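/- **Theorem 4.1 (main theorem for linear representations).** *Setting.* Let $d,k,T,n_1,n_2$ be natural numbers with $k\ge 1$ and $2k\le\min\{d,T\}$, let $\sigma\ge 0$, and let $B^*\in\mathbb R^{d\times k}$ and $W^*=[w_1^*,\dots,w_T^*]\in\mathbb R^{k\times T}$ be arbitrary. Let $p_1,\dots,p_T$ (source tasks) and $p_{T+1}$ (target task) be centered input distributions on $\mathbb R^d$ with covariances $\Sigma_t=\mathbb E_{x\sim p_t}[xx^\top]$. An example of task $t$ is a pair $(x,y)$ with $x\sim p_t$ and $y=(w_t^*)^\top (B^*)^\top x+z$, where $z\sim\mathcal N(0,\sigma^2)$ is independent of $x$. One observes $n_1$ independent examples $(x_{t,i},y_{t,i})$ of each source task $t\in[T]$, and $n_2$ independent target examples $(x_i,y_i)$ with $y_i=(w_{T+1}^*)^\top (B^*)^\top x_i+z_i$. The target predictor $w_{T+1}^*$ is random with law $\nu$ on $\mathbb R^k$ (with finite second moments) and is independent of the source data, of the target inputs $x_i$ and of the target noise $z_i$. *Algorithm.* From the source data one computes $$(\hat B,\hat W)\in\operatorname*{arg\,min}_{B\in\mathbb R^{d\times k},\,W=[w_1,\dots,w_T]\in\mathbb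 R^{k\times T}}\ \frac1{2n_1T}\sum_{t=1}^T\sum_{i=1}^{n_1}\bigl(y_{t,i}-w_t^\top B^\top x_{t,i}\bigr)^2$$ whenever this minimum is attained, where $\hat B$ is a measurable function of the source data; then from the target data $$\hat w_{T+1}\in\operatorname*{arg\,min}_{w\in\mathbb R^k}\ \frac1{2n_2}\sum_{i=1}^{n_2}\bigl(y_i-w^\top\hat B^\top x_i\bigr)^2 .$$ The excess risk is $$\mathrm{ER}(\hat B,\hat w_{T+1})=\tfrac12\,\mathbb E_{(x,y)}\bigl(y-\hat w_{T+1}^\top\hat B^\top x\bigr)^2-\tfrac12\,\mathbb E_{(x,y)}\bigl(y-(w_{T+1}^*)^\top (B^*)^\top x\bigr)^2,$$ where $(x,y)$ is a fresh example of the target task. *Assumptions.* 1. (Subgaussian inputs.) There is $\rho$ such that for every $t\in[T+1]$, $x\sim p_t$ can be generated as $x=\Sigma_t^{1/2}\bar x$ with $\mathbb E[\bar x]=0$, $\mathbb E[\bar x\bar x^\top]=I$ and $\mathbb E[e^{s v^\top\bar x}]\le e^{s^2\rho^2/2}$ for all unit vectors $v$ and all $s\in\mathbb R$. 2. (Covariance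 dominance.) $c>0$ and $\Sigma_t\succeq c\,\Sigma_{T+1}$ for all $t\in[T]$. Moreover $\Sigma_t\succ0$ for $t\in[T]$, so that $\kappa=\dfrac{\max_{t\in[T]}\lambda_{\max}(\Sigma_t)}{\min_{t\in[T]}\lambda_{\min}(\Sigma_t)}$ is finite. 3. (Diverse source tasks.) $\sigma_k^2(W^*)\ge c_1T/k$, where $\sigma_k(W^*)$ is the $k$-th largest singular value of $W^*$. 4. (Target task distribution.) $\bigl\|\mathbb E_{w\sim\nu}[ww^\top]\bigr\|\le C_2/k$ in operator norm. *Claim.* There is a universal constant $C_0>0$, and for all $c_1,C_2>0$ there is a constant $C>0$ depending only on $c_1$ and $C_2$, such that for every $\delta\in(0,1)$, in the above setting and under assumptions 1–4, if $$n_1\ge C_0\,\rho^4\Bigl(d+\log\frac T\delta\Bigr),\qquad n_2\ge C_0\,\rho^4\Bigl(k+\log\frac1\delta\Bigr),\qquad c\,n_1\ge n_2,$$ then with probability at least $1-\delta$ over the source data and the target inputs and target noise, the excess risk is $\nu$-integrable as a function of $w_{T+1}^*$ and $$\mathbb E_{w_{T+1}^*\sim\nu}\bigl[\mathrm{ER}(\hat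 B,\hat w_{T+1})\bigr]\le C\,\sigma^2\left(\frac{kd\log(\kappa n_1)}{c\,n_1T}+\frac{k+\log\frac1\delta}{n_2}\right).$$ -/

import Mathlib

open MeasureTheory ProbabilityTheory Matrix
open scoped NNReal

namespace RepLearn

/-- Second moment matrix `E[x xᵀ]` of a distribution on `ℝᵐ`
(the covariance matrix when the distribution is centered). -/
noncomputable def secondMoment {m : ℕ} (p : Measure (Fin m → ℝ)) : Matrix (Fin m) (Fin m) ℝ :=
  Matrix.of fun i j => ∫ x, x i * x j ∂p

/-- Mean vector `E[x]` of a distribution on `ℝᵐ`. -/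
noncomputable def meanVec {m : ℕ} (p : Measure (Fin m → ℝ)) : Fin m → ℝ :=
  fun i => ∫ x, x i ∂p

/-- A random vector with law `q` is `ρ²`-subgaussian: for every unit vector `v` and every real `s`,
`E[exp (s * vᵀ(x - E x))]` is finite and at most `exp (s² ρ² / 2)`. -/
def IsSubgaussianVector {m : ℕ} (q : Measure (Fin m → ℝ)) (ρ : ℝ≥0) : Prop :=
  ∀ v : Fin m → ℝ, v ⬝ᵥ v = 1 → HasSubgaussianMGF (fun x => v ⬝ᵥ (x - meanVec q)) (ρ ^ 2) q

/-- `q` is a whitening of `p`: `q` is centered with identity covariance, and `x ∼ p` is generated as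
`x = Σ^{1/2} x'` with `x' ∼ q`, where `Σ = E_p[x xᵀ]` and `Σ^{1/2}` is the positive semidefinite
square root of `Σ`. In particular `p` is then centered. -/
structure IsWhitening {d : ℕ} (q p : Measure (Fin d → ℝ)) : Prop where
  mean_zero : meanVec q = 0
  isotropic : secondMoment q = 1
  map_sqrt : ∃ S : Matrix (Fin d) (Fin d) ℝ,
    S.PosSemidef ∧ S * S = secondMoment p ∧ p = q.map (fun x => S *ᵥ x)

/-- Centered input distribution whose whitening is `ρ²`-subgaussian. -/
def IsSubgaussianInput {d : ℕ} (ρ : ℝ≥0) (p : Measure (Fin d → ℝ)) : Prop :=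
  ∃ q : Measure (Fin d → ℝ), IsProbabilityMeasure q ∧ IsWhitening q p ∧ IsSubgaussianVector q ρ

/-- Largest eigenvalue of a real symmetric matrix. -/
noncomputable def lamMax {m : ℕ} (A : Matrix (Fin m) (Fin m) ℝ) : ℝ := sSup (spectrum ℝ A)

/-- Smallest eigenvalue of a real symmetric matrix. -/
noncomputable def lamMin {m : ℕ} (A : Matrix (Fin m) (Fin m) ℝ) : ℝ := sInf (spectrum ℝ A)

/-- `κ = max_t λ_max(Σ_t) / min_t λ_min(Σ_t)` over the source input distributions. -/
noncomputable def kappa {d T : ℕ} (p : Fin T → Measure (Fin d → ℝ)) : ℝ :=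
  (⨆ t, lamMax (secondMoment (p t))) / (⨅ t, lamMin (secondMoment (p t)))

/-- The predictor `x ↦ wᵀ Bᵀ x`. -/
def predict {d k : ℕ} (B : Matrix (Fin d) (Fin k) ℝ) (w : Fin k → ℝ) (x : Fin d → ℝ) : ℝ :=
  w ⬝ᵥ (Bᵀ *ᵥ x)

/-- Law of a labelled example `(x, y)` with `x ∼ p`, `y = wᵀ Bᵀ x + z` and independent noise
`z ∼ N(0, σ²)`. -/
noncomputable def taskLaw {d k : ℕ} (p : Measure (Fin d → ℝ)) (B : Matrix (Fin d) (Fin k) ℝ)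
    (w : Fin k → ℝ) (σ : ℝ≥0) : Measure ((Fin d → ℝ) × ℝ) :=
  (p.prod (gaussianReal 0 (σ ^ 2))).map fun a => (a.1, predict B w a.1 + a.2)

/-- Population loss `L_μ(B, w) = E_{(x, y) ∼ μ} ½ (y - wᵀ Bᵀ x)²`. -/
noncomputable def popLoss {d k : ℕ} (μ : Measure ((Fin d → ℝ) × ℝ))
    (B : Matrix (Fin d) (Fin k) ℝ) (w : Fin k → ℝ) : ℝ :=
  ∫ a, (1 / 2 : ℝ) * (a.2 - predict B w a.1) ^ 2 ∂μ

/-- Excess risk of the model `(B, w)` over the ground truth `(Bs, ws)` on the task with input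
distribution `p` and noise level `σ`. -/
noncomputable def excessRisk {d k : ℕ} (p : Measure (Fin d → ℝ)) (σ : ℝ≥0)
    (Bs : Matrix (Fin d) (Fin k) ℝ) (ws : Fin k → ℝ)
    (B : Matrix (Fin d) (Fin k) ℝ) (w : Fin k → ℝ) : ℝ :=
  popLoss (taskLaw p Bs ws σ) B w - popLoss (taskLaw p Bs ws σ) Bs ws

/-- A source data set: `n₁` labelled examples for each of the `T` source tasks. -/
abbrev SourceData (d T n₁ : ℕ) : Type := Fin T → Fin n₁ → (Fin d → ℝ) × ℝ

/-- A target data set: `n₂` labelled examples. -/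
abbrev TargetData (d n₂ : ℕ) : Type := Fin n₂ → (Fin d → ℝ) × ℝ

/-- Training objective on the source data; the predictor of task `t` is the column `t` of `W`. -/
noncomputable def sourceObjective {d k T n₁ : ℕ} (D : SourceData d T n₁)
    (B : Matrix (Fin d) (Fin k) ℝ) (W : Matrix (Fin k) (Fin T) ℝ) : ℝ :=
  1 / (2 * (n₁ : ℝ) * (T : ℝ)) *
    ∑ t, ∑ i, ((D t i).2 - predict B (fun j => W j t) (D t i).1) ^ 2

/-- `(B, W)` minimizes the source objective over all pairs of matrices. -/
def IsSourceMinimizer {d k T n₁ : ℕ} (D : SourceData d T n₁)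
    (B : Matrix (Fin d) (Fin k) ℝ) (W : Matrix (Fin k) (Fin T) ℝ) : Prop :=
  ∀ (B' : Matrix (Fin d) (Fin k) ℝ) (W' : Matrix (Fin k) (Fin T) ℝ),
    sourceObjective D B W ≤ sourceObjective D B' W'

/-- Training objective on the target data for a fixed representation `B`. -/
noncomputable def targetObjective {d k n₂ : ℕ} (D : TargetData d n₂)
    (B : Matrix (Fin d) (Fin k) ℝ) (w : Fin k → ℝ) : ℝ :=
  1 / (2 * (n₂ : ℝ)) * ∑ i, ((D i).2 - predict B w (D i).1) ^ 2

/-- `w` minimizes the target objective for the fixed representation `B`. -/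
def IsTargetMinimizer {d k n₂ : ℕ} (D : TargetData d n₂)
    (B : Matrix (Fin d) (Fin k) ℝ) (w : Fin k → ℝ) : Prop :=
  ∀ w' : Fin k → ℝ, targetObjective D B w ≤ targetObjective D B w'

/-- Law of the source data: all examples independent, those of task `t` drawn from its task law. -/
noncomputable def sourceLaw {d k T : ℕ} (n₁ : ℕ) (p : Fin T → Measure (Fin d → ℝ))
    (Bs : Matrix (Fin d) (Fin k) ℝ) (Ws : Matrix (Fin k) (Fin T) ℝ) (σ : ℝ≥0) :
    Measure (SourceData d T n₁) :=
  Measure.pi fun t => Measure.pi fun _ : Fin n₁ => taskLaw (p t) Bs (fun j => Ws j t) σ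

/-- Law of the `n₂` independent pairs (input, noise) of the target task. The labels are formed from
these and from the random target predictor, see `targetSample`. -/
noncomputable def targetNoiseLaw {d : ℕ} (n₂ : ℕ) (p : Measure (Fin d → ℝ)) (σ : ℝ≥0) :
    Measure (Fin n₂ → (Fin d → ℝ) × ℝ) :=
  Measure.pi fun _ : Fin n₂ => p.prod (gaussianReal 0 (σ ^ 2))

/-- The target data set `y i = wᵀ Bsᵀ (x i) + z i` formed from the pairs `(x i, z i)`. -/
def targetSample {d k n₂ : ℕ} (Bs : Matrix (Fin d) (Fin k) ℝ) (w : Fin k → ℝ)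
    (ω : Fin n₂ → (Fin d → ℝ) × ℝ) : TargetData d n₂ :=
  fun i => ((ω i).1, predict Bs w (ω i).1 + (ω i).2)

end RepLearn

open RepLearn

/-!
The excess risk of a predictor is half the squared norm of its error in the target covariance `Σ₀`
(`excessRisk_eq`), so two quantities have to be controlled: how well the learned representation can
do on a target task, and how well least squares on top of it does with `n₂` samples.

*Source stage.* A minimizer `(B̂, Ŵ)` satisfies the basic inequality `|X Δ|² ≤ 2 ⟨z, X Δ⟩` for the
error `Δ = B̂ Ŵ - B* W*`, whose rank is at most `2k`. Thus `Δ = V R` with a left factor `V` of width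
`2k` with entries in `[-1, 1]` (`exists_factor_mul_sub_mul`). For a fixed `V` the fitted values of
`V R` form a linear space of dimension at most `2kT`, and the supremum over `R` of
`2 ⟨z, X V R⟩ - |X V R|²` is a chi-square variable, whose tail is found by linearizing the square
with an auxiliary Gaussian vector (`IsSubStdGaussian.measure_exists_lt_le`). A union bound over all
`V` on a grid of mesh polynomial in `1 / (κ n₁)` costs `kd log (κ n₁)`, and the rounding error is
absorbed because the empirical covariances are comparable with the population ones. Altogether the
in-sample error is of order `σ² (kT + kd log (κ n₁) + log (1 / δ))`
(`RepLearn.IsSourceMinimizer.sum_sq_error_le`). Comparability of the covariances comes from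
Bernstein's inequality for squares of subgaussian variables and a net of the unit ball
(`RepLearn.IsSubgaussianInput.measure_not_forall_le`); it turns the in-sample error into a bound on
`c n₁ ∑ₜ Δₜᵀ Σ₀ Δₜ` by covariance dominance. It also makes the objective coercive, so that its
minimum is attained (`SourceCovGood.exists_isSourceMinimizer`) and `(B̂, Ŵ)` is indeed a minimizer.

*Target stage.* Conditionally on `B̂`, least squares in dimension `k` competes with every predictor
`B̂ u` up to a noise term of order `σ² (k + log (1 / δ)) / n₂` (`TargetGood.error_le`), on an event
that does not depend on the target predictor `w`. The competitor is `u = Ŵ P w`, with a right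
inverse `P` of `W*` of squared norm at most `k / (c₁ T)`, which exists by task diversity
(`exists_right_inverse_of_le_singularValues`). Its error is `-Δ P w`, and since
`E[w wᵀ] ≤ C₂ / k` its average over `w` is at most `C₂ / (c₁ T) ∑ₜ Δₜᵀ Σ₀ Δₜ`
(`integral_transfer_le`). Finally `n₂ ≤ c n₁` absorbs the parts of the source error that are not of
the form `kd log (κ n₁) / (c n₁ T)`.
-/

/-! ### Vectors dominated by a standard Gaussian -/

theorem lintegral_pi_prod {ι : Type*} [Fintype ι] {X : ι → Type*} [∀ i, MeasurableSpace (X i)]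
    (μ : ∀ i, Measure (X i)) [∀ i, IsProbabilityMeasure (μ i)] (f : ∀ i, X i → ENNReal)
    (hf : ∀ i, Measurable (f i)) :
    ∫⁻ x, ∏ i, f i (x i) ∂Measure.pi μ = ∏ i, ∫⁻ x, f i x ∂μ i := by
  have hind : iIndepFun (fun i (x : ∀ i, X i) => f i (x i)) (Measure.pi μ) :=
    iIndepFun_pi (fun i => (hf i).aemeasurable)
  have := lintegral_prod_eq_prod_lintegral_of_indepFun (μ := Measure.pi μ) Finset.univ
    (fun i (x : ∀ i, X i) => f i (x i)) hind (fun i => (hf i).comp (measurable_pi_apply i))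
  rw [this]
  refine Finset.prod_congr rfl fun i _ => ?_
  exact (measurePreserving_eval μ i).lintegral_comp (hf i)

theorem lintegral_exp_mul_gaussian (t : ℝ) :
    ∫⁻ x, ENNReal.ofReal (Real.exp (t * x)) ∂gaussianReal 0 1 =
      ENNReal.ofReal (Real.exp (t ^ 2 / 2)) := by
  rw [← ofReal_integral_eq_lintegral_ofReal (integrable_exp_mul_gaussianReal t)
    (Filter.Eventually.of_forall fun x => (Real.exp_pos _).le)]
  have := congrFun (mgf_id_gaussianReal (μ := 0) (v := 1)) t
  simp [mgf] at this
  rw [this]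

theorem lintegral_exp_sq_gaussian :
    ∫⁻ x, ENNReal.ofReal (Real.exp (x ^ 2 / 4)) ∂gaussianReal 0 1 = ENNReal.ofReal (√2) := by
  rw [gaussianReal_of_var_ne_zero 0 one_ne_zero,
    lintegral_withDensity_eq_lintegral_mul _ (measurable_gaussianPDF 0 1) (by fun_prop)]
  -- the Gaussian density of variance `2` appears, up to the factor `√2`
  have h : ∀ x : ℝ, (gaussianPDF 0 1 * fun x => ENNReal.ofReal (Real.exp (x ^ 2 / 4))) x =
      ENNReal.ofReal (√2) * gaussianPDF 0 2 x := by
    intro x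
    simp only [Pi.mul_apply, gaussianPDF]
    rw [← ENNReal.ofReal_mul (gaussianPDFReal_nonneg _ _ _), ← ENNReal.ofReal_mul (by positivity)]
    congr 1
    simp only [gaussianPDFReal, NNReal.coe_one, sub_zero, NNReal.coe_ofNat, mul_one]
    rw [mul_assoc, ← Real.exp_add, show (2 : ℝ) * Real.pi * 2 = 2 * (2 * Real.pi) by ring,
      Real.sqrt_mul (by norm_num : (0 : ℝ) ≤ 2) (2 * Real.pi)]
    have : √2 ≠ 0 := by positivity
    have : √(2 * Real.pi) ≠ 0 := by positivity
    field_simp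
    ring_nf
  simp_rw [h]
  rw [lintegral_const_mul _ (measurable_gaussianPDF 0 2),
    lintegral_gaussianPDF_eq_one 0 two_ne_zero, mul_one]

/-- The random vector `Y` is dominated by a standard Gaussian vector:
`E exp (a · Y) ≤ exp (|a|² / 2)` for every `a`. -/
def IsSubStdGaussian {Ω ι : Type*} [MeasurableSpace Ω] [Fintype ι] (Y : Ω → ι → ℝ)
    (μ : Measure Ω) : Prop :=
  ∀ a : ι → ℝ, ∫⁻ ω, ENNReal.ofReal (Real.exp (∑ i, a i * Y ω i)) ∂μ ≤
    ENNReal.ofReal (Real.exp ((∑ i, a i ^ 2) / 2))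

/-- A standard Gaussian vector `g` linearizes the square, `exp (|Y|² / 4) = E exp (Y · g / √2)`;
exchanging the two expectations compares `Y` with a standard Gaussian vector. -/
theorem IsSubStdGaussian.lintegral_exp_sq_le {Ω ι : Type*} [MeasurableSpace Ω] [Fintype ι]
    {Y : Ω → ι → ℝ} {μ : Measure Ω} [SFinite μ] (hY : IsSubStdGaussian Y μ) (hm : Measurable Y) :
    ∫⁻ ω, ENNReal.ofReal (Real.exp ((∑ i, Y ω i ^ 2) / 4)) ∂μ ≤
      ENNReal.ofReal (√2 ^ Fintype.card ι) := by
  have hexp : ∀ f : ι → ℝ, ENNReal.ofReal (Real.exp (∑ i, f i)) =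
      ∏ i, ENNReal.ofReal (Real.exp (f i)) := fun f => by
    rw [Real.exp_sum, ENNReal.ofReal_prod_of_nonneg fun i _ => (Real.exp_pos _).le]
  have h1 : ∀ ω, ENNReal.ofReal (Real.exp ((∑ i, Y ω i ^ 2) / 4)) =
      ∫⁻ g, ENNReal.ofReal (Real.exp (∑ i, Y ω i / √2 * g i))
        ∂Measure.pi fun _ : ι => gaussianReal 0 1 := by
    intro ω
    simp_rw [hexp]
    rw [lintegral_pi_prod (fun _ : ι => gaussianReal 0 1)
      (fun i x => ENNReal.ofReal (Real.exp (Y ω i / √2 * x))) (fun i => by fun_prop)]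
    simp_rw [lintegral_exp_mul_gaussian]
    rw [Finset.sum_div, hexp]
    refine Finset.prod_congr rfl fun i _ => ?_
    congr 2
    rw [div_pow, Real.sq_sqrt (by norm_num)]
    ring
  have hm' : ∀ i, Measurable fun ω => Y ω i := fun i => (measurable_pi_apply i).comp hm
  simp_rw [h1]
  rw [lintegral_lintegral_swap]
  · calc _ ≤ ∫⁻ g : ι → ℝ, ∏ i, ENNReal.ofReal (Real.exp (g i ^ 2 / 4))
        ∂Measure.pi fun _ : ι => gaussianReal 0 1 := by
          refine lintegral_mono fun g => ?_
          have := hY (fun i => g i / √2)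
          rw [← hexp]
          convert this using 1
          · refine lintegral_congr fun ω => ?_
            congr 2
            exact Finset.sum_congr rfl fun i _ => by ring
          · congr 2
            rw [Finset.sum_div]
            refine Finset.sum_congr rfl fun i _ => ?_
            rw [div_pow, Real.sq_sqrt (by norm_num)]
            ring
      _ = _ := by
          rw [lintegral_pi_prod (fun _ : ι => gaussianReal 0 1)
            (fun i x => ENNReal.ofReal (Real.exp (x ^ 2 / 4))) (fun i => by fun_prop)]
          simp_rw [lintegral_exp_sq_gaussian]
          rw [Finset.prod_const, ENNReal.ofReal_pow (by positivity)]
          rfl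
  · apply Measurable.aemeasurable
    simp only [Function.uncurry_def]
    apply ENNReal.measurable_ofReal.comp
    apply Real.measurable_exp.comp
    refine Finset.measurable_sum _ fun i _ => ?_
    exact (((hm' i).comp measurable_fst).div_const _).mul
      ((measurable_pi_apply i).comp measurable_snd)

/-- Markov's inequality for the squared norm of a vector dominated by a standard Gaussian. -/
theorem IsSubStdGaussian.measure_sq_gt_le {Ω ι : Type*} [MeasurableSpace Ω] [Fintype ι]
    {Y : Ω → ι → ℝ} {μ : Measure Ω} [SFinite μ] (hY : IsSubStdGaussian Y μ) (hm : Measurable Y)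
    {r : ℕ} (hr : Fintype.card ι ≤ r) (L : ℝ) :
    μ {ω | 4 * (r + L) < ∑ i, Y ω i ^ 2} ≤ ENNReal.ofReal (Real.exp (-L)) := by
  have hm' : ∀ i, Measurable fun ω => Y ω i := fun i => (measurable_pi_apply i).comp hm
  have h := hY.lintegral_exp_sq_le hm
  have hM := mul_meas_ge_le_lintegral (μ := μ)
    (f := fun ω => ENNReal.ofReal (Real.exp ((∑ i, Y ω i ^ 2) / 4)))
    (by fun_prop) (ENNReal.ofReal (Real.exp (r + L)))
  have hsub : {ω | 4 * (r + L) < ∑ i, Y ω i ^ 2} ⊆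
      {ω | ENNReal.ofReal (Real.exp (r + L)) ≤
        ENNReal.ofReal (Real.exp ((∑ i, Y ω i ^ 2) / 4))} := by
    intro ω hω
    simp only [Set.mem_ofPred_eq] at hω ⊢
    apply ENNReal.ofReal_le_ofReal
    apply Real.exp_le_exp.2
    linarith
  have h2 : (√2) ^ Fintype.card ι ≤ Real.exp r := by
    have h3 : √2 ≤ Real.exp 1 := by
      have : √2 ≤ 2 := by rw [Real.sqrt_le_left (by norm_num)]; norm_num
      have := Real.add_one_le_exp (1 : ℝ)
      linarith
    calc (√2) ^ Fintype.card ι ≤ (Real.exp 1) ^ Fintype.card ι := by gcongr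
      _ ≤ (Real.exp 1) ^ r := pow_le_pow_right₀ (Real.one_le_exp (by norm_num)) hr
      _ = _ := by rw [← Real.exp_nat_mul]; simp
  have h4 : ENNReal.ofReal (Real.exp (r + L)) * μ {ω | 4 * (r + L) < ∑ i, Y ω i ^ 2} ≤
      ENNReal.ofReal (Real.exp r) := by
    refine (mul_le_mul_right (measure_mono hsub) _).trans (hM.trans (h.trans ?_))
    exact ENNReal.ofReal_le_ofReal h2
  have h5 : ENNReal.ofReal (Real.exp (-L)) =
      ENNReal.ofReal (Real.exp r) / ENNReal.ofReal (Real.exp (r + L)) := by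
    rw [← ENNReal.ofReal_div_of_pos (Real.exp_pos _), ← Real.exp_sub]
    congr 2; ring
  rw [h5, ENNReal.le_div_iff_mul_le (Or.inl (by simp [Real.exp_pos])) (Or.inl (by simp)), mul_comm]
  exact h4

theorem isSubStdGaussian_pi {ι : Type*} [Fintype ι] :
    IsSubStdGaussian (fun g : ι → ℝ => g) (Measure.pi fun _ : ι => gaussianReal 0 1) := by
  intro a
  have hexp : ∀ f : ι → ℝ, ENNReal.ofReal (Real.exp (∑ i, f i)) =
      ∏ i, ENNReal.ofReal (Real.exp (f i)) := fun f => by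
    rw [Real.exp_sum, ENNReal.ofReal_prod_of_nonneg fun i _ => (Real.exp_pos _).le]
  rw [Finset.sum_div, hexp]
  simp_rw [hexp]
  rw [lintegral_pi_prod (fun _ : ι => gaussianReal 0 1)
      (fun i x => ENNReal.ofReal (Real.exp (a i * x))) (fun i => by fun_prop)]
  simp_rw [lintegral_exp_mul_gaussian]
  exact le_rfl

theorem isSubStdGaussian_pi_pi {κ ι : Type*} [Fintype κ] [Fintype ι] :
    IsSubStdGaussian (fun (g : κ → ι → ℝ) (s : κ × ι) => g s.1 s.2)
      (Measure.pi fun _ : κ => Measure.pi fun _ : ι => gaussianReal 0 1) := by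
  intro a
  have hexp : ∀ f : κ → ℝ, ENNReal.ofReal (Real.exp (∑ i, f i)) =
      ∏ i, ENNReal.ofReal (Real.exp (f i)) := fun f => by
    rw [Real.exp_sum, ENNReal.ofReal_prod_of_nonneg fun i _ => (Real.exp_pos _).le]
  simp_rw [Fintype.sum_prod_type]
  rw [Finset.sum_div, hexp]
  simp_rw [hexp]
  rw [lintegral_pi_prod (fun _ : κ => Measure.pi fun _ : ι => gaussianReal 0 1)
      (fun t x => ENNReal.ofReal (Real.exp (∑ i, a (t, i) * x i))) (fun i => by fun_prop)]
  exact Finset.prod_le_prod' fun t _ => isSubStdGaussian_pi fun i => a (t, i)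

/-- A supremum of linear functionals of the noise penalised by a quadratic. It is at most the
squared norm of the projection of the noise onto the range of `A`, so that only the dimension of
`E` matters. -/
theorem IsSubStdGaussian.measure_exists_lt_le {Ω ι E : Type*} [MeasurableSpace Ω] [Fintype ι]
    [AddCommGroup E] [Module ℝ E] [FiniteDimensional ℝ E]
    {z : Ω → ι → ℝ} {μ : Measure Ω} [SFinite μ] (hz : IsSubStdGaussian z μ) (hm : Measurable z)
    (A : E →ₗ[ℝ] ι → ℝ) {r : ℕ} (hr : Module.finrank ℝ E ≤ r) (L σ : ℝ) :
    μ {ω | ∃ u, σ ^ 2 * (4 * (r + L)) < 2 * ∑ i, (σ * z ω i) * A u i - ∑ i, A u i ^ 2} ≤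
      ENNReal.ofReal (Real.exp (-L)) := by
  have hm' : ∀ i, Measurable fun ω => z ω i := fun i => (measurable_pi_apply i).comp hm
  let A' : E →ₗ[ℝ] EuclideanSpace ℝ ι := (WithLp.linearEquiv 2 ℝ (ι → ℝ)).symm.toLinearMap ∘ₗ A
  let F := LinearMap.range A'
  let b := stdOrthonormalBasis ℝ F
  let Y : Ω → Fin (Module.finrank ℝ F) → ℝ := fun ω j => ∑ i, z ω i * (b j : EuclideanSpace ℝ ι) i
  have hAF : ∀ u, ∃ c : Fin (Module.finrank ℝ F) → ℝ,
      (∀ i, A u i = ∑ j, c j * (b j : EuclideanSpace ℝ ι) i) := by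
    intro u
    refine ⟨fun j => b.repr ⟨A' u, LinearMap.mem_range_self _ _⟩ j, fun i => ?_⟩
    have h := b.sum_repr ⟨A' u, LinearMap.mem_range_self _ _⟩
    have h2 := congrArg (fun v : F => (v : EuclideanSpace ℝ ι) i) h
    simp only [Submodule.coe_sum, Submodule.coe_smul, WithLp.ofLp_sum, Finset.sum_apply,
      PiLp.smul_apply, smul_eq_mul] at h2
    rw [h2]
    rfl
  have hc : ∀ c : Fin (Module.finrank ℝ F) → ℝ,
      ∑ i, (∑ j, c j * (b j : EuclideanSpace ℝ ι) i) ^ 2 = ∑ j, c j ^ 2 := by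
    intro c
    have h := b.repr.symm.norm_map (WithLp.toLp 2 c)
    rw [← sq_eq_sq₀ (norm_nonneg _) (norm_nonneg _), EuclideanSpace.real_norm_sq_eq] at h
    rw [← b.sum_repr_symm, Submodule.coe_norm, EuclideanSpace.real_norm_sq_eq] at h
    simpa using h
  have hY : IsSubStdGaussian Y μ := by
    intro c
    have := hz fun i => ∑ j, c j * (b j : EuclideanSpace ℝ ι) i
    rw [hc] at this
    refine le_of_eq_of_le (lintegral_congr fun ω => ?_) this
    congr 2
    simp only [Y, Finset.mul_sum, Finset.sum_mul]
    rw [Finset.sum_comm]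
    exact Finset.sum_congr rfl fun i _ => Finset.sum_congr rfl fun j _ => by ring
  have hYm : Measurable Y := by
    refine measurable_pi_lambda _ fun j => Finset.measurable_sum _ fun i _ => (hm' i).mul_const _
  have hr' : Fintype.card (Fin (Module.finrank ℝ F)) ≤ r := by
    rw [Fintype.card_fin]
    exact (LinearMap.finrank_range_le A').trans hr
  refine (measure_mono ?_).trans (hY.measure_sq_gt_le hYm hr' L)
  rintro ω ⟨u, hu⟩
  obtain ⟨c, hcu⟩ := hAF u
  simp only [hcu, hc] at hu
  have h1 : ∑ i, (σ * z ω i) * ∑ j, c j * (b j : EuclideanSpace ℝ ι) i =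
      ∑ j, σ * (c j * Y ω j) := by
    simp only [Y, Finset.mul_sum]
    rw [Finset.sum_comm]
    exact Finset.sum_congr rfl fun i _ => Finset.sum_congr rfl fun j _ => by ring
  rw [h1] at hu
  have h2 : 2 * ∑ j, σ * (c j * Y ω j) - ∑ j, c j ^ 2 ≤ σ ^ 2 * ∑ j, Y ω j ^ 2 := by
    rw [Finset.mul_sum, Finset.mul_sum, ← Finset.sum_sub_distrib]
    exact Finset.sum_le_sum fun j _ => by nlinarith [sq_nonneg (σ * Y ω j - c j)]
  have h3 := hu.trans_le h2
  exact lt_of_mul_lt_mul_left h3 (sq_nonneg σ)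

/-! ### The data as images of inputs and standard Gaussian noise -/

theorem gaussianReal_sq_eq_map (σ : ℝ≥0) :
    gaussianReal 0 (σ ^ 2) = (gaussianReal 0 1).map fun x => (σ : ℝ) * x := by
  rw [gaussianReal_map_const_mul]
  congr 1
  · simp
  · ext; simp

/-- Independent pairs of an input and a noise of variance `σ²` are obtained from inputs and standard
Gaussian noises that are independent as families. -/
theorem pi_prod_gaussian_eq_map {ι α : Type*} [Fintype ι] [MeasurableSpace α] (p : ι → Measure α)
    [∀ i, IsProbabilityMeasure (p i)] (σ : ℝ≥0) :
    (Measure.pi fun i => (p i).prod (gaussianReal 0 (σ ^ 2))) =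
      ((Measure.pi p).prod (Measure.pi fun _ : ι => gaussianReal 0 1)).map
        fun a i => (a.1 i, (σ : ℝ) * a.2 i) := by
  have h1 := (measurePreserving_arrowProdEquivProdArrow α ℝ ι p
    (fun _ => gaussianReal 0 1)).symm.map_eq
  have h2 : ∀ i, (p i).prod (gaussianReal 0 (σ ^ 2)) =
      ((p i).prod (gaussianReal 0 1)).map (Prod.map id fun x => (σ : ℝ) * x) := by
    intro i
    rw [gaussianReal_sq_eq_map]
    conv_lhs => rw [← Measure.map_id (μ := p i)]
    exact Measure.map_prod_map _ _ measurable_id (by fun_prop)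
  simp_rw [h2]
  have hmm : Measurable (Prod.map id fun x : ℝ => (σ : ℝ) * x : α × ℝ → α × ℝ) := by fun_prop
  rw [← Measure.pi_map_pi (fun i => hmm.aemeasurable), ← h1,
    Measure.map_map (by fun_prop) (MeasurableEquiv.measurable _)]
  rfl

@[fun_prop]
theorem measurable_predict {d k : ℕ} (B : Matrix (Fin d) (Fin k) ℝ) (w : Fin k → ℝ) :
    Measurable (predict B w) := by
  unfold predict dotProduct mulVec dotProduct
  fun_prop

instance isProbabilityMeasure_taskLaw {d k : ℕ} (p : Measure (Fin d → ℝ)) [IsProbabilityMeasure p]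
    (B : Matrix (Fin d) (Fin k) ℝ) (w : Fin k → ℝ) (σ : ℝ≥0) :
    IsProbabilityMeasure (taskLaw p B w σ) := by
  unfold taskLaw
  exact Measure.isProbabilityMeasure_map (by fun_prop)

/-- The source data set with inputs `X` and noise `σ G`. -/
def sourceSample {d k T n : ℕ} (Bs : Matrix (Fin d) (Fin k) ℝ) (Ws : Matrix (Fin k) (Fin T) ℝ)
    (σ : ℝ) (a : (Fin T → Fin n → Fin d → ℝ) × (Fin T → Fin n → ℝ)) : SourceData d T n :=
  fun t i => (a.1 t i, predict Bs (fun j => Ws j t) (a.1 t i) + σ * a.2 t i)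

theorem measurable_sourceSample {d k T n : ℕ} (Bs : Matrix (Fin d) (Fin k) ℝ)
    (Ws : Matrix (Fin k) (Fin T) ℝ) (σ : ℝ) :
    Measurable (sourceSample (n := n) Bs Ws σ) := by
  unfold sourceSample
  refine measurable_pi_lambda _ fun t => measurable_pi_lambda _ fun i => ?_
  have : Measurable fun a : (Fin T → Fin n → Fin d → ℝ) × (Fin T → Fin n → ℝ) => a.1 t i := by
    fun_prop
  exact this.prodMk (((measurable_predict _ _).comp this).add (by fun_prop))

theorem sourceLaw_eq_map {d k T : ℕ} (n : ℕ) (p : Fin T → Measure (Fin d → ℝ))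
    [∀ t, IsProbabilityMeasure (p t)] (Bs : Matrix (Fin d) (Fin k) ℝ)
    (Ws : Matrix (Fin k) (Fin T) ℝ) (σ : ℝ≥0) :
    sourceLaw n p Bs Ws σ =
      ((Measure.pi fun t => Measure.pi fun _ : Fin n => p t).prod
        (Measure.pi fun _ : Fin T => Measure.pi fun _ : Fin n => gaussianReal 0 1)).map
        (sourceSample Bs Ws σ) := by
  have h1 : ∀ t, (Measure.pi fun _ : Fin n => taskLaw (p t) Bs (fun j => Ws j t) σ) =
      ((Measure.pi fun _ : Fin n => p t).prod (Measure.pi fun _ : Fin n => gaussianReal 0 1)).map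
        (fun a i => (a.1 i, predict Bs (fun j => Ws j t) (a.1 i) + σ * a.2 i)) := by
    intro t
    have hm : Measurable fun a : (Fin d → ℝ) × ℝ =>
        (a.1, predict Bs (fun j => Ws j t) a.1 + a.2) := by fun_prop
    have : ∀ i : Fin n, IsProbabilityMeasure (((p t).prod (gaussianReal 0 (σ ^ 2))).map
        fun a => (a.1, predict Bs (fun j => Ws j t) a.1 + a.2)) :=
      fun i => isProbabilityMeasure_taskLaw _ _ _ _
    unfold taskLaw
    rw [← Measure.pi_map_pi (fun i => hm.aemeasurable),
      pi_prod_gaussian_eq_map (fun _ : Fin n => p t), Measure.map_map (by fun_prop) (by fun_prop)]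
    rfl
  have h2 := (measurePreserving_arrowProdEquivProdArrow (Fin n → Fin d → ℝ) (Fin n → ℝ) (Fin T)
    (fun t => Measure.pi fun _ : Fin n => p t)
    (fun _ => Measure.pi fun _ : Fin n => gaussianReal 0 1)).symm.map_eq
  have hmm : ∀ t, Measurable fun (a : (Fin n → Fin d → ℝ) × (Fin n → ℝ)) (i : Fin n) =>
      (a.1 i, predict Bs (fun j => Ws j t) (a.1 i) + σ * a.2 i) := by
    intro t
    refine measurable_pi_lambda _ fun i => ?_
    have : Measurable fun a : (Fin n → Fin d → ℝ) × (Fin n → ℝ) => a.1 i := by fun_prop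
    exact this.prodMk (((measurable_predict _ _).comp this).add (by fun_prop))
  have hprob : ∀ t, IsProbabilityMeasure (((Measure.pi fun _ : Fin n => p t).prod
      (Measure.pi fun _ : Fin n => gaussianReal 0 1)).map
        (fun a i => (a.1 i, predict Bs (fun j => Ws j t) (a.1 i) + σ * a.2 i))) :=
    fun t => Measure.isProbabilityMeasure_map (hmm t).aemeasurable
  unfold sourceLaw
  simp_rw [h1]
  rw [← Measure.pi_map_pi (fun t => (hmm t).aemeasurable), ← h2]
  exact Measure.map_map (measurable_pi_lambda _ fun t => (hmm t).comp (measurable_pi_apply t))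
      (MeasurableEquiv.measurable _)

/-! ### Squares of scalar subgaussian variables -/

theorem one_add_sq_half_le_cosh (x : ℝ) : 1 + x ^ 2 / 2 ≤ Real.cosh x := by
  have h1 : |x| / 2 ≤ Real.sinh (|x| / 2) := Real.self_le_sinh_iff.2 (by positivity)
  have h2 : Real.cosh x = 1 + 2 * Real.sinh (|x| / 2) ^ 2 := by
    rw [← Real.cosh_abs x]
    conv_lhs => rw [show |x| = 2 * (|x| / 2) by ring, Real.cosh_two_mul, Real.cosh_sq]
    ring
  have h3 : (|x| / 2) ^ 2 ≤ Real.sinh (|x| / 2) ^ 2 := by gcongr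
  rw [div_pow, sq_abs] at h3
  linarith

section Scalar

variable {Ω : Type*} [MeasurableSpace Ω] {μ : Measure Ω} [IsProbabilityMeasure μ]
  {X : Ω → ℝ} {ρ : ℝ≥0}

/-- A subgaussian variable of second moment `1` has variance proxy at least `1 / 2`: compare
`1 + X² / 2 ≤ cosh X` with the bound on the moment generating function at `±1`. -/
theorem half_le_sq_of_hasSubgaussianMGF (hX : HasSubgaussianMGF X (ρ ^ 2) μ)
    (h1 : ∫ ω, X ω ^ 2 ∂μ = 1) :
    (1 / 2 : ℝ) ≤ (ρ : ℝ) ^ 2 := by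
  have hp := hX.mgf_le 1
  have hn := hX.mgf_le (-1)
  have ip := hX.integrable_exp_mul 1
  have in' := hX.integrable_exp_mul (-1)
  have i2 : Integrable (fun ω => X ω ^ 2) μ := (hX.memLp 2).integrable_sq
  have hle : ∫ ω, (2 + X ω ^ 2) ∂μ ≤
      ∫ ω, (Real.exp (1 * X ω) + Real.exp (-1 * X ω)) ∂μ := by
    refine integral_mono ((integrable_const _).add i2) (ip.add in') fun ω => ?_
    have := one_add_sq_half_le_cosh (X ω)
    rw [Real.cosh_eq] at this
    simp only [one_mul, neg_one_mul]
    linarith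
  rw [integral_add (integrable_const _) i2, integral_add ip in', h1] at hle
  simp only [mgf, integral_const, probReal_univ, smul_eq_mul] at hp hn hle
  by_contra! hlt
  push_cast at hp hn
  have h3 : Real.exp ((ρ : ℝ) ^ 2 / 2) ≤ Real.exp (1 / 4) := Real.exp_le_exp.2 (by linarith)
  have h4 : Real.exp (1 / 4 : ℝ) < 3 / 2 := by
    have := Real.exp_bound' (x := 1 / 4) (by norm_num) (by norm_num) (n := 2) (by norm_num)
    norm_num [Finset.sum_range_succ] at this
    linarith
  have e1 : (ρ : ℝ) ^ 2 * 1 ^ 2 / 2 = (ρ : ℝ) ^ 2 / 2 := by ring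
  have e2 : (ρ : ℝ) ^ 2 * (-1) ^ 2 / 2 = (ρ : ℝ) ^ 2 / 2 := by ring
  rw [e1] at hp
  rw [e2] at hn
  linarith

theorem lintegral_exp_sq_le_of_hasSubgaussianMGF (hX : HasSubgaussianMGF X (ρ ^ 2) μ)
    (hm : Measurable X) (hρ : 0 < ρ) :
    ∫⁻ ω, ENNReal.ofReal (Real.exp (X ω ^ 2 / (4 * ρ ^ 2))) ∂μ ≤ ENNReal.ofReal (√2) := by
  have hY : IsSubStdGaussian (fun ω (_ : Unit) => X ω / ρ) μ := by
    intro a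
    have hp := hX.mgf_le (a () / ρ)
    have ip := hX.integrable_exp_mul (a () / ρ)
    simp only [Finset.univ_unique, Finset.sum_singleton]
    have e : ∀ ω, a default * (X ω / ρ) = a () / ρ * X ω := fun ω => by
      change a () * (X ω / ρ) = _
      ring
    simp_rw [e]
    rw [← ofReal_integral_eq_lintegral_ofReal ip
      (Filter.Eventually.of_forall fun x => (Real.exp_pos _).le)]
    refine ENNReal.ofReal_le_ofReal (hp.trans (le_of_eq ?_))
    congr 1
    push_cast
    have : (ρ : ℝ) ≠ 0 := by exact_mod_cast hρ.ne'
    change _ = a () ^ 2 / 2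
    field_simp
  have := hY.lintegral_exp_sq_le (by fun_prop)
  simp only [Finset.univ_unique, Finset.sum_singleton, Fintype.card_unit, pow_one] at this
  refine le_of_eq_of_le (lintegral_congr fun ω => ?_) this
  congr 2
  rw [div_pow]
  field_simp

/-- The centred square of a subgaussian variable is subexponential. The second order remainder of
the exponential is controlled by `exp (X² / (4 ρ²))`, whose expectation is at most `√2`. -/
theorem mgf_sq_sub_one_le (hX : HasSubgaussianMGF X (ρ ^ 2) μ) (hm : Measurable X)
    (h1 : ∫ ω, X ω ^ 2 ∂μ = 1) {l : ℝ} (hl : |l| ≤ 1 / (8 * ρ ^ 2)) :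
    Integrable (fun ω => Real.exp (l * (X ω ^ 2 - 1))) μ ∧
      mgf (fun ω => X ω ^ 2 - 1) μ l ≤ Real.exp (182 * l ^ 2 * ρ ^ 4) := by
  have hρ2 := half_le_sq_of_hasSubgaussianMGF hX h1
  have hρ : 0 < (ρ : ℝ) := by
    refine ρ.coe_nonneg.lt_of_ne fun h => ?_
    rw [← h] at hρ2
    norm_num at hρ2
  have i2 : Integrable (fun ω => X ω ^ 2) μ := (hX.memLp 2).integrable_sq
  have hlin := lintegral_exp_sq_le_of_hasSubgaussianMGF hX hm (by exact_mod_cast hρ)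
  have iE : Integrable (fun ω => Real.exp (X ω ^ 2 / (4 * ρ ^ 2))) μ := by
    refine ⟨by fun_prop, ?_⟩
    rw [hasFiniteIntegral_iff_ofReal (Filter.Eventually.of_forall fun x => (Real.exp_pos _).le)]
    exact hlin.trans_lt ENNReal.ofReal_lt_top
  have hE : ∫ ω, Real.exp (X ω ^ 2 / (4 * ρ ^ 2)) ∂μ ≤ √2 := by
    rw [← ofReal_integral_eq_lintegral_ofReal iE
      (Filter.Eventually.of_forall fun x => (Real.exp_pos _).le)] at hlin
    exact (ENNReal.ofReal_le_ofReal_iff (by positivity)).1 hlin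
  have hpt : ∀ x : ℝ, Real.exp (l * x ^ 2) ≤
      1 + l * x ^ 2 + 128 * l ^ 2 * ρ ^ 4 * Real.exp (x ^ 2 / (4 * ρ ^ 2)) := by
    intro x
    have ha := Complex.norm_exp_sub_sum_le_norm_mul_exp ((l * x ^ 2 : ℝ) : ℂ) 2
    have hcast : Complex.exp ((l * x ^ 2 : ℝ) : ℂ) - ∑ m ∈ Finset.range 2,
        ((l * x ^ 2 : ℝ) : ℂ) ^ m / (m.factorial : ℂ) =
        ((Real.exp (l * x ^ 2) - (1 + l * x ^ 2) : ℝ) : ℂ) := by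
      simp [Finset.sum_range_succ]
    rw [hcast, Complex.norm_real, Complex.norm_real, Real.norm_eq_abs, Real.norm_eq_abs,
      sq_abs] at ha
    have hb := (le_abs_self _).trans ha
    have habs : |l * x ^ 2| ≤ x ^ 2 / (8 * ρ ^ 2) := by
      rw [abs_mul, abs_of_nonneg (sq_nonneg x)]
      calc |l| * x ^ 2 ≤ 1 / (8 * ρ ^ 2) * x ^ 2 := by gcongr
        _ = _ := by ring
    have hc : (x ^ 2 / (8 * ρ ^ 2)) ^ 2 ≤ 2 * Real.exp (x ^ 2 / (8 * ρ ^ 2)) := by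
      have := Real.quadratic_le_exp_of_nonneg (x := x ^ 2 / (8 * ρ ^ 2)) (by positivity)
      have : 0 ≤ x ^ 2 / (8 * (ρ : ℝ) ^ 2) := by positivity
      linarith
    have hx4 : (l * x ^ 2) ^ 2 ≤ 128 * l ^ 2 * ρ ^ 4 * Real.exp (x ^ 2 / (8 * ρ ^ 2)) := by
      have e : (l * x ^ 2) ^ 2 = 64 * l ^ 2 * ρ ^ 4 * (x ^ 2 / (8 * ρ ^ 2)) ^ 2 := by
        field_simp
        ring
      rw [e]
      calc 64 * l ^ 2 * (ρ : ℝ) ^ 4 * (x ^ 2 / (8 * ρ ^ 2)) ^ 2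
          ≤ 64 * l ^ 2 * ρ ^ 4 * (2 * Real.exp (x ^ 2 / (8 * ρ ^ 2))) := by gcongr
        _ = _ := by ring
    have hd : (l * x ^ 2) ^ 2 * Real.exp |l * x ^ 2| ≤
        128 * l ^ 2 * ρ ^ 4 * Real.exp (x ^ 2 / (4 * ρ ^ 2)) := by
      calc (l * x ^ 2) ^ 2 * Real.exp |l * x ^ 2| ≤
          128 * l ^ 2 * ρ ^ 4 * Real.exp (x ^ 2 / (8 * ρ ^ 2)) *
            Real.exp (x ^ 2 / (8 * ρ ^ 2)) := by gcongr
        _ = _ := by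
          rw [mul_assoc, ← Real.exp_add]
          congr 2
          field_simp
          ring
    linarith
  have iR : Integrable (fun ω => 1 + l * X ω ^ 2 +
      128 * l ^ 2 * ρ ^ 4 * Real.exp (X ω ^ 2 / (4 * ρ ^ 2))) μ :=
    ((integrable_const _).add (i2.const_mul l)).add (iE.const_mul _)
  have iL : Integrable (fun ω => Real.exp (l * X ω ^ 2)) μ := by
    refine iR.mono' (by fun_prop) (Filter.Eventually.of_forall fun ω => ?_)
    rw [Real.norm_eq_abs, abs_of_pos (Real.exp_pos _)]
    exact hpt _
  have hint : ∫ ω, Real.exp (l * X ω ^ 2) ∂μ ≤ Real.exp (l + 182 * l ^ 2 * ρ ^ 4) := by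
    have h2 : √2 ≤ 1.42 := by rw [Real.sqrt_le_left (by norm_num)]; norm_num
    calc ∫ ω, Real.exp (l * X ω ^ 2) ∂μ
        ≤ ∫ ω, (1 + l * X ω ^ 2 +
      128 * l ^ 2 * ρ ^ 4 * Real.exp (X ω ^ 2 / (4 * ρ ^ 2))) ∂μ :=
          integral_mono iL iR fun ω => hpt _
      _ = 1 + l + 128 * l ^ 2 * ρ ^ 4 * ∫ ω, Real.exp (X ω ^ 2 / (4 * ρ ^ 2)) ∂μ := by
          have i3 : Integrable (fun ω => 1 + l * X ω ^ 2) μ :=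
            (integrable_const _).add (i2.const_mul l)
          rw [integral_add i3 (iE.const_mul _),
            integral_add (integrable_const _) (i2.const_mul l), integral_const_mul,
            integral_const_mul, h1]
          simp
      _ ≤ 1 + l + 128 * l ^ 2 * ρ ^ 4 * 1.42 := by gcongr; exact hE.trans h2
      _ ≤ l + 182 * l ^ 2 * ρ ^ 4 + 1 := by
          have : 0 ≤ l ^ 2 * (ρ : ℝ) ^ 4 := by positivity
          linarith
      _ ≤ _ := Real.add_one_le_exp _
  have e : ∀ ω, Real.exp (l * (X ω ^ 2 - 1)) = Real.exp (-l) * Real.exp (l * X ω ^ 2) := by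
    intro ω
    rw [← Real.exp_add]
    ring_nf
  simp only [mgf, e]
  refine ⟨iL.const_mul _, ?_⟩
  rw [integral_const_mul]
  calc Real.exp (-l) * ∫ ω, Real.exp (l * X ω ^ 2) ∂μ
      ≤ Real.exp (-l) * Real.exp (l + 182 * l ^ 2 * ρ ^ 4) := by gcongr
    _ = _ := by rw [← Real.exp_add]; ring_nf

end Scalar

/-! ### Quadratic forms on nets of the unit ball -/

section Net

variable {E : Type*} [NormedAddCommGroup E] [NormedSpace ℝ E] [FiniteDimensional ℝ E]

variable (E) in
/-- The unit ball has a `1 / 2`-net of at most `5 ^ dim` points. -/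
theorem exists_finset_half_net :
    ∃ N : Finset E, N.card ≤ 5 ^ Module.finrank ℝ E ∧ (∀ c ∈ N, ‖c‖ ≤ 1) ∧
      ∀ v : E, ‖v‖ ≤ 1 → ∃ c ∈ N, ‖v - c‖ ≤ 1 / 2 := by
  classical
  -- a `1`-separated subset of the ball of radius `2` of maximal cardinality, scaled by `1 / 2`
  let P : ℕ → Prop := fun m => ∃ s : Finset E, s.card = m ∧ (∀ c ∈ s, ‖c‖ ≤ 2) ∧
    ∀ c ∈ s, ∀ d ∈ s, c ≠ d → 1 ≤ ‖c - d‖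
  have hP0 : P 0 := ⟨∅, by simp⟩
  obtain ⟨s, hs, hs2, hsep⟩ : P (Nat.findGreatest P (5 ^ Module.finrank ℝ E)) :=
    Nat.findGreatest_spec (Nat.zero_le _) hP0
  refine ⟨s.image fun c => (1 / 2 : ℝ) • c, ?_, ?_, ?_⟩
  · exact Finset.card_image_le.trans (hs ▸ Nat.findGreatest_le _)
  · intro c hc
    obtain ⟨b, hb, rfl⟩ := Finset.mem_image.1 hc
    rw [norm_smul, Real.norm_of_nonneg (by norm_num)]
    linarith [hs2 b hb]
  · intro v hv
    by_contra! hcon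
    have hfar : ∀ c ∈ s, 1 < ‖(2 : ℝ) • v - c‖ := by
      intro c hc
      have h := hcon _ (Finset.mem_image_of_mem _ hc)
      have e : (2 : ℝ) • v - c = (2 : ℝ) • (v - (1 / 2 : ℝ) • c) := by
        rw [smul_sub, smul_smul]; norm_num
      rw [e, norm_smul, Real.norm_of_nonneg (by norm_num)]
      linarith
    have hnot : (2 : ℝ) • v ∉ s := by
      intro h
      have := hfar _ h
      rw [sub_self, norm_zero] at this
      linarith
    have h2 : ∀ c ∈ insert ((2 : ℝ) • v) s, ‖c‖ ≤ 2 := by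
      intro c hc
      rcases Finset.mem_insert.1 hc with rfl | hc
      · rw [norm_smul, Real.norm_of_nonneg (by norm_num)]; linarith
      · exact hs2 c hc
    have hsep' : ∀ c ∈ insert ((2 : ℝ) • v) s, ∀ d ∈ insert ((2 : ℝ) • v) s, c ≠ d →
        1 ≤ ‖c - d‖ := by
      intro c hc d hd hcd
      rcases Finset.mem_insert.1 hc with rfl | hc <;> rcases Finset.mem_insert.1 hd with rfl | hd
      · exact absurd rfl hcd
      · exact (hfar d hd).le
      · rw [norm_sub_rev]; exact (hfar c hc).le
      · exact hsep c hc d hd hcd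
    have hcard := Besicovitch.card_le_of_separated _ h2 hsep'
    rw [Finset.card_insert_of_notMem hnot] at hcard
    have hle : s.card + 1 ≤ Nat.findGreatest P (5 ^ Module.finrank ℝ E) :=
      Nat.le_findGreatest hcard ⟨_, Finset.card_insert_of_notMem hnot, h2, hsep'⟩
    omega

variable (E) in
/-- A second half net, placed around each point of the first at scale `1 / 2`. -/
theorem exists_finset_quarter_net :
    ∃ N : Finset E, N.card ≤ 25 ^ Module.finrank ℝ E ∧ (∀ c ∈ N, ‖c‖ ≤ 3 / 2) ∧
      ∀ v : E, ‖v‖ ≤ 1 → ∃ c ∈ N, ‖v - c‖ ≤ 1 / 4 := by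
  classical
  obtain ⟨N, hN, h1, hnet⟩ := exists_finset_half_net E
  refine ⟨(N ×ˢ N).image fun c => c.1 + (1 / 2 : ℝ) • c.2, ?_, ?_, ?_⟩
  · refine Finset.card_image_le.trans ?_
    rw [Finset.card_product, show 25 = 5 * 5 by norm_num, mul_pow]
    exact Nat.mul_le_mul hN hN
  · intro c hc
    obtain ⟨⟨a, b⟩, hab, rfl⟩ := Finset.mem_image.1 hc
    rw [Finset.mem_product] at hab
    refine (norm_add_le _ _).trans ?_
    rw [norm_smul, Real.norm_of_nonneg (by norm_num)]
    linarith [h1 a hab.1, h1 b hab.2]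
  · intro v hv
    obtain ⟨a, ha, hva⟩ := hnet v hv
    obtain ⟨b, hb, hvb⟩ := hnet ((2 : ℝ) • (v - a)) (by
      rw [norm_smul, Real.norm_of_nonneg (by norm_num)]; linarith)
    refine ⟨_, Finset.mem_image_of_mem _ (Finset.mk_mem_product ha hb), ?_⟩
    have e : v - (a + (1 / 2 : ℝ) • b) = (1 / 2 : ℝ) • ((2 : ℝ) • (v - a) - b) := by
      rw [smul_sub, smul_smul]
      norm_num
      abel
    rw [e, norm_smul, Real.norm_of_nonneg (by norm_num)]
    linarith

end Net

/-- Control of the quadratic form `Σ ℓᵢ² - n |·|²` on a quarter net gives control everywhere. -/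
theorem abs_sum_sq_sub_le_of_net {E ι : Type*} [NormedAddCommGroup E] [InnerProductSpace ℝ E]
    [FiniteDimensional ℝ E] [Fintype ι] (l : ι → E →ₗ[ℝ] ℝ) (n : ℝ) (hn : 0 ≤ n)
    (N : Finset E) (h1 : ∀ c ∈ N, ‖c‖ ≤ 3 / 2)
    (hnet : ∀ v : E, ‖v‖ ≤ 1 → ∃ c ∈ N, ‖v - c‖ ≤ 1 / 4)
    (hN : ∀ c ∈ N, |∑ i, l i c ^ 2 - n * ‖c‖ ^ 2| ≤ n * (1 / 16 * ‖c‖ ^ 2)) (v : E) :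
    |∑ i, l i v ^ 2 - n * ‖v‖ ^ 2| ≤ n * (1 / 2 * ‖v‖ ^ 2) := by
  set D : E → ℝ := fun v => ∑ i, l i v ^ 2 - n * ‖v‖ ^ 2 with hD
  have hlc : ∀ i, Continuous (l i) := fun i => LinearMap.continuous_of_finiteDimensional _
  have hcont : Continuous fun v => |D v| := by
    refine Continuous.abs ?_
    exact (continuous_finsetSum _ fun i _ => (hlc i).pow 2).sub (by fun_prop)
  obtain ⟨w, hw, hmax⟩ := (isCompact_closedBall (0 : E) 1).exists_isMaxOn
    ⟨0, by simp⟩ hcont.continuousOn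
  set K := |D w|
  have hK : ∀ v, |D v| ≤ K * ‖v‖ ^ 2 := by
    intro v
    rcases eq_or_ne v 0 with rfl | hv
    · simp [hD]
    · have hv' : 0 < ‖v‖ := norm_pos_iff.2 hv
      have hu : ‖v‖⁻¹ • v ∈ Metric.closedBall (0 : E) 1 := by
        simp [norm_smul, hv'.ne']
      have h := hmax hu
      have e : D (‖v‖⁻¹ • v) = (‖v‖⁻¹) ^ 2 * D v := by
        simp only [hD, map_smul, smul_eq_mul, norm_smul, norm_inv, norm_norm, mul_pow, mul_sub,
          Finset.mul_sum]
        ring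
      simp only [Set.mem_ofPred_eq, e, abs_mul, abs_pow, abs_inv, abs_norm] at h
      rw [inv_pow, inv_mul_le_iff₀ (by positivity)] at h
      linarith
  -- polarization of the quadratic form `D`; the weights `5 / 2` and `2 / 5` balance the small
  -- difference `a - b` against the large sum `a + b`
  have hpol : ∀ a b : E, D a - D b = D ((2 : ℝ)⁻¹ • ((5 / 2 : ℝ) • (a - b) + (2 / 5 : ℝ) • (a + b)))
      - D ((2 : ℝ)⁻¹ • ((5 / 2 : ℝ) • (a - b) - (2 / 5 : ℝ) • (a + b))) := by
    intro a b
    simp only [hD, ← real_inner_self_eq_norm_sq, map_smul, map_add, map_sub, smul_eq_mul,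
      inner_add_left, inner_add_right, inner_sub_left, inner_sub_right, inner_smul_left,
      inner_smul_right, real_inner_comm b a]
    have : ∑ i, (l i a ^ 2 - l i b ^ 2) =
        ∑ i, ((2⁻¹ * (5 / 2 * (l i a - l i b) + 2 / 5 * (l i a + l i b))) ^ 2 -
          (2⁻¹ * (5 / 2 * (l i a - l i b) - 2 / 5 * (l i a + l i b))) ^ 2) :=
      Finset.sum_congr rfl fun i _ => by ring
    rw [Finset.sum_sub_distrib, Finset.sum_sub_distrib] at this
    simp only [conj_trivial]
    linear_combination this
  have hsub : ∀ x y : E, D ((2 : ℝ)⁻¹ • (x + y)) - D ((2 : ℝ)⁻¹ • (x - y)) ≤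
      K * ((1 / 2) * (‖x‖ ^ 2 + ‖y‖ ^ 2)) := by
    intro x y
    have h2 := (le_abs_self _).trans (hK ((2 : ℝ)⁻¹ • (x + y)))
    have h3 := (neg_abs_le _).trans' (neg_le_neg (hK ((2 : ℝ)⁻¹ • (x - y))))
    have h4 := parallelogram_law_with_norm ℝ x y
    rw [norm_smul, mul_pow, Real.norm_of_nonneg (by norm_num)] at h2 h3
    have h5 : K * ((1 / 2) * (‖x‖ ^ 2 + ‖y‖ ^ 2)) =
        K * (2⁻¹ ^ 2 * ‖x + y‖ ^ 2) + K * (2⁻¹ ^ 2 * ‖x - y‖ ^ 2) := by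
      linear_combination (-K / 4) * h4
    linarith
  have hle : ∀ a b : E, D a - D b ≤
      K * ((1 / 2) * (25 / 4 * ‖a - b‖ ^ 2 + 4 / 25 * ‖a + b‖ ^ 2)) := by
    intro a b
    rw [hpol]
    refine (hsub _ _).trans (le_of_eq ?_)
    rw [norm_smul, norm_smul, mul_pow, mul_pow, Real.norm_eq_abs, Real.norm_eq_abs, sq_abs, sq_abs]
    ring
  have hw1 : ‖w‖ ≤ 1 := by simpa using hw
  obtain ⟨c, hc, hwc⟩ := hnet w hw1
  have hc1 := h1 c hc
  have hsum : ‖w + c‖ ≤ 5 / 2 := (norm_add_le _ _).trans (by linarith)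
  have hK0 : 0 ≤ K := abs_nonneg _
  have hKb : K * ((1 / 2) * (25 / 4 * ‖w - c‖ ^ 2 + 4 / 25 * ‖w + c‖ ^ 2)) ≤ K * (89 / 128) := by
    have s1 : ‖w - c‖ ^ 2 ≤ (1 / 4) ^ 2 := by gcongr
    have s2 : ‖w + c‖ ^ 2 ≤ (5 / 2) ^ 2 := by gcongr
    refine mul_le_mul_of_nonneg_left ?_ hK0
    linarith
  have hDc : |D c| ≤ n * (9 / 64) := by
    refine (hN c hc).trans ?_
    have : ‖c‖ ^ 2 ≤ (3 / 2) ^ 2 := by gcongr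
    refine mul_le_mul_of_nonneg_left ?_ hn
    linarith
  -- the maximum `K` of `|D|` on the ball is at most its value on the net plus a fraction of itself
  have hKn : K ≤ n * (9 / 64) + K * (89 / 128) := by
    have e1 := hle w c
    have e2 := hle c w
    rw [norm_sub_rev, add_comm c w] at e2
    have e3 := abs_le.1 hDc
    exact abs_le.2 ⟨by linarith, by linarith⟩
  have hKn' : K ≤ n * (1 / 2) := by linarith
  refine (hK v).trans ?_
  calc K * ‖v‖ ^ 2 ≤ n * (1 / 2) * ‖v‖ ^ 2 := by gcongr
    _ = _ := by ring

/-! ### Concentration of empirical covariances -/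

theorem integrable_mul_dotProduct_sq {m : ℕ} {μ : Measure (Fin m → ℝ)}
    (h : ∀ i, MemLp (fun x : Fin m → ℝ => x i) 2 μ) (v : Fin m → ℝ) :
    Integrable (fun x => (v ⬝ᵥ x) ^ 2) μ := by
  have : MemLp (fun x : Fin m → ℝ => v ⬝ᵥ x) 2 μ := by
    have := memLp_finsetSum (s := Finset.univ) fun i _ => (h i).const_mul (v i)
    exact this
  exact this.integrable_sq

theorem integral_dotProduct_sq {m : ℕ} {μ : Measure (Fin m → ℝ)}
    (h : ∀ i, MemLp (fun x : Fin m → ℝ => x i) 2 μ) (v : Fin m → ℝ) :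
    ∫ x, (v ⬝ᵥ x) ^ 2 ∂μ = v ⬝ᵥ (secondMoment μ *ᵥ v) := by
  have hint : ∀ i j, Integrable (fun x : Fin m → ℝ => x i * x j) μ := fun i j =>
    (h i).integrable_mul (h j)
  have e : ∀ x : Fin m → ℝ, (v ⬝ᵥ x) ^ 2 = ∑ i, ∑ j, v i * v j * (x i * x j) := by
    intro x
    rw [sq, dotProduct, Finset.sum_mul_sum]
    exact Finset.sum_congr rfl fun i _ => Finset.sum_congr rfl fun j _ => by ring
  simp_rw [e]
  rw [integral_finsetSum _ fun i _ => integrable_finsetSum _ fun j _ => (hint i j).const_mul _]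
  simp only [dotProduct, mulVec, Finset.mul_sum]
  refine Finset.sum_congr rfl fun i _ => ?_
  rw [integral_finsetSum _ fun j _ => (hint i j).const_mul _]
  refine Finset.sum_congr rfl fun j _ => ?_
  rw [integral_const_mul]
  simp only [secondMoment, Matrix.of_apply]
  ring

@[fun_prop]
theorem measurable_dotProduct_const {m : ℕ} (v : Fin m → ℝ) :
    Measurable fun x : Fin m → ℝ => v ⬝ᵥ x := by
  unfold dotProduct; fun_prop

section Isotropic

variable {d : ℕ} {q : Measure (Fin d → ℝ)} [IsProbabilityMeasure q] {ρ : ℝ≥0}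

omit [IsProbabilityMeasure q] in
theorem hasSubgaussianMGF_dotProduct (h0 : meanVec q = 0) (hsub : IsSubgaussianVector q ρ)
    {v : Fin d → ℝ} (hv : v ⬝ᵥ v = 1) : HasSubgaussianMGF (fun x => v ⬝ᵥ x) (ρ ^ 2) q := by
  simpa [h0] using hsub v hv

omit [IsProbabilityMeasure q] in
theorem memLp_coord (h0 : meanVec q = 0) (hsub : IsSubgaussianVector q ρ) (i : Fin d) :
    MemLp (fun x : Fin d → ℝ => x i) 2 q := by
  have := (hasSubgaussianMGF_dotProduct h0 hsub (v := Pi.single i 1) (by simp)).memLp 2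
  simpa using this

omit [IsProbabilityMeasure q] in
theorem integral_dotProduct_sq_eq_one (h0 : meanVec q = 0) (h1 : secondMoment q = 1)
    (hsub : IsSubgaussianVector q ρ) {v : Fin d → ℝ} (hv : v ⬝ᵥ v = 1) :
    ∫ x, (v ⬝ᵥ x) ^ 2 ∂q = 1 := by
  rw [integral_dotProduct_sq (memLp_coord h0 hsub), h1, one_mulVec, hv]

/-- Bernstein's inequality for the empirical second moment in a fixed direction. -/
theorem measure_abs_sum_sq_sub_gt_le (h0 : meanVec q = 0) (h1 : secondMoment q = 1)
    (hsub : IsSubgaussianVector q ρ) {v : Fin d → ℝ} (hv : v ⬝ᵥ v = 1) (n : ℕ) :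
    (Measure.pi fun _ : Fin n => q) {x | (n : ℝ) * (1 / 16) < |∑ i, (v ⬝ᵥ x i) ^ 2 - n|} ≤
      ENNReal.ofReal (2 * Real.exp (-(n / (200000 * ρ ^ 4)))) := by
  have hX := hasSubgaussianMGF_dotProduct h0 hsub hv
  have hX2 := integral_dotProduct_sq_eq_one h0 h1 hsub hv
  have hρ2 := half_le_sq_of_hasSubgaussianMGF hX hX2
  have hρ : 0 < (ρ : ℝ) := by
    refine ρ.coe_nonneg.lt_of_ne fun h => ?_
    rw [← h] at hρ2
    norm_num at hρ2
  set P := Measure.pi fun _ : Fin n => q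
  set Y : Fin n → (Fin n → Fin d → ℝ) → ℝ := fun i x => (v ⬝ᵥ x i) ^ 2 - 1
  have hYm : ∀ i, Measurable (Y i) := fun i => by
    have : Measurable fun x : Fin n → Fin d → ℝ => v ⬝ᵥ x i :=
      (measurable_dotProduct_const v).comp (measurable_pi_apply i)
    exact (this.pow_const 2).sub_const 1
  have hind : iIndepFun Y P :=
    iIndepFun_pi (μ := fun _ : Fin n => q) (X := fun _ x => (v ⬝ᵥ x) ^ 2 - 1)
      (fun i => by fun_prop)
  have key : ∀ l : ℝ, |l| ≤ 1 / (8 * ρ ^ 2) →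
      Integrable (fun x => Real.exp (l * (∑ i, Y i) x)) P ∧
      mgf (∑ i, Y i) P l ≤ Real.exp (n * (182 * l ^ 2 * ρ ^ 4)) := by
    intro l hl
    obtain ⟨i1, i2⟩ := mgf_sq_sub_one_le hX (by fun_prop) hX2 hl
    have hmp : ∀ i, MeasurePreserving (fun x : Fin n → Fin d → ℝ => x i) P q := fun i =>
      measurePreserving_eval (fun _ : Fin n => q) i
    refine ⟨hind.integrable_exp_mul_sum hYm fun i _ => ?_, ?_⟩
    · exact (hmp i).integrable_comp_of_integrable i1
    · rw [hind.mgf_sum hYm]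
      calc ∏ i, mgf (Y i) P l ≤ ∏ _i : Fin n, Real.exp (182 * l ^ 2 * ρ ^ 4) := by
            refine Finset.prod_le_prod (fun i _ => mgf_nonneg) fun i _ => ?_
            refine le_of_eq_of_le ?_ i2
            have := integral_map (μ := P) (hmp i).measurable.aemeasurable
              (f := fun x => Real.exp (l * ((v ⬝ᵥ x) ^ 2 - 1))) (by
                apply Measurable.aestronglyMeasurable; fun_prop)
            rw [(hmp i).map_eq] at this
            exact this.symm
        _ = _ := by
            rw [Finset.prod_const, Finset.card_univ, Fintype.card_fin, ← Real.exp_nat_mul]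
  have hsum : ∀ x, (∑ i, Y i) x = ∑ i, (v ⬝ᵥ x i) ^ 2 - n := by
    intro x
    simp [Y, Finset.sum_apply, Finset.sum_sub_distrib]
  -- a nearly optimal parameter: the exponent `-l / 16 + 182 l² ρ⁴` is at most `-1 / (200000 ρ⁴)`
  set l : ℝ := 1 / (6400 * ρ ^ 4) with hl
  have hlpos : 0 ≤ l := by positivity
  have hlb : l ≤ 1 / (8 * ρ ^ 2) := by
    rw [hl]
    apply one_div_le_one_div_of_le (by positivity)
    nlinarith [sq_nonneg ((ρ : ℝ) ^ 2)]
  have hfin : Real.exp (-l * (n * (1 / 16))) * Real.exp (n * (182 * l ^ 2 * ρ ^ 4)) ≤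
      Real.exp (-(n / (200000 * ρ ^ 4))) := by
    rw [← Real.exp_add]
    apply Real.exp_le_exp.2
    rw [hl]
    have hn : 0 ≤ (n : ℝ) / ρ ^ 4 := by positivity
    have e1 : -(1 / (6400 * (ρ : ℝ) ^ 4)) * (n * (1 / 16)) +
        n * (182 * (1 / (6400 * (ρ : ℝ) ^ 4)) ^ 2 * ρ ^ 4) =
        (n / ρ ^ 4) * (-(1 / 102400) + 182 / 40960000) := by
      field_simp
      ring
    have e2 : -((n : ℝ) / (200000 * ρ ^ 4)) = (n / ρ ^ 4) * (-(1 / 200000)) := by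
      field_simp
    rw [e1, e2]
    exact mul_le_mul_of_nonneg_left (by norm_num) hn
  have hup : P.real {x | (n : ℝ) * (1 / 16) ≤ (∑ i, Y i) x} ≤
      Real.exp (-(n / (200000 * ρ ^ 4))) := by
    obtain ⟨i1, i2⟩ := key l (by rwa [abs_of_nonneg hlpos])
    refine (measure_ge_le_exp_mul_mgf _ hlpos i1).trans (le_trans ?_ hfin)
    gcongr
  have hlo : P.real {x | (∑ i, Y i) x ≤ -((n : ℝ) * (1 / 16))} ≤
      Real.exp (-(n / (200000 * ρ ^ 4))) := by
    obtain ⟨i1, i2⟩ := key (-l) (by rwa [abs_neg, abs_of_nonneg hlpos])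
    refine (measure_le_le_exp_mul_mgf _ (by linarith) i1).trans (le_trans ?_ hfin)
    rw [neg_sq] at i2
    rw [neg_neg, mul_neg, ← neg_mul]
    gcongr
  have hsub : {x : Fin n → Fin d → ℝ | (n : ℝ) * (1 / 16) < |∑ i, (v ⬝ᵥ x i) ^ 2 - n|} ⊆
      {x | (n : ℝ) * (1 / 16) ≤ (∑ i, Y i) x} ∪ {x | (∑ i, Y i) x ≤ -((n : ℝ) * (1 / 16))} := by
    intro x hx
    simp only [Set.mem_union, Set.mem_ofPred_eq, hsum] at hx ⊢
    rcases lt_abs.1 hx with h | h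
    · left; exact h.le
    · right; linarith
  calc P _ ≤ P _ := measure_mono hsub
    _ ≤ _ := measure_union_le _ _
    _ ≤ ENNReal.ofReal (Real.exp (-(n / (200000 * ρ ^ 4)))) +
        ENNReal.ofReal (Real.exp (-(n / (200000 * ρ ^ 4)))) := by
        gcongr
        · rw [← ofReal_measureReal]; exact ENNReal.ofReal_le_ofReal hup
        · rw [← ofReal_measureReal]; exact ENNReal.ofReal_le_ofReal hlo
    _ = _ := by rw [← ENNReal.ofReal_add (by positivity) (by positivity), two_mul]

/-- Uniform two-sided control of the empirical second moment on a subspace of dimension at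
most `m`. -/
theorem measure_exists_sum_sq_le (h0 : meanVec q = 0) (h1 : secondMoment q = 1)
    (hsub : IsSubgaussianVector q ρ) (hρ : 0 < ρ)
    (F : Submodule ℝ (EuclideanSpace ℝ (Fin d))) {m n : ℕ}
    (hm : 1 ≤ m) (hF : Module.finrank ℝ F ≤ m) {δ : ℝ} (hδ : 0 < δ) (hδ1 : δ ≤ 1)
    (hn : 1000000 * ((ρ : ℝ) ^ 4 * (m + Real.log (1 / δ))) ≤ n) :
    (Measure.pi fun _ : Fin n => q)
      {x | ∃ v ∈ F, (n : ℝ) * (1 / 2 * ‖v‖ ^ 2) < |∑ i, (v.ofLp ⬝ᵥ x i) ^ 2 - n * ‖v‖ ^ 2|} ≤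
      ENNReal.ofReal δ := by
  obtain ⟨N, hNc, hN1, hnet⟩ := exists_finset_quarter_net F
  set P := Measure.pi fun _ : Fin n => q
  -- the exceptional set is covered by those of the directions in the net
  have hcov : {x : Fin n → Fin d → ℝ | ∃ v ∈ F, (n : ℝ) * (1 / 2 * ‖v‖ ^ 2) <
      |∑ i, (v.ofLp ⬝ᵥ x i) ^ 2 - n * ‖v‖ ^ 2|} ⊆ ⋃ c ∈ N,
      {x | (n : ℝ) * (1 / 16 * ‖c‖ ^ 2) <
        |∑ i, ((c : EuclideanSpace ℝ (Fin d)).ofLp ⬝ᵥ x i) ^ 2 - n * ‖c‖ ^ 2|} := by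
    rintro x ⟨v, hv, hx⟩
    by_contra hcon
    simp only [Set.mem_iUnion, Set.mem_ofPred_eq, not_exists, not_lt] at hcon
    let l : Fin n → F →ₗ[ℝ] ℝ := fun i =>
      { toFun := fun w => (w : EuclideanSpace ℝ (Fin d)).ofLp ⬝ᵥ x i
        map_add' := fun a b => by simp [add_dotProduct]
        map_smul' := fun a b => by simp }
    have := abs_sum_sq_sub_le_of_net l n (by positivity) N hN1 hnet hcon ⟨v, hv⟩
    exact absurd this (not_le.2 hx)
  have hpt : ∀ c : F, P {x | (n : ℝ) * (1 / 16 * ‖c‖ ^ 2) <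
        |∑ i, ((c : EuclideanSpace ℝ (Fin d)).ofLp ⬝ᵥ x i) ^ 2 - n * ‖c‖ ^ 2|} ≤
      ENNReal.ofReal (2 * Real.exp (-(n / (200000 * ρ ^ 4)))) := by
    intro c
    rcases eq_or_ne c 0 with rfl | hc
    · simp
    have hc' : 0 < ‖c‖ := norm_pos_iff.2 hc
    have hcc : (c : EuclideanSpace ℝ (Fin d)).ofLp ⬝ᵥ (c : EuclideanSpace ℝ (Fin d)).ofLp =
        ‖c‖ ^ 2 := by
      rw [Submodule.coe_norm, EuclideanSpace.real_norm_sq_eq]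
      simp [dotProduct, sq]
    have hv : (‖c‖⁻¹ • (c : EuclideanSpace ℝ (Fin d)).ofLp) ⬝ᵥ
        (‖c‖⁻¹ • (c : EuclideanSpace ℝ (Fin d)).ofLp) = 1 := by
      rw [smul_dotProduct, dotProduct_smul, hcc, smul_eq_mul, smul_eq_mul]
      field_simp
    refine (measure_mono ?_).trans (measure_abs_sum_sq_sub_gt_le h0 h1 hsub hv n)
    intro x hx
    simp only [Set.mem_ofPred_eq] at hx ⊢
    simp only [smul_dotProduct, smul_eq_mul, mul_pow, ← Finset.mul_sum]
    have e : (‖c‖⁻¹) ^ 2 * ∑ i, ((c : EuclideanSpace ℝ (Fin d)).ofLp ⬝ᵥ x i) ^ 2 - n =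
        (‖c‖ ^ 2)⁻¹ * (∑ i, ((c : EuclideanSpace ℝ (Fin d)).ofLp ⬝ᵥ x i) ^ 2 - n * ‖c‖ ^ 2) := by
      field_simp
    rw [e, abs_mul, abs_of_nonneg (by positivity), lt_inv_mul_iff₀ (by positivity)]
    linarith
  refine (measure_mono hcov).trans ((measure_biUnion_finset_le _ _).trans
    ((Finset.sum_le_sum fun c _ => hpt c).trans ?_))
  rw [Finset.sum_const, nsmul_eq_mul, ← ENNReal.ofReal_natCast,
    ← ENNReal.ofReal_mul (by positivity)]
  apply ENNReal.ofReal_le_ofReal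
  have hlog : 0 ≤ Real.log (1 / δ) := Real.log_nonneg (by rw [le_div_iff₀ hδ]; linarith)
  have hρ' : (0 : ℝ) < ρ := by exact_mod_cast hρ
  have hexp : 5 * (m + Real.log (1 / δ)) ≤ n / (200000 * (ρ : ℝ) ^ 4) := by
    rw [le_div_iff₀ (by positivity)]
    linarith
  have hcard : (N.card : ℝ) ≤ 25 ^ m := by
    calc (N.card : ℝ) ≤ (25 : ℝ) ^ Module.finrank ℝ F := by exact_mod_cast hNc
      _ ≤ _ := pow_le_pow_right₀ (by norm_num) hF
  have h50 : (25 : ℝ) ^ m * 2 ≤ Real.exp (5 * m) := by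
    have h3 : (50 : ℝ) ≤ Real.exp 5 := by
      have := Real.exp_one_gt_d9
      calc (50 : ℝ) ≤ 2.7 ^ 5 := by norm_num
        _ ≤ (Real.exp 1) ^ 5 := by gcongr; linarith
        _ = Real.exp 5 := by rw [← Real.exp_nat_mul]; norm_num
    calc (25 : ℝ) ^ m * 2 ≤ 25 ^ m * 2 ^ m := by
          gcongr
          exact le_self_pow₀ (by norm_num) (by omega)
      _ = 50 ^ m := by rw [← mul_pow]; norm_num
      _ ≤ (Real.exp 5) ^ m := by gcongr
      _ = _ := by rw [← Real.exp_nat_mul]; ring_nf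
  calc (N.card : ℝ) * (2 * Real.exp (-(n / (200000 * ρ ^ 4))))
      ≤ 25 ^ m * (2 * Real.exp (-(5 * (m + Real.log (1 / δ))))) := by gcongr
    _ = 25 ^ m * 2 * (Real.exp (-(5 * m)) * Real.exp (-(5 * Real.log (1 / δ)))) := by
        rw [← Real.exp_add]; ring_nf
    _ ≤ Real.exp (5 * m) * (Real.exp (-(5 * m)) * Real.exp (-(1 * Real.log (1 / δ)))) := by
        gcongr
        norm_num
    _ = δ := by
        rw [← mul_assoc, ← Real.exp_add, one_div, Real.log_inv]
        simp [Real.exp_log hδ]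

end Isotropic

section Input

variable {d : ℕ} {p : Measure (Fin d → ℝ)} {ρ : ℝ≥0}

theorem measurable_mulVec_const {m n : ℕ} (S : Matrix (Fin m) (Fin n) ℝ) :
    Measurable fun x : Fin n → ℝ => S *ᵥ x := by
  unfold mulVec dotProduct; fun_prop

theorem RepLearn.IsSubgaussianInput.isProbabilityMeasure (h : IsSubgaussianInput ρ p) :
    IsProbabilityMeasure p := by
  obtain ⟨q, hq, hw, -⟩ := h
  obtain ⟨S, -, -, rfl⟩ := hw.map_sqrt
  exact Measure.isProbabilityMeasure_map (measurable_mulVec_const S).aemeasurable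

/-- The constant `ρ` of a whitened input is bounded below, since the whitening has unit variance. -/
theorem RepLearn.IsSubgaussianInput.half_le (h : IsSubgaussianInput ρ p) (hd : 0 < d) :
    (1 / 2 : ℝ) ≤ (ρ : ℝ) ^ 2 := by
  obtain ⟨q, hq, hw, hs⟩ := h
  have hv : (Pi.single ⟨0, hd⟩ 1 : Fin d → ℝ) ⬝ᵥ Pi.single ⟨0, hd⟩ 1 = 1 := by simp
  exact half_le_sq_of_hasSubgaussianMGF (hasSubgaussianMGF_dotProduct hw.mean_zero hs hv)
    (integral_dotProduct_sq_eq_one hw.mean_zero hw.isotropic hs hv)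

theorem RepLearn.IsSubgaussianInput.memLp (h : IsSubgaussianInput ρ p) (i : Fin d) :
    MemLp (fun x : Fin d → ℝ => x i) 2 p := by
  obtain ⟨q, hq, hw, hs⟩ := h
  obtain ⟨S, -, -, hp⟩ := hw.map_sqrt
  rw [hp]
  refine (memLp_map_measure_iff (measurable_pi_apply i).aestronglyMeasurable
    (measurable_mulVec_const S).aemeasurable).2 ?_
  have := memLp_finsetSum (s := Finset.univ) fun j _ =>
    (memLp_coord hw.mean_zero hs j).const_mul (S i j)
  exact this

theorem isClosed_forall_sum_sq {d n : ℕ} {E : Type*} (M : E → Fin d → ℝ) (a b : E → ℝ) :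
    IsClosed {x : Fin n → Fin d → ℝ | ∀ u, a u ≤ ∑ i, (M u ⬝ᵥ x i) ^ 2 ∧
      ∑ i, (M u ⬝ᵥ x i) ^ 2 ≤ b u} := by
  simp only [Set.ofPred_forall]
  refine isClosed_iInter fun u => ?_
  have : Continuous fun x : Fin n → Fin d → ℝ => ∑ i, (M u ⬝ᵥ x i) ^ 2 := by
    unfold dotProduct; fun_prop
  exact (isClosed_le continuous_const this).inter (isClosed_le this continuous_const)

/-- With high probability the empirical covariance is comparable with the population covariance,
uniformly over the range of a linear map from a space of dimension at most `m`. -/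
theorem RepLearn.IsSubgaussianInput.measure_not_forall_le (h : IsSubgaussianInput ρ p) (hd : 0 < d)
    {E : Type*} [AddCommGroup E] [Module ℝ E] [FiniteDimensional ℝ E]
    (M : E →ₗ[ℝ] Fin d → ℝ) {m n : ℕ} (hm : 1 ≤ m) (hE : Module.finrank ℝ E ≤ m)
    {δ : ℝ} (hδ : 0 < δ) (hδ1 : δ ≤ 1)
    (hn : 1000000 * ((ρ : ℝ) ^ 4 * (m + Real.log (1 / δ))) ≤ n) :
    (Measure.pi fun _ : Fin n => p)
      {x | ∀ u, n / 2 * (M u ⬝ᵥ (secondMoment p *ᵥ M u)) ≤ ∑ i, (M u ⬝ᵥ x i) ^ 2 ∧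
        ∑ i, (M u ⬝ᵥ x i) ^ 2 ≤ 2 * n * (M u ⬝ᵥ (secondMoment p *ᵥ M u))}ᶜ ≤
      ENNReal.ofReal δ := by
  have hρ2 := h.half_le hd
  have hρ : 0 < ρ := by
    rw [pos_iff_ne_zero]
    rintro rfl
    norm_num at hρ2
  obtain ⟨q, hq, hw, hs⟩ := h
  obtain ⟨S, hS, hSS, hp⟩ := hw.map_sqrt
  have hST : Sᵀ = S := by simpa using hS.isHermitian.eq
  rw [← hSS]
  have hclosed := isClosed_forall_sum_sq (n := n) (fun u => M u)
    (fun u => n / 2 * (M u ⬝ᵥ ((S * S) *ᵥ M u))) (fun u => 2 * n * (M u ⬝ᵥ ((S * S) *ᵥ M u)))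
  have hprob : IsProbabilityMeasure (q.map fun x => S *ᵥ x) :=
    Measure.isProbabilityMeasure_map (measurable_mulVec_const S).aemeasurable
  have hmap : (Measure.pi fun _ : Fin n => p) =
      (Measure.pi fun _ : Fin n => q).map fun x i => S *ᵥ x i := by
    rw [hp]
    exact (Measure.pi_map_pi fun i => (measurable_mulVec_const S).aemeasurable).symm
  have hmeas : Measurable fun (x : Fin n → Fin d → ℝ) (i : Fin n) => S *ᵥ x i :=
    measurable_pi_lambda _ fun i => (measurable_mulVec_const S).comp (measurable_pi_apply i)
  rw [hmap, Measure.map_apply hmeas hclosed.measurableSet.compl]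
  let A : E →ₗ[ℝ] EuclideanSpace ℝ (Fin d) :=
    (WithLp.linearEquiv 2 ℝ (Fin d → ℝ)).symm.toLinearMap ∘ₗ (Matrix.mulVecLin S) ∘ₗ M
  have hF : Module.finrank ℝ (LinearMap.range A) ≤ m := (LinearMap.finrank_range_le A).trans hE
  refine (measure_mono ?_).trans (measure_exists_sum_sq_le hw.mean_zero hw.isotropic hs hρ
    (LinearMap.range A) hm hF hδ hδ1 hn)
  intro x hx
  by_contra hcon
  simp only [Set.mem_ofPred_eq, not_exists, not_and, not_lt] at hcon
  apply hx
  intro u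
  have h1 := hcon (A u) (LinearMap.mem_range_self _ _)
  have hA : (A u).ofLp = S *ᵥ M u := rfl
  have hnorm : ‖A u‖ ^ 2 = M u ⬝ᵥ ((S * S) *ᵥ M u) := by
    rw [EuclideanSpace.real_norm_sq_eq, hA, ← mulVec_mulVec, dotProduct_mulVec, ← mulVec_transpose,
      hST]
    simp [dotProduct, sq]
  have hdot : ∀ i, (S *ᵥ M u) ⬝ᵥ x i = M u ⬝ᵥ (S *ᵥ x i) := by
    intro i
    rw [dotProduct_mulVec, ← mulVec_transpose, hST]
  simp only [hA, hdot, hnorm] at h1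
  have h0 : 0 ≤ M u ⬝ᵥ ((S * S) *ᵥ M u) := hnorm ▸ sq_nonneg _
  have hn0 : 0 ≤ n * (M u ⬝ᵥ ((S * S) *ᵥ M u)) := by positivity
  obtain ⟨h2, h3⟩ := abs_le.1 h1
  constructor <;> linarith

end Input

/-! ### Factorizations, right inverses and eigenvalue bounds -/

/-- An orthonormal basis of `F`, padded with zeros to exactly `m` vectors. -/
theorem exists_parseval_frame {d m : ℕ} (F : Submodule ℝ (EuclideanSpace ℝ (Fin d)))
    (hF : Module.finrank ℝ F ≤ m) :
    ∃ v : Fin m → EuclideanSpace ℝ (Fin d), (∀ j, ‖v j‖ ≤ 1) ∧ ∀ x ∈ F,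
      x = ∑ j, inner ℝ (v j) x • v j ∧ ∑ j, inner ℝ (v j) x ^ 2 = ‖x‖ ^ 2 := by
  classical
  let b := stdOrthonormalBasis ℝ F
  let f : Fin (Module.finrank ℝ F) → Fin m := Fin.castLE hF
  have hf : Function.Injective f := Fin.castLE_injective hF
  let v : Fin m → EuclideanSpace ℝ (Fin d) :=
    Function.extend f (fun j => (b j : EuclideanSpace ℝ (Fin d))) 0
  have hvf : ∀ j, v (f j) = b j := fun j => hf.extend_apply _ _ j
  have hv0 : ∀ j, j ∉ Set.range f → v j = 0 := fun j hj =>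
    Function.extend_apply' _ _ _ (by simpa using hj)
  refine ⟨v, fun j => ?_, fun x hx => ⟨?_, ?_⟩⟩
  · by_cases hj : j ∈ Set.range f
    · obtain ⟨i, rfl⟩ := hj
      rw [hvf, ← Submodule.coe_norm, b.orthonormal.1 i]
    · simp [hv0 j hj]
  · have h := b.sum_repr' ⟨x, hx⟩
    have h2 := congrArg (fun w : F => (w : EuclideanSpace ℝ (Fin d))) h
    simp only [Submodule.coe_sum, Submodule.coe_smul, Submodule.coe_inner] at h2
    conv_lhs => rw [← h2]
    exact Fintype.sum_of_injective f hf _ _ (fun j hj => by simp [hv0 j hj])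
      fun j => by rw [hvf]
  · have h := b.sum_sq_norm_inner_right ⟨x, hx⟩
    simp only [Submodule.coe_inner, Submodule.coe_norm, Real.norm_eq_abs, sq_abs] at h
    rw [← h]
    exact (Fintype.sum_of_injective f hf _ _ (fun j hj => by simp [hv0 j hj])
      fun j => by rw [hvf]).symm

/-- A matrix whose columns lie in a subspace of dimension at most `m` factors through `ℝᵐ` with a
left factor that has entries in `[-1, 1]` and a right factor of no larger Frobenius norm. -/
theorem exists_factor_of_mem {d m T : ℕ} (F : Submodule ℝ (EuclideanSpace ℝ (Fin d)))
    (hF : Module.finrank ℝ F ≤ m) (Θ : Matrix (Fin d) (Fin T) ℝ)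
    (hΘ : ∀ t, WithLp.toLp 2 (fun i => Θ i t) ∈ F) :
    ∃ (V : Matrix (Fin d) (Fin m) ℝ) (R : Matrix (Fin m) (Fin T) ℝ), V * R = Θ ∧
      (∀ i j, |V i j| ≤ 1) ∧ ∑ t, ∑ j, R j t ^ 2 ≤ ∑ t, ∑ i, Θ i t ^ 2 := by
  obtain ⟨v, hv1, hv⟩ := exists_parseval_frame F hF
  refine ⟨Matrix.of fun i j => (v j).ofLp i,
    Matrix.of fun j t => inner ℝ (v j) (WithLp.toLp 2 fun i => Θ i t), ?_, ?_, ?_⟩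
  · ext i t
    have h := congrArg (fun w : EuclideanSpace ℝ (Fin d) => w.ofLp i) (hv _ (hΘ t)).1
    simp only [WithLp.ofLp_sum, WithLp.ofLp_smul, Finset.sum_apply, Pi.smul_apply,
      smul_eq_mul] at h
    rw [h, Matrix.mul_apply]
    exact Finset.sum_congr rfl fun j _ => mul_comm _ _
  · intro i j
    exact (PiLp.norm_apply_le (v j) i).trans (hv1 j)
  · refine Finset.sum_le_sum fun t _ => ?_
    have h := (hv _ (hΘ t)).2
    rw [EuclideanSpace.real_norm_sq_eq] at h
    simp only [Matrix.of_apply]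
    exact h.le

theorem mul_col_mem_range {d k T : ℕ} (B : Matrix (Fin d) (Fin k) ℝ) (W : Matrix (Fin k) (Fin T) ℝ)
    (t : Fin T) :
    WithLp.toLp 2 (fun i => (B * W) i t) ∈ LinearMap.range (Matrix.toEuclideanLin B) :=
  ⟨WithLp.toLp 2 fun j => W j t, rfl⟩

theorem finrank_range_toEuclideanLin_le {d k : ℕ} (B : Matrix (Fin d) (Fin k) ℝ) :
    Module.finrank ℝ (LinearMap.range (Matrix.toEuclideanLin B)) ≤ k :=
  (LinearMap.finrank_range_le _).trans (by simp)

/-- Any product of rank at most `k` can be refactored with a left factor with entries in `[-1, 1]`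
and a right factor of controlled Frobenius norm. -/
theorem exists_factor_mul {d k T : ℕ} (B : Matrix (Fin d) (Fin k) ℝ)
    (W : Matrix (Fin k) (Fin T) ℝ) :
    ∃ (V : Matrix (Fin d) (Fin k) ℝ) (R : Matrix (Fin k) (Fin T) ℝ), V * R = B * W ∧
      (∀ i j, |V i j| ≤ 1) ∧ ∑ t, ∑ j, R j t ^ 2 ≤ ∑ t, ∑ i, (B * W) i t ^ 2 :=
  exists_factor_of_mem _ (finrank_range_toEuclideanLin_le B) _ (mul_col_mem_range B W)

/-- The error of one rank `k` predictor matrix against another has rank at most `2k`, and can be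
refactored through `ℝ²ᵏ`. -/
theorem exists_factor_mul_sub_mul {d k T : ℕ} (B B' : Matrix (Fin d) (Fin k) ℝ)
    (W W' : Matrix (Fin k) (Fin T) ℝ) :
    ∃ (V : Matrix (Fin d) (Fin (2 * k)) ℝ) (R : Matrix (Fin (2 * k)) (Fin T) ℝ),
      V * R = B * W - B' * W' ∧ (∀ i j, |V i j| ≤ 1) ∧
      ∑ t, ∑ j, R j t ^ 2 ≤ ∑ t, ∑ i, (B * W - B' * W') i t ^ 2 := by
  refine exists_factor_of_mem (LinearMap.range (Matrix.toEuclideanLin B) ⊔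
    LinearMap.range (Matrix.toEuclideanLin B')) ?_ _ fun t => ?_
  · refine (Submodule.finrank_add_le_finrank_add_finrank _ _).trans ?_
    have := finrank_range_toEuclideanLin_le B
    have := finrank_range_toEuclideanLin_le B'
    omega
  · exact Submodule.sub_mem _ (Submodule.mem_sup_left (mul_col_mem_range B W t))
      (Submodule.mem_sup_right (mul_col_mem_range B' W' t))

/-- A matrix whose `k`-th singular value is bounded below has a right inverse that is bounded
correspondingly. -/
theorem exists_right_inverse_of_le_singularValues {k T : ℕ} (hk : 1 ≤ k) (hkT : k ≤ T)
    (Ws : Matrix (Fin k) (Fin T) ℝ) {s : ℝ} (hs : 0 < s)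
    (h : s ≤ (Matrix.toEuclideanLin Ws).singularValues (k - 1) ^ 2) :
    ∃ P : Matrix (Fin T) (Fin k) ℝ, Ws * P = 1 ∧
      ∀ r : Fin T → ℝ, s * ∑ j, (r ᵥ* P) j ^ 2 ≤ ∑ t, r t ^ 2 := by
  set A := Matrix.toEuclideanLin Ws
  have hn : Module.finrank ℝ (EuclideanSpace ℝ (Fin T)) = T := by simp
  have hsym := A.isSymmetric_adjoint_comp_self
  let e := hsym.eigenvectorBasis hn
  let l := hsym.eigenvalues hn
  let c : Fin k → Fin T := Fin.castLE hkT
  have hc : Function.Injective c := Fin.castLE_injective hkT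
  have hl : ∀ i, s ≤ l (c i) := by
    intro i
    rw [A.sq_singularValues_of_lt hn (show k - 1 < T by omega)] at h
    refine h.trans (hsym.eigenvalues_antitone hn ?_)
    simp only [c, Fin.le_def, Fin.val_castLE]
    omega
  have hl0 : ∀ i, 0 < l (c i) := fun i => hs.trans_le (hl i)
  have hinner : ∀ i j, inner ℝ (A (e i)) (A (e j)) = if i = j then l i else 0 := by
    intro i j
    have h1 : A.adjoint (A (e i)) = l i • e i := hsym.apply_eigenvectorBasis hn i
    rw [← LinearMap.adjoint_inner_left, h1, inner_smul_left,
      orthonormal_iff_ite.1 e.orthonormal i j]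
    simp
  let f : Fin k → EuclideanSpace ℝ (Fin k) := fun i => (√(l (c i)))⁻¹ • A (e (c i))
  have hf : Orthonormal ℝ f := by
    rw [orthonormal_iff_ite]
    intro i j
    simp only [f, inner_smul_left, inner_smul_right, hinner, hc.eq_iff]
    split_ifs with hij
    · subst hij
      have h1 := Real.mul_self_sqrt (hl0 i).le
      have h2 : √(l (c i)) ≠ 0 := (Real.sqrt_pos.2 (hl0 i)).ne'
      simp only [conj_trivial]
      field_simp
      rw [sq, h1]
    · simp
  have : Nonempty (Fin k) := ⟨⟨0, hk⟩⟩
  let b : OrthonormalBasis (Fin k) ℝ (EuclideanSpace ℝ (Fin k)) :=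
    (basisOfOrthonormalOfCardEqFinrank hf (by simp)).toOrthonormalBasis (by simpa using hf)
  have hb : ∀ i, b i = f i := fun i => by simp [b]
  refine ⟨Matrix.of fun t j => ∑ i, (√(l (c i)))⁻¹ * (e (c i)).ofLp t * (f i).ofLp j, ?_, ?_⟩
  · ext a j
    have h1 := b.sum_repr' (EuclideanSpace.single j (1 : ℝ))
    have h2 := congrArg (fun w : EuclideanSpace ℝ (Fin k) => w.ofLp a) h1
    simp only [WithLp.ofLp_sum, WithLp.ofLp_smul, Finset.sum_apply, Pi.smul_apply,
      smul_eq_mul, hb, EuclideanSpace.inner_single_right, conj_trivial, one_mul] at h2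
    have h3 : (1 : Matrix (Fin k) (Fin k) ℝ) a j = (EuclideanSpace.single j (1 : ℝ)).ofLp a := by
      simp [Matrix.one_apply]
    rw [h3, ← h2, Matrix.mul_apply]
    simp only [Matrix.of_apply, Finset.mul_sum]
    rw [Finset.sum_comm]
    refine Finset.sum_congr rfl fun i _ => ?_
    have h4 : (f i).ofLp a = (√(l (c i)))⁻¹ * ∑ t, Ws a t * (e (c i)).ofLp t := rfl
    rw [h4, Finset.mul_sum, Finset.mul_sum]
    exact Finset.sum_congr rfl fun t _ => by ring
  · intro r
    have h1 : WithLp.toLp 2 (r ᵥ* Matrix.of fun t j =>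
        ∑ i, (√(l (c i)))⁻¹ * (e (c i)).ofLp t * (f i).ofLp j) =
        ∑ i, ((√(l (c i)))⁻¹ * inner ℝ (e (c i)) (WithLp.toLp 2 r)) • b i := by
      ext j
      simp only [vecMul, dotProduct, Matrix.of_apply, WithLp.ofLp_sum, WithLp.ofLp_smul,
        Finset.sum_apply, Pi.smul_apply, smul_eq_mul, hb, PiLp.inner_apply, RCLike.inner_apply,
        conj_trivial, Finset.mul_sum, Finset.sum_mul]
      rw [Finset.sum_comm]
      exact Finset.sum_congr rfl fun i _ => Finset.sum_congr rfl fun t _ => by ring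
    have h2 : ∑ j, (r ᵥ* Matrix.of fun t j =>
        ∑ i, (√(l (c i)))⁻¹ * (e (c i)).ofLp t * (f i).ofLp j) j ^ 2 =
        ∑ i, ((√(l (c i)))⁻¹ * inner ℝ (e (c i)) (WithLp.toLp 2 r)) ^ 2 := by
      have h3 := congrArg (fun w : EuclideanSpace ℝ (Fin k) => ‖w‖ ^ 2) h1
      simp only [EuclideanSpace.real_norm_sq_eq] at h3
      rw [h3, ← EuclideanSpace.real_norm_sq_eq]
      have h4 := b.sum_sq_norm_inner_right
        (∑ i, ((√(l (c i)))⁻¹ * inner ℝ (e (c i)) (WithLp.toLp 2 r)) • b i)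
      rw [← h4]
      refine Finset.sum_congr rfl fun i _ => ?_
      rw [b.orthonormal.inner_right_fintype, Real.norm_eq_abs, sq_abs]
    rw [h2, Finset.mul_sum]
    have h5 := e.sum_sq_norm_inner_right (WithLp.toLp 2 r)
    rw [EuclideanSpace.real_norm_sq_eq] at h5
    refine le_trans ?_ h5.le
    have h6 : ∑ i, ‖inner ℝ (e (c i)) (WithLp.toLp 2 r)‖ ^ 2 ≤
        ∑ t, ‖inner ℝ (e t) (WithLp.toLp 2 r)‖ ^ 2 := by
      rw [← Finset.sum_image (s := Finset.univ) (g := c)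
        (f := fun t => ‖inner ℝ (e t) (WithLp.toLp 2 r)‖ ^ 2) (fun _ _ _ _ h => hc h)]
      exact Finset.sum_le_sum_of_subset_of_nonneg (Finset.subset_univ _)
        fun _ _ _ => sq_nonneg _
    refine le_trans (Finset.sum_le_sum fun i _ => ?_) h6
    rw [mul_pow, inv_pow, Real.sq_sqrt (hl0 i).le, Real.norm_eq_abs, sq_abs, ← mul_assoc]
    refine mul_le_of_le_one_left (sq_nonneg _) ?_
    rw [← div_eq_mul_inv, div_le_one (hl0 i)]
    exact hl i

/-- A linear choice of least squares solutions, characterized by the normal equations. -/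
theorem exists_linear_least_squares {k n : ℕ} (A : (Fin k → ℝ) →ₗ[ℝ] Fin n → ℝ) :
    ∃ L : (Fin n → ℝ) →ₗ[ℝ] Fin k → ℝ, ∀ y u, ∑ i, (y i - A (L y) i) * A u i = 0 := by
  let A' : (Fin k → ℝ) →ₗ[ℝ] EuclideanSpace ℝ (Fin n) :=
    (WithLp.linearEquiv 2 ℝ (Fin n → ℝ)).symm.toLinearMap ∘ₗ A
  obtain ⟨G, hG⟩ := A'.rangeRestrict.exists_rightInverse_of_surjective A'.range_rangeRestrict
  let F := LinearMap.range A'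
  refine ⟨G ∘ₗ F.orthogonalProjectionOnto.toLinearMap ∘ₗ
    (WithLp.linearEquiv 2 ℝ (Fin n → ℝ)).symm.toLinearMap, fun y u => ?_⟩
  set y' : EuclideanSpace ℝ (Fin n) := WithLp.toLp 2 y
  have h1 : A' (G (F.orthogonalProjectionOnto y')) = F.orthogonalProjectionOnto y' := by
    have := congrArg Subtype.val (LinearMap.congr_fun hG (F.orthogonalProjectionOnto y'))
    exact this
  have h2 := F.starProjection_inner_eq_zero y' (A' u) (LinearMap.mem_range_self _ _)
  rw [Submodule.starProjection_apply, ← h1, PiLp.inner_apply] at h2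
  rw [← h2]
  refine Finset.sum_congr rfl fun i _ => ?_
  simp only [RCLike.inner_apply, conj_trivial]
  exact mul_comm _ _

theorem dotProduct_mulVec_le_lamMax {m : ℕ} {A : Matrix (Fin m) (Fin m) ℝ} (hA : A.IsHermitian)
    (v : Fin m → ℝ) : v ⬝ᵥ (A *ᵥ v) ≤ lamMax A * (v ⬝ᵥ v) := by
  have h : (lamMax A • (1 : Matrix (Fin m) (Fin m) ℝ) - A).PosSemidef := by
    rw [posSemidef_iff_isHermitian_and_spectrum_nonneg]
    refine ⟨(isHermitian_one.smul (IsSelfAdjoint.all _)).sub hA, ?_⟩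
    rw [← Algebra.algebraMap_eq_smul_one, ← spectrum.singleton_sub_eq]
    rintro _ ⟨a, rfl, b, hb, rfl⟩
    exact sub_nonneg.2 (le_csSup A.finite_real_spectrum.bddAbove hb)
  have := h.dotProduct_mulVec_nonneg v
  simp only [star_trivial, sub_mulVec, smul_mulVec, one_mulVec, dotProduct_sub, dotProduct_smul,
    smul_eq_mul] at this
  linarith

theorem lamMin_mul_le_dotProduct_mulVec {m : ℕ} {A : Matrix (Fin m) (Fin m) ℝ}
    (hA : A.IsHermitian) (v : Fin m → ℝ) : lamMin A * (v ⬝ᵥ v) ≤ v ⬝ᵥ (A *ᵥ v) := by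
  have h : (A - lamMin A • (1 : Matrix (Fin m) (Fin m) ℝ)).PosSemidef := by
    rw [posSemidef_iff_isHermitian_and_spectrum_nonneg]
    refine ⟨hA.sub (isHermitian_one.smul (IsSelfAdjoint.all _)), ?_⟩
    rw [← Algebra.algebraMap_eq_smul_one, ← spectrum.sub_singleton_eq]
    rintro _ ⟨a, ha, b, rfl, rfl⟩
    exact sub_nonneg.2 (csInf_le A.finite_real_spectrum.bddBelow ha)
  have := h.dotProduct_mulVec_nonneg v
  simp only [star_trivial, sub_mulVec, smul_mulVec, one_mulVec, dotProduct_sub, dotProduct_smul,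
    smul_eq_mul] at this
  linarith

theorem lamMin_pos {m : ℕ} (hm : 0 < m) {A : Matrix (Fin m) (Fin m) ℝ} (hA : A.PosDef) :
    0 < lamMin A := by
  have : Nonempty (Fin m) := ⟨⟨0, hm⟩⟩
  have hne : (spectrum ℝ A).Nonempty := by
    rw [hA.isHermitian.spectrum_real_eq_range_eigenvalues]
    exact Set.range_nonempty _
  have hmem := hne.csInf_mem A.finite_real_spectrum
  rw [hA.isHermitian.spectrum_real_eq_range_eigenvalues] at hmem
  obtain ⟨i, hi⟩ := hmem
  have := hA.eigenvalues_pos i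
  unfold lamMin
  rw [hA.isHermitian.spectrum_real_eq_range_eigenvalues, ← hi]
  exact this

/-- `κ` is the ratio of uniform upper and lower bounds for the source covariances. -/
theorem exists_kappa_bounds {d T : ℕ} (hd : 0 < d) (hT : 0 < T) (p : Fin T → Measure (Fin d → ℝ))
    (hp : ∀ t, (secondMoment (p t)).PosDef) :
    ∃ a b : ℝ, 0 < b ∧ b ≤ a ∧ kappa p = a / b ∧ ∀ t v,
      b * (v ⬝ᵥ v) ≤ v ⬝ᵥ (secondMoment (p t) *ᵥ v) ∧
      v ⬝ᵥ (secondMoment (p t) *ᵥ v) ≤ a * (v ⬝ᵥ v) := by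
  have : Nonempty (Fin T) := ⟨⟨0, hT⟩⟩
  have hnn : ∀ v : Fin d → ℝ, 0 ≤ v ⬝ᵥ v := fun v => by
    simpa using dotProduct_star_self_nonneg v
  have hbd : ∀ t v, (⨅ t, lamMin (secondMoment (p t))) * (v ⬝ᵥ v) ≤
      v ⬝ᵥ (secondMoment (p t) *ᵥ v) ∧ v ⬝ᵥ (secondMoment (p t) *ᵥ v) ≤
      (⨆ t, lamMax (secondMoment (p t))) * (v ⬝ᵥ v) := by
    intro t v
    constructor
    · refine le_trans ?_ (lamMin_mul_le_dotProduct_mulVec (hp t).isHermitian v)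
      exact mul_le_mul_of_nonneg_right (ciInf_le (Set.finite_range _).bddBelow t) (hnn v)
    · refine (dotProduct_mulVec_le_lamMax (hp t).isHermitian v).trans ?_
      exact mul_le_mul_of_nonneg_right
        (le_ciSup (f := fun t => lamMax (secondMoment (p t))) (Set.finite_range _).bddAbove t)
        (hnn v)
  refine ⟨⨆ t, lamMax (secondMoment (p t)), ⨅ t, lamMin (secondMoment (p t)), ?_, ?_, rfl, hbd⟩
  · obtain ⟨t, ht⟩ := exists_eq_ciInf_of_finite (f := fun t => lamMin (secondMoment (p t)))
    rw [← ht]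
    exact lamMin_pos hd (hp t)
  · obtain ⟨h1, h2⟩ := hbd ⟨0, hT⟩ (Pi.single ⟨0, hd⟩ 1)
    have := h1.trans h2
    simpa using this

/-! ### The source stage: deterministic bounds -/

theorem exists_grid_near {g : ℕ} (hg : 0 < g) {x : ℝ} (hx : |x| ≤ 1) :
    ∃ j : Fin (g + 1), |x - (-1 + 2 * (j : ℝ) / g)| ≤ 2 / g := by
  obtain ⟨h1, h2⟩ := abs_le.1 hx
  have hg' : (0 : ℝ) < g := by exact_mod_cast hg
  have hy : 0 ≤ (x + 1) * g / 2 := by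
    have : 0 ≤ x + 1 := by linarith
    positivity
  have hf := Nat.floor_le hy
  have hf' := Nat.lt_floor_add_one ((x + 1) * g / 2)
  refine ⟨⟨⌊(x + 1) * g / 2⌋₊, ?_⟩, ?_⟩
  · rw [Nat.lt_succ_iff]
    have : (⌊(x + 1) * g / 2⌋₊ : ℝ) ≤ g := hf.trans (by nlinarith)
    exact_mod_cast this
  · have e : x - (-1 + 2 * (⌊(x + 1) * g / 2⌋₊ : ℝ) / g) =
        (2 / g) * ((x + 1) * g / 2 - ⌊(x + 1) * g / 2⌋₊) := by
      field_simp
      ring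
    simp only [e]
    rw [abs_mul, abs_of_nonneg (by positivity : (0 : ℝ) ≤ 2 / g)]
    refine mul_le_of_le_one_right (by positivity) ?_
    rw [abs_le]
    constructor <;> linarith

section SourceDeterministic

variable {d k T n : ℕ}

theorem predict_eq_dotProduct (B : Matrix (Fin d) (Fin k) ℝ) (w : Fin k → ℝ) (x : Fin d → ℝ) :
    predict B w x = (B *ᵥ w) ⬝ᵥ x := by
  rw [predict, mulVec_transpose, ← dotProduct_comm, ← dotProduct_mulVec, dotProduct_comm]

theorem predict_col (B : Matrix (Fin d) (Fin k) ℝ) (W : Matrix (Fin k) (Fin T) ℝ) (t : Fin T)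
    (x : Fin d → ℝ) : predict B (fun j => W j t) x = (B * W)ᵀ t ⬝ᵥ x := by
  rw [predict_eq_dotProduct]
  rfl

/-- The label noise of a source data set relative to the ground truth. -/
def sourceNoise (Bs : Matrix (Fin d) (Fin k) ℝ) (Ws : Matrix (Fin k) (Fin T) ℝ)
    (D : SourceData d T n) (t : Fin T) (i : Fin n) : ℝ :=
  (D t i).2 - (Bs * Ws)ᵀ t ⬝ᵥ (D t i).1

/-- The matrices with entries on the uniform grid of `g + 1` points in `[-1, 1]`. -/
noncomputable def gridMatrix {d m : ℕ} (g : ℕ) (a : Fin d → Fin m → Fin (g + 1)) :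
    Matrix (Fin d) (Fin m) ℝ :=
  Matrix.of fun i j => -1 + 2 * ((a i j : ℕ) : ℝ) / g

theorem exists_gridMatrix_near {m g : ℕ} (hg : 0 < g) (V : Matrix (Fin d) (Fin m) ℝ)
    (hV : ∀ i j, |V i j| ≤ 1) : ∃ a : Fin d → Fin m → Fin (g + 1),
      ∀ i j, |(V - gridMatrix g a) i j| ≤ 2 / g := by
  choose a ha using fun i j => exists_grid_near hg (hV i j)
  exact ⟨a, ha⟩

/-- The empirical covariances of all source tasks are comparable with the population ones. -/
def SourceCovGood (p : Fin T → Measure (Fin d → ℝ)) (D : SourceData d T n) : Prop :=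
  ∀ t (θ : Fin d → ℝ), n / 2 * (θ ⬝ᵥ (secondMoment (p t) *ᵥ θ)) ≤ ∑ i, (θ ⬝ᵥ (D t i).1) ^ 2 ∧
    ∑ i, (θ ⬝ᵥ (D t i).1) ^ 2 ≤ 2 * n * (θ ⬝ᵥ (secondMoment (p t) *ᵥ θ))

/-- On every grid representation of width `2k` the noise explains at most `τ`: the penalised
correlation of the noise with the fitted values is at most `τ`. -/
def SourceGridGood (Bs : Matrix (Fin d) (Fin k) ℝ) (Ws : Matrix (Fin k) (Fin T) ℝ) (g : ℕ) (τ : ℝ)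
    (D : SourceData d T n) : Prop :=
  ∀ (a : Fin d → Fin (2 * k) → Fin (g + 1)) (R : Matrix (Fin (2 * k)) (Fin T) ℝ),
    2 * ∑ t, ∑ i, sourceNoise Bs Ws D t i * ((gridMatrix g a * R)ᵀ t ⬝ᵥ (D t i).1) -
      ∑ t, ∑ i, ((gridMatrix g a * R)ᵀ t ⬝ᵥ (D t i).1) ^ 2 ≤ τ

/-- The total squared noise is at most `τ`. -/
def SourceNoiseGood (Bs : Matrix (Fin d) (Fin k) ℝ) (Ws : Matrix (Fin k) (Fin T) ℝ) (τ : ℝ)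
    (D : SourceData d T n) : Prop :=
  ∑ t, ∑ i, sourceNoise Bs Ws D t i ^ 2 ≤ τ

theorem dotProduct_self_eq_sum_sq (v : Fin d → ℝ) : v ⬝ᵥ v = ∑ i, v i ^ 2 := by
  simp [dotProduct, sq]

/-- The basic inequality: a source minimizer does at least as well as the ground truth. -/
theorem RepLearn.IsSourceMinimizer.sum_sq_le {D : SourceData d T n} (hn : 0 < n) (hT : 0 < T)
    {B : Matrix (Fin d) (Fin k) ℝ} {W : Matrix (Fin k) (Fin T) ℝ} (h : IsSourceMinimizer D B W)
    (Bs : Matrix (Fin d) (Fin k) ℝ) (Ws : Matrix (Fin k) (Fin T) ℝ) :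
    ∑ t, ∑ i, ((B * W - Bs * Ws)ᵀ t ⬝ᵥ (D t i).1) ^ 2 ≤
      2 * ∑ t, ∑ i, sourceNoise Bs Ws D t i * ((B * W - Bs * Ws)ᵀ t ⬝ᵥ (D t i).1) := by
  have h1 := h Bs Ws
  unfold sourceObjective at h1
  have hpos : 0 < 1 / (2 * (n : ℝ) * (T : ℝ)) := by positivity
  have h2 := le_of_mul_le_mul_left h1 hpos
  simp only [predict_col] at h2
  have e : ∀ t i, ((D t i).2 - (B * W)ᵀ t ⬝ᵥ (D t i).1) ^ 2 =
      ((B * W - Bs * Ws)ᵀ t ⬝ᵥ (D t i).1) ^ 2 - 2 * (sourceNoise Bs Ws D t i *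
        ((B * W - Bs * Ws)ᵀ t ⬝ᵥ (D t i).1)) + ((D t i).2 - (Bs * Ws)ᵀ t ⬝ᵥ (D t i).1) ^ 2 := by
    intro t i
    have : (B * W - Bs * Ws)ᵀ t ⬝ᵥ (D t i).1 =
        (B * W)ᵀ t ⬝ᵥ (D t i).1 - (Bs * Ws)ᵀ t ⬝ᵥ (D t i).1 := by
      rw [← sub_dotProduct]; rfl
    rw [this, sourceNoise]
    ring
  simp only [e, Finset.sum_add_distrib, Finset.sum_sub_distrib, ← Finset.mul_sum] at h2
  linarith

/-- Rounding the left factor of `V * R` to the grid changes the fitted values by a small fraction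
only. -/
theorem SourceCovGood.sum_rounding_le {p : Fin T → Measure (Fin d → ℝ)} {D : SourceData d T n}
    (hD : SourceCovGood p D) (hn : 0 < n) {a b : ℝ} (hb : 0 < b) (ha : 0 ≤ a)
    (hab : ∀ t v, b * (v ⬝ᵥ v) ≤ v ⬝ᵥ (secondMoment (p t) *ᵥ v) ∧
      v ⬝ᵥ (secondMoment (p t) *ᵥ v) ≤ a * (v ⬝ᵥ v)) {m g : ℕ} (hg : 0 < g)
    (hgrid : 16 * (a / b) * (d * m) * n ≤ (g : ℝ) ^ 2)
    {U : Matrix (Fin d) (Fin m) ℝ} (hU : ∀ i j, |U i j| ≤ 2 / g)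
    {R : Matrix (Fin m) (Fin T) ℝ} {Θ : Matrix (Fin d) (Fin T) ℝ}
    (hR : ∑ t, ∑ j, R j t ^ 2 ≤ ∑ t, ∑ i, Θ i t ^ 2) :
    n * ∑ t, ∑ i, ((U * R)ᵀ t ⬝ᵥ (D t i).1) ^ 2 ≤ ∑ t, ∑ i, (Θᵀ t ⬝ᵥ (D t i).1) ^ 2 := by
  have hg' : (0 : ℝ) < g := by exact_mod_cast hg
  have hn' : (0 : ℝ) < n := by exact_mod_cast hn
  have h1 : ∀ t, (U * R)ᵀ t ⬝ᵥ (U * R)ᵀ t ≤ d * m * (2 / g) ^ 2 * ∑ j, R j t ^ 2 := by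
    intro t
    rw [dotProduct_self_eq_sum_sq]
    calc ∑ i, (U * R)ᵀ t i ^ 2 ≤ ∑ i : Fin d, m * (2 / (g : ℝ)) ^ 2 * ∑ j, R j t ^ 2 := by
          refine Finset.sum_le_sum fun i _ => ?_
          rw [transpose_apply, Matrix.mul_apply]
          refine (Finset.sum_mul_sq_le_sq_mul_sq _ _ _).trans ?_
          refine mul_le_mul_of_nonneg_right ?_ (Finset.sum_nonneg fun j _ => sq_nonneg _)
          calc ∑ j, U i j ^ 2 ≤ ∑ j : Fin m, (2 / (g : ℝ)) ^ 2 := by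
                refine Finset.sum_le_sum fun j _ => ?_
                rw [← sq_abs]
                gcongr
                exact hU i j
            _ = _ := by simp
      _ = _ := by
          rw [Finset.sum_const, Finset.card_univ, Fintype.card_fin, nsmul_eq_mul]
          ring
  have h2 : ∑ t, ∑ i, ((U * R)ᵀ t ⬝ᵥ (D t i).1) ^ 2 ≤
      2 * n * a * (d * m * (2 / g) ^ 2) * ∑ t, ∑ j, R j t ^ 2 := by
    rw [Finset.mul_sum]
    refine Finset.sum_le_sum fun t _ => ?_
    calc _ ≤ 2 * n * ((U * R)ᵀ t ⬝ᵥ (secondMoment (p t) *ᵥ (U * R)ᵀ t)) := (hD t _).2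
      _ ≤ 2 * n * (a * (d * m * (2 / g) ^ 2 * ∑ j, R j t ^ 2)) := by
          gcongr
          exact ((hab t _).2).trans (mul_le_mul_of_nonneg_left (h1 t) ha)
      _ = _ := by ring
  have h3 : n * b / 2 * ∑ t, ∑ i, Θ i t ^ 2 ≤ ∑ t, ∑ i, (Θᵀ t ⬝ᵥ (D t i).1) ^ 2 := by
    rw [Finset.mul_sum]
    refine Finset.sum_le_sum fun t _ => ?_
    refine le_trans ?_ (hD t _).1
    have := (hab t (Θᵀ t)).1
    rw [dotProduct_self_eq_sum_sq] at this
    calc n * b / 2 * ∑ i, Θ i t ^ 2 = n / 2 * (b * ∑ i, Θᵀ t i ^ 2) := by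
          simp only [transpose_apply]; ring
      _ ≤ _ := by gcongr
  have h0 : 0 ≤ ∑ t, ∑ i, Θ i t ^ 2 :=
    Finset.sum_nonneg fun _ _ => Finset.sum_nonneg fun _ _ => sq_nonneg _
  calc n * ∑ t, ∑ i, ((U * R)ᵀ t ⬝ᵥ (D t i).1) ^ 2
      ≤ n * (2 * n * a * (d * m * (2 / g) ^ 2) * ∑ t, ∑ i, Θ i t ^ 2) := by
        gcongr
        refine h2.trans ?_
        gcongr
    _ = (16 * (a / b) * (d * m) * n) / g ^ 2 * (n * b / 2 * ∑ t, ∑ i, Θ i t ^ 2) := by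
        field_simp
        ring
    _ ≤ 1 * (n * b / 2 * ∑ t, ∑ i, Θ i t ^ 2) := by
        gcongr
        rw [div_le_one (by positivity)]
        exact hgrid
    _ ≤ _ := by rw [one_mul]; exact h3

/-- In-sample prediction error of a source minimizer. The error matrix has rank at most `2k`; its
left factor is rounded to the grid, the grid part of the basic inequality is absorbed by
`SourceGridGood`, and the rounding error by the total noise. -/
theorem RepLearn.IsSourceMinimizer.sum_sq_error_le {p : Fin T → Measure (Fin d → ℝ)}
    {D : SourceData d T n}
    (hn : 3 ≤ n) (hT : 0 < T) {B : Matrix (Fin d) (Fin k) ℝ} {W : Matrix (Fin k) (Fin T) ℝ}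
    (h : IsSourceMinimizer D B W) {Bs : Matrix (Fin d) (Fin k) ℝ}
    {Ws : Matrix (Fin k) (Fin T) ℝ} (hD : SourceCovGood p D) {a b : ℝ} (hb : 0 < b) (ha : 0 ≤ a)
    (hab : ∀ t v, b * (v ⬝ᵥ v) ≤ v ⬝ᵥ (secondMoment (p t) *ᵥ v) ∧
      v ⬝ᵥ (secondMoment (p t) *ᵥ v) ≤ a * (v ⬝ᵥ v)) {g : ℕ} (hg : 0 < g)
    (hgrid : 16 * (a / b) * (d * (2 * k : ℕ)) * n ≤ (g : ℝ) ^ 2) {τ₁ τ₂ : ℝ}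
    (h1 : SourceGridGood Bs Ws g τ₁ D) (h2 : SourceNoiseGood Bs Ws τ₂ D) :
    ∑ t, ∑ i, ((B * W - Bs * Ws)ᵀ t ⬝ᵥ (D t i).1) ^ 2 ≤ 16 * (τ₁ + τ₂ / n) := by
  have hn0 : 0 < n := by omega
  have hn' : (3 : ℝ) ≤ n := by exact_mod_cast hn
  have hbasic := h.sum_sq_le hn0 hT Bs Ws
  obtain ⟨V, R, hVR, hV1, hR⟩ := exists_factor_mul_sub_mul B Bs W Ws
  rw [← hVR] at hbasic hR ⊢
  obtain ⟨c, hc⟩ := exists_gridMatrix_near hg V hV1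
  have hround := hD.sum_rounding_le hn0 hb ha hab hg hgrid hc hR
  set z := sourceNoise Bs Ws D
  set u : Fin T → Fin n → ℝ := fun t i => (V * R)ᵀ t ⬝ᵥ (D t i).1
  set e : Fin T → Fin n → ℝ := fun t i => ((V - gridMatrix g c) * R)ᵀ t ⬝ᵥ (D t i).1
  set w : Fin T → Fin n → ℝ := fun t i => (gridMatrix g c * R)ᵀ t ⬝ᵥ (D t i).1
  have hue : ∀ t i, u t i = w t i + e t i := by
    intro t i
    simp only [u, w, e]
    rw [← add_dotProduct]
    congr 1
    rw [Matrix.sub_mul]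
    ext j
    change (V * R) j t = (gridMatrix g c * R) j t + ((V * R) j t - (gridMatrix g c * R) j t)
    ring
  have hgood : 2 * ∑ t, ∑ i, z t i * w t i ≤ 8 * τ₁ + 1 / 8 * ∑ t, ∑ i, w t i ^ 2 := by
    -- scaling `R` by `1 / 8` reduces the weight of the quadratic term
    have h3 := h1 c ((1 / 8 : ℝ) • R)
    have e1 : ∀ t i, (gridMatrix g c * ((1 / 8 : ℝ) • R))ᵀ t ⬝ᵥ (D t i).1 = 1 / 8 * w t i := by
      intro t i
      have : (gridMatrix g c * ((1 / 8 : ℝ) • R))ᵀ t = (1 / 8 : ℝ) • (gridMatrix g c * R)ᵀ t := by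
        rw [Matrix.mul_smul]; rfl
      rw [this, smul_dotProduct]
      rfl
    simp only [e1] at h3
    have e2 : ∑ t, ∑ i, sourceNoise Bs Ws D t i * (1 / 8 * w t i) =
        1 / 8 * ∑ t, ∑ i, z t i * w t i := by
      simp only [Finset.mul_sum]
      exact Finset.sum_congr rfl fun t _ => Finset.sum_congr rfl fun i _ => by
        simp only [z]; ring
    have e3 : ∑ t, ∑ i, (1 / 8 * w t i) ^ 2 = 1 / 64 * ∑ t, ∑ i, w t i ^ 2 := by
      simp only [Finset.mul_sum]
      exact Finset.sum_congr rfl fun t _ => Finset.sum_congr rfl fun i _ => by ring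
    rw [e2, e3] at h3
    linarith
  have hz : ∑ t, ∑ i, z t i ^ 2 ≤ τ₂ := h2
  have hsplit : 2 * ∑ t, ∑ i, z t i * u t i =
      2 * ∑ t, ∑ i, z t i * w t i + 2 * ∑ t, ∑ i, z t i * e t i := by
    rw [← mul_add, ← Finset.sum_add_distrib]
    congr 1
    refine Finset.sum_congr rfl fun t _ => ?_
    rw [← Finset.sum_add_distrib]
    exact Finset.sum_congr rfl fun i _ => by rw [hue]; ring
  have hze : 2 * ∑ t, ∑ i, z t i * e t i ≤
      8 / n * ∑ t, ∑ i, z t i ^ 2 + n / 8 * ∑ t, ∑ i, e t i ^ 2 := by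
    simp only [Finset.mul_sum, ← Finset.sum_add_distrib]
    refine Finset.sum_le_sum fun t _ => Finset.sum_le_sum fun i _ => ?_
    have e4 : 8 / n * z t i ^ 2 + n / 8 * e t i ^ 2 - 2 * (z t i * e t i) =
        (8 * z t i - n * e t i) ^ 2 / (8 * n) := by
      field_simp
      ring
    have : 0 ≤ (8 * z t i - n * e t i) ^ 2 / (8 * n) := by positivity
    linarith
  have hw : ∑ t, ∑ i, w t i ^ 2 ≤ 2 * ∑ t, ∑ i, u t i ^ 2 + 2 * ∑ t, ∑ i, e t i ^ 2 := by
    simp only [Finset.mul_sum, ← Finset.sum_add_distrib]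
    refine Finset.sum_le_sum fun t _ => Finset.sum_le_sum fun i _ => ?_
    rw [hue]
    nlinarith [sq_nonneg (w t i + 2 * e t i)]
  have hnz : 8 / n * ∑ t, ∑ i, z t i ^ 2 ≤ 8 * (τ₂ / n) := by
    rw [mul_div_assoc', div_mul_eq_mul_div]
    gcongr
  change n * ∑ t, ∑ i, e t i ^ 2 ≤ ∑ t, ∑ i, u t i ^ 2 at hround
  change ∑ t, ∑ i, u t i ^ 2 ≤ 2 * ∑ t, ∑ i, z t i * u t i at hbasic
  change ∑ t, ∑ i, u t i ^ 2 ≤ _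
  have he0 : 0 ≤ ∑ t, ∑ i, e t i ^ 2 :=
    Finset.sum_nonneg fun _ _ => Finset.sum_nonneg fun _ _ => sq_nonneg _
  have he3 : 3 * ∑ t, ∑ i, e t i ^ 2 ≤ n * ∑ t, ∑ i, e t i ^ 2 := by gcongr
  linarith

/-- The sum of squared residuals of the linear predictors given by the columns of `Θ`. -/
def residualSq (D : SourceData d T n) (Θ : Matrix (Fin d) (Fin T) ℝ) : ℝ :=
  ∑ t, ∑ i, ((D t i).2 - Θᵀ t ⬝ᵥ (D t i).1) ^ 2

theorem sourceObjective_eq_residualSq (D : SourceData d T n) (B : Matrix (Fin d) (Fin k) ℝ)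
    (W : Matrix (Fin k) (Fin T) ℝ) :
    sourceObjective D B W = 1 / (2 * (n : ℝ) * (T : ℝ)) * residualSq D (B * W) := by
  simp only [sourceObjective, predict_col, residualSq]

theorem residualSq_nonneg (D : SourceData d T n) (Θ : Matrix (Fin d) (Fin T) ℝ) :
    0 ≤ residualSq D Θ :=
  Finset.sum_nonneg fun _ _ => Finset.sum_nonneg fun _ _ => sq_nonneg _

/-- The squared Frobenius norm. -/
def frobSq (Θ : Matrix (Fin d) (Fin T) ℝ) : ℝ := ∑ t, ∑ i, Θ i t ^ 2

theorem continuous_residualSq (D : SourceData d T n) : Continuous (residualSq D) := by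
  unfold residualSq dotProduct transpose
  simp only [Matrix.of_apply]
  fun_prop

theorem continuous_frobSq : Continuous (frobSq : Matrix (Fin d) (Fin T) ℝ → ℝ) := by
  unfold frobSq
  fun_prop

theorem sq_apply_le_frobSq (Θ : Matrix (Fin d) (Fin T) ℝ) (i : Fin d) (t : Fin T) :
    Θ i t ^ 2 ≤ frobSq Θ :=
  (Finset.single_le_sum (f := fun i => Θ i t ^ 2) (fun _ _ => sq_nonneg _)
    (Finset.mem_univ i)).trans (Finset.single_le_sum (f := fun t => ∑ i, Θ i t ^ 2)
      (fun _ _ => Finset.sum_nonneg fun _ _ => sq_nonneg _) (Finset.mem_univ t))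

/-- The residuals are coercive in the Frobenius norm. -/
theorem SourceCovGood.frobSq_le {p : Fin T → Measure (Fin d → ℝ)}
    {D : SourceData d T n} (hD : SourceCovGood p D) {b : ℝ}
    (hpb : ∀ t v, b * (v ⬝ᵥ v) ≤ v ⬝ᵥ (secondMoment (p t) *ᵥ v)) (Θ : Matrix (Fin d) (Fin T) ℝ) :
    n * b / 4 * frobSq Θ ≤ residualSq D Θ + residualSq D 0 := by
  have h1 : n * b / 2 * frobSq Θ ≤ ∑ t, ∑ i, (Θᵀ t ⬝ᵥ (D t i).1) ^ 2 := by
    rw [frobSq, Finset.mul_sum]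
    refine Finset.sum_le_sum fun t _ => ?_
    refine le_trans ?_ (hD t _).1
    have := hpb t (Θᵀ t)
    rw [dotProduct_self_eq_sum_sq] at this
    calc n * b / 2 * ∑ i, Θ i t ^ 2 = n / 2 * (b * ∑ i, Θᵀ t i ^ 2) := by
          simp only [transpose_apply]; ring
      _ ≤ _ := by gcongr
  have h2 : ∑ t, ∑ i, (Θᵀ t ⬝ᵥ (D t i).1) ^ 2 ≤ 2 * (residualSq D Θ + residualSq D 0) := by
    simp only [residualSq, Finset.mul_sum, ← Finset.sum_add_distrib]
    refine Finset.sum_le_sum fun t _ => Finset.sum_le_sum fun i _ => ?_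
    have : (0 : Matrix (Fin d) (Fin T) ℝ)ᵀ t ⬝ᵥ (D t i).1 = 0 := by
      rw [transpose_zero]; exact zero_dotProduct _
    rw [this]
    nlinarith [sq_nonneg (2 * (D t i).2 - Θᵀ t ⬝ᵥ (D t i).1)]
  linarith

theorem isCompact_entries_mem_Icc {a b : ℕ} (r s : ℝ) :
    IsCompact {V : Matrix (Fin a) (Fin b) ℝ | ∀ i j, V i j ∈ Set.Icc r s} := by
  have h := isCompact_univ_pi (X := fun _ : Fin a => Fin b → ℝ)
    (s := fun _ => Set.univ.pi fun _ => Set.Icc r s)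
    fun _ => isCompact_univ_pi fun _ => isCompact_Icc
  have e : (Set.univ.pi fun _ : Fin a => Set.univ.pi fun _ : Fin b => Set.Icc r s) =
      {V : Fin a → Fin b → ℝ | ∀ i j, V i j ∈ Set.Icc r s} := by
    ext V
    simp only [Set.mem_pi, Set.mem_univ, true_imp_iff, Set.mem_ofPred_eq]
  rw [e] at h
  exact h

/-- With comparable empirical covariances the source objective attains its minimum: the products
`B * W` of bounded Frobenius norm all arise from a compact set of factor pairs. -/
theorem SourceCovGood.exists_isSourceMinimizer {p : Fin T → Measure (Fin d → ℝ)}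
    {D : SourceData d T n} (hD : SourceCovGood p D) (hn : 0 < n) {b : ℝ} (hb : 0 < b)
    (hpb : ∀ t v, b * (v ⬝ᵥ v) ≤ v ⬝ᵥ (secondMoment (p t) *ᵥ v)) :
    ∃ (B : Matrix (Fin d) (Fin k) ℝ) (W : Matrix (Fin k) (Fin T) ℝ), IsSourceMinimizer D B W := by
  have hn' : (0 : ℝ) < n := by exact_mod_cast hn
  -- beyond Frobenius norm `√M` every predictor matrix is worse than `0`
  obtain ⟨M, hMdef⟩ : ∃ M : ℝ, M = 8 * residualSq D 0 / (n * b) := ⟨_, rfl⟩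
  have hM : 0 ≤ M := by
    have := residualSq_nonneg D 0
    rw [hMdef]
    positivity
  have hM' : n * b / 4 * M = 2 * residualSq D 0 := by
    rw [hMdef]
    field_simp
    ring
  let K : Set (Matrix (Fin d) (Fin k) ℝ × Matrix (Fin k) (Fin T) ℝ) :=
    {q | (∀ i j, |q.1 i j| ≤ 1) ∧ frobSq q.2 ≤ frobSq (q.1 * q.2) ∧ frobSq (q.1 * q.2) ≤ M}
  have hmul : Continuous fun q : Matrix (Fin d) (Fin k) ℝ × Matrix (Fin k) (Fin T) ℝ =>
      q.1 * q.2 := continuous_fst.matrix_mul continuous_snd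
  have hKclosed : IsClosed K := by
    refine IsClosed.inter ?_ (IsClosed.inter
      (isClosed_le (continuous_frobSq.comp continuous_snd) (continuous_frobSq.comp hmul))
      (isClosed_le (continuous_frobSq.comp hmul) continuous_const))
    have : {q : Matrix (Fin d) (Fin k) ℝ × Matrix (Fin k) (Fin T) ℝ | ∀ i j, |q.1 i j| ≤ 1} =
        ⋂ i, ⋂ j, {q | |q.1 i j| ≤ 1} := by ext; simp
    change IsClosed {q : Matrix (Fin d) (Fin k) ℝ × Matrix (Fin k) (Fin T) ℝ |
      ∀ i j, |q.1 i j| ≤ 1}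
    rw [this]
    exact isClosed_iInter fun i => isClosed_iInter fun j =>
      isClosed_le (continuous_fst.matrix_elem i j).abs continuous_const
  have hKsub : K ⊆ {V : Matrix (Fin d) (Fin k) ℝ | ∀ i j, V i j ∈ Set.Icc (-1 : ℝ) 1} ×ˢ
      {R : Matrix (Fin k) (Fin T) ℝ | ∀ i j, R i j ∈ Set.Icc (-√M) √M} := by
    rintro ⟨V, R⟩ ⟨h1, h2, h3⟩
    have hR : ∀ j t, |R j t| ≤ √M := by
      intro j t
      rw [← Real.sqrt_sq_eq_abs]
      exact Real.sqrt_le_sqrt ((sq_apply_le_frobSq R j t).trans (h2.trans h3))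
    exact ⟨fun i j => abs_le.1 (h1 i j), fun j t => abs_le.1 (hR j t)⟩
  have hKcomp : IsCompact K := ((isCompact_entries_mem_Icc _ _).prod
    (isCompact_entries_mem_Icc _ _)).of_isClosed_subset hKclosed hKsub
  have hz : frobSq (0 : Matrix (Fin k) (Fin T) ℝ) = 0 := by simp [frobSq]
  have hz' : frobSq (0 : Matrix (Fin d) (Fin T) ℝ) = 0 := by simp [frobSq]
  have hK0 : (0, 0) ∈ K := by
    refine ⟨by simp, ?_, ?_⟩
    · rw [Matrix.zero_mul, hz, hz']
    · rw [Matrix.zero_mul, hz']; exact hM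
  obtain ⟨q₀, hmin⟩ : ∃ q₀ : Matrix (Fin d) (Fin k) ℝ × Matrix (Fin k) (Fin T) ℝ,
      ∀ q ∈ K, residualSq D (q₀.1 * q₀.2) ≤ residualSq D (q.1 * q.2) := by
    obtain ⟨q₀, -, h⟩ := hKcomp.exists_isMinOn (f := fun q => residualSq D (q.1 * q.2)) ⟨_, hK0⟩
      ((continuous_residualSq D).comp hmul).continuousOn
    exact ⟨q₀, isMinOn_iff.1 h⟩
  refine ⟨q₀.1, q₀.2, fun B W => ?_⟩
  rw [sourceObjective_eq_residualSq, sourceObjective_eq_residualSq]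
  refine mul_le_mul_of_nonneg_left ?_ (by positivity)
  by_cases hBW : frobSq (B * W) ≤ M
  · obtain ⟨V, R, hVR, hV, hR⟩ := exists_factor_mul B W
    rw [← hVR] at hBW hR ⊢
    exact hmin (V, R) ⟨hV, hR, hBW⟩
  · have h0 := hmin (0, 0) hK0
    simp only [Matrix.zero_mul] at h0
    have h1 := hD.frobSq_le hpb (B * W)
    have h2 : n * b / 4 * M ≤ n * b / 4 * frobSq (B * W) := by
      gcongr
      exact (not_le.1 hBW).le
    linarith

end SourceDeterministic

/-! ### The source stage: probability of the favourable events -/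

/-- A conditional bound on every slice of a set bounds its probability. -/
theorem prod_le_of_forall_preimage_le {α β : Type*} [MeasurableSpace α] [MeasurableSpace β]
    (μ : Measure α) [IsProbabilityMeasure μ] (ν : Measure β) [SFinite ν] {s : Set (α × β)}
    (hs : MeasurableSet s) {c : ENNReal} (h : ∀ x, ν (Prod.mk x ⁻¹' s) ≤ c) :
    (μ.prod ν) s ≤ c := by
  rw [Measure.prod_apply hs]
  calc ∫⁻ x, ν (Prod.mk x ⁻¹' s) ∂μ ≤ ∫⁻ _, c ∂μ := lintegral_mono h
    _ = c := by simp

section SourceProbability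

variable {d k T n : ℕ}

theorem isClosed_sourceCovGood (p : Fin T → Measure (Fin d → ℝ)) :
    IsClosed {D : SourceData d T n | SourceCovGood p D} := by
  simp only [SourceCovGood, Set.ofPred_forall]
  refine isClosed_iInter fun t => isClosed_iInter fun θ => ?_
  have : Continuous fun D : SourceData d T n => ∑ i, (θ ⬝ᵥ (D t i).1) ^ 2 := by
    unfold dotProduct; fun_prop
  exact (isClosed_le continuous_const this).inter (isClosed_le this continuous_const)

theorem continuous_sourceNoise (Bs : Matrix (Fin d) (Fin k) ℝ) (Ws : Matrix (Fin k) (Fin T) ℝ)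
    (t : Fin T) (i : Fin n) :
    Continuous fun D : SourceData d T n => sourceNoise Bs Ws D t i := by
  unfold sourceNoise dotProduct
  fun_prop

theorem isClosed_sourceGridGood (Bs : Matrix (Fin d) (Fin k) ℝ) (Ws : Matrix (Fin k) (Fin T) ℝ)
    (g : ℕ) (τ : ℝ) : IsClosed {D : SourceData d T n | SourceGridGood Bs Ws g τ D} := by
  simp only [SourceGridGood, Set.ofPred_forall]
  refine isClosed_iInter fun a => isClosed_iInter fun R => ?_
  have h1 := continuous_sourceNoise (n := n) Bs Ws
  have h2 : ∀ t i, Continuous fun D : SourceData d T n =>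
      (gridMatrix g a * R)ᵀ t ⬝ᵥ (D t i).1 := by
    intro t i
    unfold dotProduct
    fun_prop
  refine isClosed_le (Continuous.sub (Continuous.mul continuous_const ?_) ?_) continuous_const
  · exact continuous_finsetSum _ fun t _ => continuous_finsetSum _ fun i _ => (h1 t i).mul (h2 t i)
  · exact continuous_finsetSum _ fun t _ => continuous_finsetSum _ fun i _ => (h2 t i).pow 2

theorem isClosed_sourceNoiseGood (Bs : Matrix (Fin d) (Fin k) ℝ) (Ws : Matrix (Fin k) (Fin T) ℝ)
    (τ : ℝ) : IsClosed {D : SourceData d T n | SourceNoiseGood Bs Ws τ D} :=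
  isClosed_le (continuous_finsetSum _ fun t _ => continuous_finsetSum _ fun i _ =>
    (continuous_sourceNoise Bs Ws t i).pow 2) continuous_const

theorem sourceNoise_sourceSample (Bs : Matrix (Fin d) (Fin k) ℝ) (Ws : Matrix (Fin k) (Fin T) ℝ)
    (σ : ℝ) (a : (Fin T → Fin n → Fin d → ℝ) × (Fin T → Fin n → ℝ)) (t : Fin T) (i : Fin n) :
    sourceNoise Bs Ws (sourceSample Bs Ws σ a) t i = σ * a.2 t i := by
  simp only [sourceNoise, sourceSample, predict_col]
  ring

theorem sourceLaw_sourceCovGood_compl_le {p : Fin T → Measure (Fin d → ℝ)} {ρ : ℝ≥0}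
    (hp : ∀ t, IsSubgaussianInput ρ (p t)) (hd : 0 < d) (Bs : Matrix (Fin d) (Fin k) ℝ)
    (Ws : Matrix (Fin k) (Fin T) ℝ) (σ : ℝ≥0) {δ : ℝ} (hδ : 0 < δ) (hδ1 : δ ≤ 1)
    (hn : 1000000 * ((ρ : ℝ) ^ 4 * (d + Real.log (1 / δ))) ≤ n) :
    sourceLaw n p Bs Ws σ {D | SourceCovGood p D}ᶜ ≤ T * ENNReal.ofReal δ := by
  have hprob : ∀ t, IsProbabilityMeasure (p t) := fun t => (hp t).isProbabilityMeasure
  rw [sourceLaw_eq_map, Measure.map_apply (measurable_sourceSample _ _ _)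
    (isClosed_sourceCovGood p).measurableSet.compl]
  let C : Fin T → Set (Fin n → Fin d → ℝ) := fun t =>
    {x | ∀ u : Fin d → ℝ, n / 2 * (u ⬝ᵥ (secondMoment (p t) *ᵥ u)) ≤ ∑ i, (u ⬝ᵥ x i) ^ 2 ∧
        ∑ i, (u ⬝ᵥ x i) ^ 2 ≤ 2 * n * (u ⬝ᵥ (secondMoment (p t) *ᵥ u))}
  have hC : ∀ t, (Measure.pi fun _ : Fin n => p t) (C t)ᶜ ≤ ENNReal.ofReal δ := fun t =>
    (hp t).measure_not_forall_le hd (LinearMap.id : (Fin d → ℝ) →ₗ[ℝ] _) hd (by simp) hδ hδ1 hn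
  have hsub : sourceSample Bs Ws σ ⁻¹' {D : SourceData d T n | SourceCovGood p D}ᶜ ⊆
      (⋃ t, Function.eval t ⁻¹' (C t)ᶜ) ×ˢ Set.univ := by
    intro a ha
    simp only [Set.mem_prod, Set.mem_iUnion, Set.mem_preimage, Set.mem_univ, and_true]
    by_contra hcon
    push Not at hcon
    exact ha fun t θ => not_not.1 (hcon t) θ
  refine (measure_mono hsub).trans ?_
  rw [Measure.prod_prod, measure_univ, mul_one]
  refine (measure_iUnion_fintype_le _ _).trans ?_
  have hCm : ∀ t, MeasurableSet (C t)ᶜ := fun t =>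
    (isClosed_forall_sum_sq (fun u : Fin d → ℝ => u) _ _).measurableSet.compl
  calc _ ≤ ∑ _t : Fin T, ENNReal.ofReal δ := by
        refine Finset.sum_le_sum fun t _ => ?_
        rw [(measurePreserving_eval (fun t => Measure.pi fun _ : Fin n => p t)
          t).measure_preimage (hCm t).nullMeasurableSet]
        exact hC t
    _ = _ := by simp

/-- Conditionally on the inputs each grid matrix `V` gives the linear family `R ↦ V * R` of
dimension `2kT`; the union bound runs over the `(g + 1) ^ (2kd)` grid matrices. -/
theorem sourceLaw_sourceGridGood_compl_le {p : Fin T → Measure (Fin d → ℝ)}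
    [∀ t, IsProbabilityMeasure (p t)] (Bs : Matrix (Fin d) (Fin k) ℝ)
    (Ws : Matrix (Fin k) (Fin T) ℝ) (σ : ℝ≥0) (g : ℕ) (L : ℝ) :
    sourceLaw n p Bs Ws σ
      {D | SourceGridGood Bs Ws g ((σ : ℝ) ^ 2 * (4 * ((2 * k * T : ℕ) + L))) D}ᶜ ≤
      ((g + 1) ^ (2 * k * d) : ℕ) * ENNReal.ofReal (Real.exp (-L)) := by
  have hmeas := (isClosed_sourceGridGood (n := n) Bs Ws g
    ((σ : ℝ) ^ 2 * (4 * ((2 * k * T : ℕ) + L)))).measurableSet.compl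
  rw [sourceLaw_eq_map, Measure.map_apply (measurable_sourceSample _ _ _) hmeas]
  refine prod_le_of_forall_preimage_le _ _ (measurable_sourceSample _ _ _ hmeas) fun X => ?_
  let A : (Fin d → Fin (2 * k) → Fin (g + 1)) →
      Matrix (Fin (2 * k)) (Fin T) ℝ →ₗ[ℝ] Fin T × Fin n → ℝ := fun a =>
    { toFun := fun R s => (gridMatrix g a * R)ᵀ s.1 ⬝ᵥ X s.1 s.2
      map_add' := fun R R' => by
        ext s
        rw [Matrix.mul_add]
        exact add_dotProduct _ _ _
      map_smul' := fun c R => by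
        ext s
        rw [Matrix.mul_smul]
        exact smul_dotProduct c ((gridMatrix g a * R)ᵀ s.1) (X s.1 s.2) }
  have hsub : Prod.mk X ⁻¹' (sourceSample Bs Ws σ ⁻¹'
      {D : SourceData d T n | SourceGridGood Bs Ws g
        ((σ : ℝ) ^ 2 * (4 * ((2 * k * T : ℕ) + L))) D}ᶜ) ⊆
      ⋃ a, {G : Fin T → Fin n → ℝ | ∃ R, (σ : ℝ) ^ 2 * (4 * ((2 * k * T : ℕ) + L)) <
        2 * ∑ s : Fin T × Fin n, (σ * G s.1 s.2) * A a R s - ∑ s, A a R s ^ 2} := by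
    intro G hG
    by_contra hcon
    simp only [Set.mem_iUnion, Set.mem_ofPred_eq, not_exists, not_lt] at hcon
    refine hG fun a R => ?_
    have h := hcon a R
    simp only [Fintype.sum_prod_type] at h
    simp only [sourceNoise_sourceSample]
    exact h
  refine (measure_mono hsub).trans ((measure_iUnion_fintype_le _ _).trans ?_)
  have hz : Measurable fun (G : Fin T → Fin n → ℝ) (s : Fin T × Fin n) => G s.1 s.2 :=
    measurable_pi_lambda _ fun s => by fun_prop
  calc _ ≤ ∑ _a : Fin d → Fin (2 * k) → Fin (g + 1), ENNReal.ofReal (Real.exp (-L)) := by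
        refine Finset.sum_le_sum fun a _ => ?_
        exact isSubStdGaussian_pi_pi.measure_exists_lt_le hz (A a)
          (by rw [Module.finrank_matrix]; simp) L σ
    _ = _ := by
        rw [Finset.sum_const, nsmul_eq_mul]
        congr 2
        simp only [Finset.card_univ, Fintype.card_fun, Fintype.card_fin]
        rw [← pow_mul]

theorem sourceLaw_sourceNoiseGood_compl_le {p : Fin T → Measure (Fin d → ℝ)}
    [∀ t, IsProbabilityMeasure (p t)] (Bs : Matrix (Fin d) (Fin k) ℝ)
    (Ws : Matrix (Fin k) (Fin T) ℝ) (σ : ℝ≥0) (L : ℝ) :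
    sourceLaw n p Bs Ws σ
      {D | SourceNoiseGood Bs Ws ((σ : ℝ) ^ 2 * (4 * ((T * n : ℕ) + L))) D}ᶜ ≤
      ENNReal.ofReal (Real.exp (-L)) := by
  have hmeas := (isClosed_sourceNoiseGood (n := n) Bs Ws
    ((σ : ℝ) ^ 2 * (4 * ((T * n : ℕ) + L)))).measurableSet.compl
  rw [sourceLaw_eq_map, Measure.map_apply (measurable_sourceSample _ _ _) hmeas]
  refine prod_le_of_forall_preimage_le _ _ (measurable_sourceSample _ _ _ hmeas) fun X => ?_
  have hz : Measurable fun (G : Fin T → Fin n → ℝ) (s : Fin T × Fin n) => G s.1 s.2 :=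
    measurable_pi_lambda _ fun s => by fun_prop
  refine (measure_mono ?_).trans (isSubStdGaussian_pi_pi.measure_sq_gt_le hz
    (r := T * n) (by simp) L)
  intro G hG
  by_contra hcon
  simp only [Set.mem_ofPred_eq, not_lt, Fintype.sum_prod_type] at hcon
  refine hG ?_
  simp only [Set.mem_ofPred_eq, SourceNoiseGood, sourceNoise_sourceSample, mul_pow,
    ← Finset.mul_sum]
  exact mul_le_mul_of_nonneg_left hcon (sq_nonneg _)

end SourceProbability

/-- With `g = ⌈4 y²⌉` the grid of `g + 1` points has at most `y ^ 4` points. -/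
theorem log_ceil_add_one_le {y : ℝ} (hy : 3 ≤ y) :
    Real.log ((⌈4 * y ^ 2⌉₊ + 1 : ℕ) : ℝ) ≤ 4 * Real.log y := by
  have h1 : ((⌈4 * y ^ 2⌉₊ + 1 : ℕ) : ℝ) ≤ y ^ 4 := by
    have := (Nat.ceil_lt_add_one (show 0 ≤ 4 * y ^ 2 by positivity)).le
    push_cast
    nlinarith [mul_self_nonneg (y ^ 2 - 9), sq_nonneg (y - 3)]
  calc Real.log ((⌈4 * y ^ 2⌉₊ + 1 : ℕ) : ℝ) ≤ Real.log (y ^ 4) :=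
        Real.log_le_log (by positivity) h1
    _ = _ := by rw [Real.log_pow]; norm_num

theorem log_eight_div {δ : ℝ} (hδ : 0 < δ) : Real.log (8 / δ) ≤ 2.1 + Real.log (1 / δ) := by
  have h8 : Real.log 8 ≤ 2.1 := by
    have : (8 : ℝ) = 2 ^ 3 := by norm_num
    rw [this, Real.log_pow]
    have := Real.log_two_lt_d9
    norm_num
    linarith
  rw [Real.log_div (by norm_num) hδ.ne', one_div, Real.log_inv]
  linarith

/-- The source stage: with probability at least `1 - δ / 2` the source objective has a minimizer,
and the total prediction error of every minimizer, measured in the target covariance, is small. -/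
theorem sourceLaw_prediction_error_le {d k T n : ℕ} {δ c : ℝ} {ρ σ : ℝ≥0}
    {p : Fin T → Measure (Fin d → ℝ)} {p₀ : Measure (Fin d → ℝ)}
    (Bs : Matrix (Fin d) (Fin k) ℝ) (Ws : Matrix (Fin k) (Fin T) ℝ)
    (hδ : 0 < δ) (hδ1 : δ < 1) (hk : 1 ≤ k) (hkd : 2 * k ≤ min d T)
    (hp : ∀ t, IsSubgaussianInput ρ (p t)) (hp0 : ∀ t, (secondMoment (p t)).PosDef)
    (hdom : ∀ t, (secondMoment (p t) - c • secondMoment p₀).PosSemidef)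
    (hn : 4000000 * ((ρ : ℝ) ^ 4 * (d + Real.log (T / δ))) ≤ n) :
    sourceLaw n p Bs Ws σ {D | ¬ ((∃ (B : Matrix (Fin d) (Fin k) ℝ) (W : Matrix (Fin k) (Fin T) ℝ),
        IsSourceMinimizer D B W) ∧
      ∀ (B : Matrix (Fin d) (Fin k) ℝ) (W : Matrix (Fin k) (Fin T) ℝ), IsSourceMinimizer D B W →
        c * n * ∑ t, (B * W - Bs * Ws)ᵀ t ⬝ᵥ (secondMoment p₀ *ᵥ (B * W - Bs * Ws)ᵀ t) ≤
          1024 * ((σ : ℝ) ^ 2 *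
            (k * T + k * d * Real.log (kappa p * n) + Real.log (1 / δ))))} ≤
      ENNReal.ofReal (δ / 2) := by
  have hkd' : 2 * k ≤ d := hkd.trans (min_le_left _ _)
  have hkT : 2 * k ≤ T := hkd.trans (min_le_right _ _)
  have hd : 0 < d := by omega
  have hT : 0 < T := by omega
  have hTr : (2 : ℝ) ≤ T := by exact_mod_cast (by omega : 2 ≤ T)
  have hdr : (2 : ℝ) ≤ d := by exact_mod_cast (by omega : 2 ≤ d)
  have hkr : (1 : ℝ) ≤ k := by exact_mod_cast hk
  have hkdr : 2 * (k : ℝ) ≤ d := by exact_mod_cast hkd'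
  have hprob : ∀ t, IsProbabilityMeasure (p t) := fun t => (hp t).isProbabilityMeasure
  obtain ⟨a, b, hb, hba, hκ, hab⟩ := exists_kappa_bounds hd hT p hp0
  have hρ2 := (hp ⟨0, hT⟩).half_le hd
  have hρ4 : (1 / 4 : ℝ) ≤ (ρ : ℝ) ^ 4 := by nlinarith
  have hlogT : 0 ≤ Real.log (T / δ) :=
    Real.log_nonneg (by rw [le_div_iff₀ hδ]; linarith)
  have hdn : 1000000 * (d : ℝ) ≤ n := by
    refine le_trans ?_ hn
    nlinarith [mul_nonneg (sub_nonneg.2 hρ4) (by positivity : (0 : ℝ) ≤ d + Real.log (T / δ))]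
  have hn3 : 3 ≤ n := by
    have : (3 : ℝ) ≤ n := by linarith
    exact_mod_cast this
  have hn0 : 0 < n := by omega
  have hnr : (3 : ℝ) ≤ n := by exact_mod_cast hn3
  have hκ1 : 1 ≤ kappa p := by rw [hκ, le_div_iff₀ hb]; linarith
  set y : ℝ := kappa p * n with hy
  have hyn : (n : ℝ) ≤ y := by rw [hy]; nlinarith
  have hy3 : 3 ≤ y := hnr.trans hyn
  have hlogy : 0 ≤ Real.log y := Real.log_nonneg (by linarith)
  have hl : 0 ≤ Real.log (1 / δ) := Real.log_nonneg (by rw [le_div_iff₀ hδ]; linarith)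
  -- a grid fine enough for the rounding error, with `log g` still of order `log y`
  set g : ℕ := ⌈4 * y ^ 2⌉₊ with hg
  have hgy : 4 * y ^ 2 ≤ g := Nat.le_ceil _
  have hg0 : 0 < g := by
    rw [hg, Nat.ceil_pos]
    positivity
  have hgrid : 16 * (a / b) * (d * (2 * k : ℕ)) * n ≤ (g : ℝ) ^ 2 := by
    rw [← hκ]
    have h1 : (d : ℝ) * (2 * k) ≤ n * n := by
      have : (d : ℝ) ≤ n := by linarith
      have : 2 * (k : ℝ) ≤ n := by linarith
      gcongr
    have h2 : (n : ℝ) * n ≤ y * y := by gcongr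
    have h3 : 1 ≤ y := by linarith
    push_cast
    calc 16 * kappa p * (d * (2 * k)) * n = 16 * y * (d * (2 * k)) := by rw [hy]; ring
      _ ≤ 16 * y * (y * y) :=
          mul_le_mul_of_nonneg_left (h1.trans h2) (by positivity)
      _ ≤ 16 * y * (y * y) * y := le_mul_of_one_le_right (by positivity) h3
      _ = (4 * y ^ 2) ^ 2 := by ring
      _ ≤ (g : ℝ) ^ 2 := by gcongr
  set N : ℕ := (g + 1) ^ (2 * k * d) with hN
  have hNpos : 0 < (N : ℝ) := by
    rw [hN]
    positivity
  set L₁ : ℝ := Real.log N + Real.log (8 / δ) with hL₁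
  set L₂ : ℝ := Real.log (8 / δ) with hL₂
  set τ₁ : ℝ := (σ : ℝ) ^ 2 * (4 * ((2 * k * T : ℕ) + L₁)) with hτ₁
  set τ₂ : ℝ := (σ : ℝ) ^ 2 * (4 * ((T * n : ℕ) + L₂)) with hτ₂
  have hL₂le := log_eight_div hδ
  have hlogN : Real.log N ≤ 8 * (k * d * Real.log y) := by
    rw [hN, Nat.cast_pow, Real.log_pow]
    have := log_ceil_add_one_le hy3
    push_cast at this ⊢
    calc 2 * (k : ℝ) * d * Real.log (g + 1) ≤ 2 * k * d * (4 * Real.log y) := by gcongr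
      _ = _ := by ring
  have hτ : 2 * (16 * (τ₁ + τ₂ / n)) ≤
      1024 * ((σ : ℝ) ^ 2 * (k * T + k * d * Real.log y + Real.log (1 / δ))) := by
    have hL0 : 0 ≤ L₂ := Real.log_nonneg (by rw [le_div_iff₀ hδ]; linarith)
    have h1 : τ₂ / n ≤ (σ : ℝ) ^ 2 * (4 * (T + L₂)) := by
      rw [div_le_iff₀ (by positivity), hτ₂]
      push_cast
      have : L₂ ≤ L₂ * n := le_mul_of_one_le_right hL0 (by linarith)
      calc (σ : ℝ) ^ 2 * (4 * (T * n + L₂)) ≤ (σ : ℝ) ^ 2 * (4 * (T * n + L₂ * n)) := by gcongr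
        _ = _ := by ring
    have h2 : (1 : ℝ) * T ≤ k * T := by gcongr
    calc 2 * (16 * (τ₁ + τ₂ / n)) ≤ 2 * (16 * (τ₁ + (σ : ℝ) ^ 2 * (4 * (T + L₂)))) := by gcongr
      _ = (σ : ℝ) ^ 2 * (128 * (2 * (k * T) + Real.log N + 2 * L₂ + T)) := by
          rw [hτ₁, hL₁]
          push_cast
          ring
      _ ≤ (σ : ℝ) ^ 2 * (128 * (8 * (k * T + k * d * Real.log y + Real.log (1 / δ)))) := by
          gcongr
          linarith
      _ = _ := by ring
  have hsub : {D : SourceData d T n | ¬ ((∃ (B : Matrix (Fin d) (Fin k) ℝ)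
        (W : Matrix (Fin k) (Fin T) ℝ), IsSourceMinimizer D B W) ∧
      ∀ (B : Matrix (Fin d) (Fin k) ℝ) (W : Matrix (Fin k) (Fin T) ℝ), IsSourceMinimizer D B W →
        c * n * ∑ t, (B * W - Bs * Ws)ᵀ t ⬝ᵥ (secondMoment p₀ *ᵥ (B * W - Bs * Ws)ᵀ t) ≤
          1024 * ((σ : ℝ) ^ 2 * (k * T + k * d * Real.log y + Real.log (1 / δ))))} ⊆
      {D | SourceCovGood p D}ᶜ ∪
        ({D | SourceGridGood Bs Ws g τ₁ D}ᶜ ∪ {D | SourceNoiseGood Bs Ws τ₂ D}ᶜ) := by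
    intro D hD
    by_contra hcon
    simp only [Set.mem_union, Set.mem_compl_iff, Set.mem_ofPred_eq, not_or, not_not] at hcon
    obtain ⟨h1, h2, h3⟩ := hcon
    refine hD ⟨h1.exists_isSourceMinimizer hn0 hb fun t v => (hab t v).1, fun B W hBW => ?_⟩
    have h4 := hBW.sum_sq_error_le hn3 hT h1 hb (hb.le.trans hba) hab hg0 hgrid h2 h3
    refine le_trans ?_ hτ
    refine le_trans ?_ (mul_le_mul_of_nonneg_left h4 zero_le_two)
    rw [Finset.mul_sum, Finset.mul_sum]
    refine Finset.sum_le_sum fun t _ => ?_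
    -- covariance dominance passes from the covariance of task `t` to that of the target task
    have h5 := (h1 t ((B * W - Bs * Ws)ᵀ t)).1
    have h6 := (hdom t).dotProduct_mulVec_nonneg ((B * W - Bs * Ws)ᵀ t)
    simp only [star_trivial, sub_mulVec, smul_mulVec, dotProduct_sub, dotProduct_smul,
      smul_eq_mul] at h6
    nlinarith [mul_nonneg (Nat.cast_nonneg (α := ℝ) n) h6]
  refine (measure_mono hsub).trans ((measure_union_le _ _).trans
    ((add_le_add le_rfl (measure_union_le _ _)).trans ?_))
  have e1 : sourceLaw n p Bs Ws σ {D | SourceCovGood p D}ᶜ ≤ ENNReal.ofReal (δ / 4) := by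
    have hδ' : 0 < δ / (4 * T) := by positivity
    have hlog4 : Real.log 4 ≤ 1.4 := by
      have : (4 : ℝ) = 2 ^ 2 := by norm_num
      rw [this, Real.log_pow]
      have := Real.log_two_lt_d9
      norm_num
      linarith
    refine (sourceLaw_sourceCovGood_compl_le hp hd Bs Ws σ hδ' ?_ ?_).trans ?_
    · rw [div_le_one (by positivity)]
      linarith
    · refine le_trans ?_ hn
      have : Real.log (1 / (δ / (4 * T))) = Real.log 4 + Real.log (T / δ) := by
        rw [← Real.log_mul (by norm_num) (by positivity)]
        congr 1
        field_simp
      rw [this]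
      have h4 : 0 ≤ (ρ : ℝ) ^ 4 := by positivity
      have h5 : (ρ : ℝ) ^ 4 * (d + (Real.log 4 + Real.log (T / δ))) ≤
          (ρ : ℝ) ^ 4 * (4 * (d + Real.log (T / δ))) := by
        gcongr
        linarith
      linarith
    · rw [← ENNReal.ofReal_natCast, ← ENNReal.ofReal_mul (by positivity)]
      apply ENNReal.ofReal_le_ofReal
      apply le_of_eq
      field_simp
  have e2 : sourceLaw n p Bs Ws σ {D | SourceGridGood Bs Ws g τ₁ D}ᶜ ≤
      ENNReal.ofReal (δ / 8) := by
    refine (sourceLaw_sourceGridGood_compl_le Bs Ws σ g L₁).trans ?_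
    rw [← ENNReal.ofReal_natCast, ← ENNReal.ofReal_mul (by positivity)]
    apply ENNReal.ofReal_le_ofReal
    rw [hL₁, neg_add, Real.exp_add, Real.exp_neg, Real.exp_log hNpos, ← Real.log_inv,
      Real.exp_log (by positivity)]
    rw [← hN]
    apply le_of_eq
    field_simp
  have e3 : sourceLaw n p Bs Ws σ {D | SourceNoiseGood Bs Ws τ₂ D}ᶜ ≤
      ENNReal.ofReal (δ / 8) := by
    refine (sourceLaw_sourceNoiseGood_compl_le Bs Ws σ L₂).trans ?_
    apply ENNReal.ofReal_le_ofReal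
    rw [hL₂, ← Real.log_inv, Real.exp_log (by positivity)]
    apply le_of_eq
    field_simp
  refine (add_le_add e1 (add_le_add e2 e3)).trans (le_of_eq ?_)
  rw [← ENNReal.ofReal_add (by positivity) (by positivity),
    ← ENNReal.ofReal_add (by positivity) (by positivity)]
  congr 1
  ring

/-! ### The target stage -/

theorem RepLearn.IsSubgaussianInput.exists_sqrt {d : ℕ} {p : Measure (Fin d → ℝ)} {ρ : ℝ≥0}
    (h : IsSubgaussianInput ρ p) : ∃ S : Matrix (Fin d) (Fin d) ℝ, ∀ v : Fin d → ℝ,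
      v ⬝ᵥ (secondMoment p *ᵥ v) = ∑ i, (S *ᵥ v) i ^ 2 := by
  obtain ⟨q, hq, hw, -⟩ := h
  obtain ⟨S, hS, hSS, -⟩ := hw.map_sqrt
  have hST : Sᵀ = S := by simpa using hS.isHermitian.eq
  refine ⟨S, fun v => ?_⟩
  rw [← hSS, ← mulVec_mulVec, dotProduct_mulVec, ← mulVec_transpose, hST,
    dotProduct_self_eq_sum_sq]

section ExcessRisk

variable {d k : ℕ} {p : Measure (Fin d → ℝ)} [IsProbabilityMeasure p]

theorem popLoss_taskLaw (hp : ∀ i, MemLp (fun x : Fin d → ℝ => x i) 2 p) (σ : ℝ≥0)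
    (Bs B : Matrix (Fin d) (Fin k) ℝ) (ws w : Fin k → ℝ) :
    popLoss (taskLaw p Bs ws σ) B w = 1 / 2 * ((Bs *ᵥ ws - B *ᵥ w) ⬝ᵥ
      (secondMoment p *ᵥ (Bs *ᵥ ws - B *ᵥ w))) + 1 / 2 * (σ : ℝ) ^ 2 := by
  set θ := Bs *ᵥ ws - B *ᵥ w
  have hL : MemLp (fun x : Fin d → ℝ => θ ⬝ᵥ x) 2 p :=
    memLp_finsetSum (s := Finset.univ) fun i _ => (hp i).const_mul (θ i)
  have hz : MemLp (fun z : ℝ => z) 2 (gaussianReal 0 (σ ^ 2)) := memLp_id_gaussianReal 2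
  have hz1 : ∫ z, z ∂gaussianReal 0 (σ ^ 2) = 0 := integral_id_gaussianReal
  have hz2 : ∫ z, z ^ 2 ∂gaussianReal 0 (σ ^ 2) = (σ : ℝ) ^ 2 := by
    have h := variance_fun_id_gaussianReal (μ := 0) (v := σ ^ 2)
    rw [variance_eq_integral (by fun_prop), hz1] at h
    simpa using h
  have i1 : Integrable (fun x : Fin d → ℝ => (θ ⬝ᵥ x) ^ 2) p := hL.integrable_sq
  have i2 : Integrable (fun x : Fin d → ℝ => θ ⬝ᵥ x) p := hL.integrable (by norm_num)
  have i3 : Integrable (fun z : ℝ => z) (gaussianReal 0 (σ ^ 2)) := hz.integrable (by norm_num)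
  have i4 : Integrable (fun z : ℝ => z ^ 2) (gaussianReal 0 (σ ^ 2)) := hz.integrable_sq
  unfold popLoss taskLaw
  rw [integral_map (by fun_prop) (by apply Measurable.aestronglyMeasurable; fun_prop)]
  have e : ∀ a : (Fin d → ℝ) × ℝ, (1 / 2 : ℝ) * (predict Bs ws a.1 + a.2 - predict B w a.1) ^ 2 =
      1 / 2 * (θ ⬝ᵥ a.1) ^ 2 + (θ ⬝ᵥ a.1) * a.2 + 1 / 2 * a.2 ^ 2 := by
    intro a
    rw [predict_eq_dotProduct, predict_eq_dotProduct, sub_dotProduct]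
    ring
  simp only [e]
  have j1 : Integrable (fun a : (Fin d → ℝ) × ℝ => 1 / 2 * (θ ⬝ᵥ a.1) ^ 2)
      (p.prod (gaussianReal 0 (σ ^ 2))) := (i1.comp_fst _).const_mul _
  have j2 : Integrable (fun a : (Fin d → ℝ) × ℝ => (θ ⬝ᵥ a.1) * a.2)
      (p.prod (gaussianReal 0 (σ ^ 2))) := i2.mul_prod i3
  have j3 : Integrable (fun a : (Fin d → ℝ) × ℝ => 1 / 2 * a.2 ^ 2)
      (p.prod (gaussianReal 0 (σ ^ 2))) := (i4.comp_snd _).const_mul _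
  have j12 : Integrable (fun a : (Fin d → ℝ) × ℝ => 1 / 2 * (θ ⬝ᵥ a.1) ^ 2 + (θ ⬝ᵥ a.1) * a.2)
      (p.prod (gaussianReal 0 (σ ^ 2))) := j1.add j2
  rw [integral_add j12 j3, integral_add j1 j2, integral_const_mul, integral_const_mul,
    integral_prod_mul (fun x : Fin d → ℝ => θ ⬝ᵥ x) (fun z : ℝ => z), hz1, mul_zero, add_zero,
    integral_fun_fst (fun x : Fin d → ℝ => (θ ⬝ᵥ x) ^ 2), integral_fun_snd (fun z : ℝ => z ^ 2),
    hz2, integral_dotProduct_sq hp]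
  simp

/-- The excess risk is half the squared norm of the predictor error in the input covariance. -/
theorem excessRisk_eq (hp : ∀ i, MemLp (fun x : Fin d → ℝ => x i) 2 p) (σ : ℝ≥0)
    (Bs B : Matrix (Fin d) (Fin k) ℝ) (ws w : Fin k → ℝ) :
    excessRisk p σ Bs ws B w = 1 / 2 * ((Bs *ᵥ ws - B *ᵥ w) ⬝ᵥ
      (secondMoment p *ᵥ (Bs *ᵥ ws - B *ᵥ w))) := by
  rw [excessRisk, popLoss_taskLaw hp, popLoss_taskLaw hp]
  simp

end ExcessRisk

section Target

variable {d k n : ℕ}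

/-- The favourable event of the target stage for the representation `B`: the empirical covariance
of the target inputs is comparable with the population one on the span of the columns of `B` and
`Bs`, and the noise explains at most `τ` on the columns of `B`. -/
def TargetGood (p : Measure (Fin d → ℝ)) (Bs : Matrix (Fin d) (Fin k) ℝ) (τ : ℝ)
    (B : Matrix (Fin d) (Fin k) ℝ) (ω : Fin n → (Fin d → ℝ) × ℝ) : Prop :=
  (∀ u : (Fin k → ℝ) × (Fin k → ℝ),
    n / 2 * ((Bs *ᵥ u.1 - B *ᵥ u.2) ⬝ᵥ (secondMoment p *ᵥ (Bs *ᵥ u.1 - B *ᵥ u.2))) ≤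
      ∑ i, ((Bs *ᵥ u.1 - B *ᵥ u.2) ⬝ᵥ (ω i).1) ^ 2 ∧
    ∑ i, ((Bs *ᵥ u.1 - B *ᵥ u.2) ⬝ᵥ (ω i).1) ^ 2 ≤
      2 * n * ((Bs *ᵥ u.1 - B *ᵥ u.2) ⬝ᵥ (secondMoment p *ᵥ (Bs *ᵥ u.1 - B *ᵥ u.2)))) ∧
  ∀ u : Fin k → ℝ, 2 * ∑ i, (ω i).2 * ((B *ᵥ u) ⬝ᵥ (ω i).1) - ∑ i, ((B *ᵥ u) ⬝ᵥ (ω i).1) ^ 2 ≤ τ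

/-- Joint closedness in the representation and the target data, hence joint measurability. -/
theorem isClosed_targetGood (p : Measure (Fin d → ℝ)) (Bs : Matrix (Fin d) (Fin k) ℝ) (τ : ℝ) :
    IsClosed {q : (Fin d → Fin k → ℝ) × (Fin n → (Fin d → ℝ) × ℝ) |
      TargetGood p Bs τ (Matrix.of q.1) q.2} := by
  have c1 : ∀ u : (Fin k → ℝ) × (Fin k → ℝ), Continuous
      fun q : (Fin d → Fin k → ℝ) × (Fin n → (Fin d → ℝ) × ℝ) =>
        ∑ i, ((Bs *ᵥ u.1 - Matrix.of q.1 *ᵥ u.2) ⬝ᵥ (q.2 i).1) ^ 2 := by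
    intro u
    simp only [dotProduct, Pi.sub_apply, mulVec, Matrix.of_apply]
    fun_prop
  have c2 : ∀ u : (Fin k → ℝ) × (Fin k → ℝ), Continuous
      fun q : (Fin d → Fin k → ℝ) × (Fin n → (Fin d → ℝ) × ℝ) =>
        (Bs *ᵥ u.1 - Matrix.of q.1 *ᵥ u.2) ⬝ᵥ
          (secondMoment p *ᵥ (Bs *ᵥ u.1 - Matrix.of q.1 *ᵥ u.2)) := by
    intro u
    simp only [dotProduct, Pi.sub_apply, mulVec, Matrix.of_apply]
    fun_prop
  have c3 : ∀ u : Fin k → ℝ, Continuous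
      fun q : (Fin d → Fin k → ℝ) × (Fin n → (Fin d → ℝ) × ℝ) =>
        2 * ∑ i, (q.2 i).2 * ((Matrix.of q.1 *ᵥ u) ⬝ᵥ (q.2 i).1) -
          ∑ i, ((Matrix.of q.1 *ᵥ u) ⬝ᵥ (q.2 i).1) ^ 2 := by
    intro u
    simp only [dotProduct, mulVec, Matrix.of_apply]
    fun_prop
  refine IsClosed.inter ?_ ?_
  · change IsClosed {q : (Fin d → Fin k → ℝ) × (Fin n → (Fin d → ℝ) × ℝ) |
      ∀ u : (Fin k → ℝ) × (Fin k → ℝ), _}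
    simp only [Set.ofPred_forall]
    exact isClosed_iInter fun u => (isClosed_le ((c2 u).const_mul _) (c1 u)).inter
      (isClosed_le (c1 u) ((c2 u).const_mul _))
  · change IsClosed {q : (Fin d → Fin k → ℝ) × (Fin n → (Fin d → ℝ) × ℝ) | ∀ u : Fin k → ℝ, _}
    simp only [Set.ofPred_forall]
    exact isClosed_iInter fun u => isClosed_le (c3 u) continuous_const

/-- For a fixed representation the covariance has to be controlled in dimension `2k` only, and the
noise in dimension `k`. -/
theorem targetNoiseLaw_targetGood_compl_le {p : Measure (Fin d → ℝ)} {ρ : ℝ≥0}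
    (hp : IsSubgaussianInput ρ p) (hd : 0 < d) (hk : 1 ≤ k) (Bs B : Matrix (Fin d) (Fin k) ℝ)
    (σ : ℝ≥0) {δ : ℝ} (hδ : 0 < δ) (hδ1 : δ ≤ 1)
    (hn : 1000000 * ((ρ : ℝ) ^ 4 * ((2 * k : ℕ) + Real.log (1 / δ))) ≤ n) :
    targetNoiseLaw n p σ
      {ω | TargetGood p Bs ((σ : ℝ) ^ 2 * (4 * (k + Real.log (1 / δ)))) B ω}ᶜ ≤
      ENNReal.ofReal (2 * δ) := by
  have hprob := hp.isProbabilityMeasure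
  set τ := (σ : ℝ) ^ 2 * (4 * (k + Real.log (1 / δ)))
  have hmeas : MeasurableSet {ω : Fin n → (Fin d → ℝ) × ℝ | TargetGood p Bs τ B ω}ᶜ :=
    ((isClosed_targetGood p Bs τ).preimage
      (f := fun ω : Fin n → (Fin d → ℝ) × ℝ => ((B : Fin d → Fin k → ℝ), ω))
      (by fun_prop)).measurableSet.compl
  have hphi : Measurable fun (a : (Fin n → Fin d → ℝ) × (Fin n → ℝ)) (i : Fin n) =>
      (a.1 i, (σ : ℝ) * a.2 i) := by fun_prop
  unfold targetNoiseLaw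
  rw [pi_prod_gaussian_eq_map (fun _ : Fin n => p), Measure.map_apply hphi hmeas]
  let M : (Fin k → ℝ) × (Fin k → ℝ) →ₗ[ℝ] Fin d → ℝ :=
    (Matrix.mulVecLin Bs) ∘ₗ LinearMap.fst ℝ _ _ - (Matrix.mulVecLin B) ∘ₗ LinearMap.snd ℝ _ _
  let C : Set (Fin n → Fin d → ℝ) :=
    {x | ∀ u, n / 2 * (M u ⬝ᵥ (secondMoment p *ᵥ M u)) ≤ ∑ i, (M u ⬝ᵥ x i) ^ 2 ∧
        ∑ i, (M u ⬝ᵥ x i) ^ 2 ≤ 2 * n * (M u ⬝ᵥ (secondMoment p *ᵥ M u))}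
  have hC : (Measure.pi fun _ : Fin n => p) Cᶜ ≤ ENNReal.ofReal δ :=
    hp.measure_not_forall_le hd M (m := 2 * k) (by omega) (by simp; omega) hδ hδ1 hn
  let G : Set ((Fin n → Fin d → ℝ) × (Fin n → ℝ)) :=
    {a | ∀ u : Fin k → ℝ, 2 * ∑ i, ((σ : ℝ) * a.2 i) * ((B *ᵥ u) ⬝ᵥ a.1 i) -
      ∑ i, ((B *ᵥ u) ⬝ᵥ a.1 i) ^ 2 ≤ τ}
  have hGm : MeasurableSet Gᶜ := by
    have : IsClosed G := by
      simp only [G, Set.ofPred_forall]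
      refine isClosed_iInter fun u => isClosed_le ?_ continuous_const
      simp only [dotProduct]
      fun_prop
    exact this.measurableSet.compl
  have hG : ((Measure.pi fun _ : Fin n => p).prod (Measure.pi fun _ : Fin n => gaussianReal 0 1))
      Gᶜ ≤ ENNReal.ofReal δ := by
    refine prod_le_of_forall_preimage_le _ _ hGm fun X => ?_
    let A : (Fin k → ℝ) →ₗ[ℝ] Fin n → ℝ :=
      { toFun := fun u i => (B *ᵥ u) ⬝ᵥ X i
        map_add' := fun u v => by
          ext i
          rw [mulVec_add, add_dotProduct]
          rfl
        map_smul' := fun c u => by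
          ext i
          rw [mulVec_smul, smul_dotProduct]
          rfl }
    have h := isSubStdGaussian_pi.measure_exists_lt_le measurable_id A (r := k) (by simp)
      (Real.log (1 / δ)) σ
    rw [← Real.log_inv, one_div, inv_inv, Real.exp_log hδ] at h
    refine (measure_mono ?_).trans h
    intro g hg
    by_contra hcon
    simp only [Set.mem_ofPred_eq, not_exists, not_lt] at hcon
    refine hg fun u => ?_
    have := hcon u
    simp only [τ, one_div]
    exact this
  have hsub : (fun (a : (Fin n → Fin d → ℝ) × (Fin n → ℝ)) (i : Fin n) =>
      (a.1 i, (σ : ℝ) * a.2 i)) ⁻¹' {ω | TargetGood p Bs τ B ω}ᶜ ⊆ Cᶜ ×ˢ Set.univ ∪ Gᶜ := by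
    intro a ha
    by_contra hcon
    simp only [Set.mem_union, Set.mem_prod, Set.mem_univ, and_true, Set.mem_compl_iff, not_or,
      not_not] at hcon
    exact ha ⟨hcon.1, hcon.2⟩
  refine (measure_mono hsub).trans ((measure_union_le _ _).trans ?_)
  rw [Measure.prod_prod, measure_univ, mul_one]
  refine (add_le_add hC hG).trans (le_of_eq ?_)
  rw [← ENNReal.ofReal_add hδ.le hδ.le, two_mul]

end Target

section TargetDeterministic

variable {d k n : ℕ} {p : Measure (Fin d → ℝ)} {Bs B : Matrix (Fin d) (Fin k) ℝ} {τ : ℝ}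
  {ω : Fin n → (Fin d → ℝ) × ℝ}

/-- The basic inequality of the target stage, against an arbitrary competitor `u`. -/
theorem RepLearn.IsTargetMinimizer.sum_sq_le (hn : 0 < n) {w ŵ : Fin k → ℝ}
    (h : IsTargetMinimizer (targetSample Bs w ω) B ŵ) (u : Fin k → ℝ) :
    ∑ i, ((Bs *ᵥ w - B *ᵥ ŵ) ⬝ᵥ (ω i).1 + (ω i).2) ^ 2 ≤
      ∑ i, ((Bs *ᵥ w - B *ᵥ u) ⬝ᵥ (ω i).1 + (ω i).2) ^ 2 := by
  have h1 := h u
  unfold targetObjective at h1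
  have h2 := le_of_mul_le_mul_left h1 (by positivity)
  simp only [targetSample, predict_eq_dotProduct] at h2
  refine le_of_eq_of_le ?_ (h2.trans (le_of_eq ?_)) <;>
  · refine Finset.sum_congr rfl fun i _ => ?_
    rw [sub_dotProduct]
    ring

/-- Least squares on top of `B` competes with every linear predictor `B u`. -/
theorem TargetGood.error_le (hG : TargetGood p Bs τ B ω) (hn : 0 < n) {w ŵ : Fin k → ℝ}
    (h : IsTargetMinimizer (targetSample Bs w ω) B ŵ) (u : Fin k → ℝ) :
    (Bs *ᵥ w - B *ᵥ ŵ) ⬝ᵥ (secondMoment p *ᵥ (Bs *ᵥ w - B *ᵥ ŵ)) ≤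
      12 * ((Bs *ᵥ w - B *ᵥ u) ⬝ᵥ (secondMoment p *ᵥ (Bs *ᵥ w - B *ᵥ u))) + 16 * τ / n := by
  have hn' : (0 : ℝ) < n := by exact_mod_cast hn
  have hmin := h.sum_sq_le hn u
  set a : Fin n → ℝ := fun i => (Bs *ᵥ w - B *ᵥ ŵ) ⬝ᵥ (ω i).1
  set b : Fin n → ℝ := fun i => (Bs *ᵥ w - B *ᵥ u) ⬝ᵥ (ω i).1
  set z : Fin n → ℝ := fun i => (ω i).2
  have ha := (hG.1 (w, ŵ)).1
  have hb := (hG.1 (w, u)).2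
  have hz : 2 * ∑ i, z i * (b i - a i) ≤ 4 * τ + 1 / 4 * ∑ i, (b i - a i) ^ 2 := by
    -- scaling by `1 / 4` reduces the weight of the quadratic term
    have h1 := hG.2 ((1 / 4 : ℝ) • (ŵ - u))
    have e : ∀ i, (B *ᵥ ((1 / 4 : ℝ) • (ŵ - u))) ⬝ᵥ (ω i).1 = 1 / 4 * (b i - a i) := by
      intro i
      simp only [a, b]
      rw [mulVec_smul, smul_dotProduct, ← sub_dotProduct, mulVec_sub, smul_eq_mul]
      congr 2
      abel
    simp only [e] at h1
    have e2 : ∑ i, (ω i).2 * (1 / 4 * (b i - a i)) = 1 / 4 * ∑ i, z i * (b i - a i) := by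
      rw [Finset.mul_sum]
      exact Finset.sum_congr rfl fun i _ => by simp only [z]; ring
    have e3 : ∑ i, (1 / 4 * (b i - a i)) ^ 2 = 1 / 16 * ∑ i, (b i - a i) ^ 2 := by
      rw [Finset.mul_sum]
      exact Finset.sum_congr rfl fun i _ => by ring
    rw [e2, e3] at h1
    linarith
  have hab : ∑ i, (b i - a i) ^ 2 ≤ 2 * ∑ i, a i ^ 2 + 2 * ∑ i, b i ^ 2 := by
    rw [Finset.mul_sum, Finset.mul_sum, ← Finset.sum_add_distrib]
    exact Finset.sum_le_sum fun i _ => by nlinarith [sq_nonneg (a i + b i)]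
  have hexp : ∑ i, a i ^ 2 ≤ ∑ i, b i ^ 2 + 2 * ∑ i, z i * (b i - a i) := by
    have e : ∑ i, (b i ^ 2 + 2 * (z i * (b i - a i)) - a i ^ 2) =
        ∑ i, (b i + z i) ^ 2 - ∑ i, (a i + z i) ^ 2 := by
      rw [← Finset.sum_sub_distrib]
      exact Finset.sum_congr rfl fun i _ => by ring
    rw [Finset.sum_sub_distrib, Finset.sum_add_distrib, ← Finset.mul_sum] at e
    linarith
  change _ ≤ ∑ i, a i ^ 2 at ha
  change ∑ i, b i ^ 2 ≤ _ at hb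
  dsimp only at ha hb
  rw [← sub_le_iff_le_add', le_div_iff₀ hn']
  linarith

/-- The error of least squares on top of `B` is that of an affine function of the target
predictor, whichever minimizer is selected. The minimizers are selected without any measurability,
so that the excess risk is seen to be measurable in the target predictor from this representation:
on the favourable event two minimizers differ by a vector that does not affect the risk. -/
theorem TargetGood.exists_linear (hG : TargetGood p Bs τ B ω) (hn : 0 < n)
    {S : Matrix (Fin d) (Fin d) ℝ}
    (hS : ∀ v : Fin d → ℝ, v ⬝ᵥ (secondMoment p *ᵥ v) = ∑ i, (S *ᵥ v) i ^ 2) :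
    ∃ L : (Fin n → ℝ) →ₗ[ℝ] Fin k → ℝ, ∀ w ŵ : Fin k → ℝ,
      IsTargetMinimizer (targetSample Bs w ω) B ŵ →
      S *ᵥ (Bs *ᵥ w - B *ᵥ ŵ) =
        S *ᵥ (Bs *ᵥ w - B *ᵥ L fun i => (Bs *ᵥ w) ⬝ᵥ (ω i).1 + (ω i).2) := by
  have hn' : (0 : ℝ) < n := by exact_mod_cast hn
  let A : (Fin k → ℝ) →ₗ[ℝ] Fin n → ℝ :=
    { toFun := fun u i => (B *ᵥ u) ⬝ᵥ (ω i).1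
      map_add' := fun u v => by
        ext i
        rw [mulVec_add, add_dotProduct]
        rfl
      map_smul' := fun c u => by
        ext i
        rw [mulVec_smul, smul_dotProduct]
        rfl }
  obtain ⟨L, hL⟩ := exists_linear_least_squares A
  refine ⟨L, fun w ŵ h => ?_⟩
  set y : Fin n → ℝ := fun i => (Bs *ᵥ w) ⬝ᵥ (ω i).1 + (ω i).2
  set v := ŵ - L y
  have hmin := h.sum_sq_le hn (L y)
  have hexp : ∑ i, ((Bs *ᵥ w - B *ᵥ ŵ) ⬝ᵥ (ω i).1 + (ω i).2) ^ 2 =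
      ∑ i, ((Bs *ᵥ w - B *ᵥ L y) ⬝ᵥ (ω i).1 + (ω i).2) ^ 2 -
        2 * ∑ i, (y i - A (L y) i) * A v i + ∑ i, A v i ^ 2 := by
    rw [Finset.mul_sum, ← Finset.sum_sub_distrib, ← Finset.sum_add_distrib]
    refine Finset.sum_congr rfl fun i _ => ?_
    have e1 : A v i = (B *ᵥ ŵ) ⬝ᵥ (ω i).1 - (B *ᵥ L y) ⬝ᵥ (ω i).1 := by
      rw [map_sub]; rfl
    have e2 : A (L y) i = (B *ᵥ L y) ⬝ᵥ (ω i).1 := rfl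
    rw [e1, e2, sub_dotProduct, sub_dotProduct]
    ring
  rw [hL y v, mul_zero, sub_zero] at hexp
  have hAv : ∑ i, ((B *ᵥ v) ⬝ᵥ (ω i).1) ^ 2 ≤ 0 := by
    change ∑ i, A v i ^ 2 ≤ 0
    linarith
  have hcov := (hG.1 (0, -v)).1
  simp only [mulVec_zero, mulVec_neg, sub_neg_eq_add, zero_add] at hcov
  have hQ : ∑ i, (S *ᵥ (B *ᵥ v)) i ^ 2 ≤ 0 := by
    rw [← hS]
    by_contra hcon
    push Not at hcon
    have : 0 < n / 2 * ((B *ᵥ v) ⬝ᵥ (secondMoment p *ᵥ (B *ᵥ v))) := by positivity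
    linarith
  have hzero : S *ᵥ (B *ᵥ v) = 0 := by
    have h0 := (Finset.sum_eq_zero_iff_of_nonneg (fun i _ => sq_nonneg _)).1
      (le_antisymm hQ (Finset.sum_nonneg fun i _ => sq_nonneg _))
    ext i
    exact pow_eq_zero_iff two_ne_zero |>.1 (h0 i (Finset.mem_univ i))
  have : Bs *ᵥ w - B *ᵥ ŵ = (Bs *ᵥ w - B *ᵥ L y) - B *ᵥ v := by
    rw [mulVec_sub]; abel
  rw [this, mulVec_sub, hzero, sub_zero]

end TargetDeterministic

/-! ### Averaging over the target predictor -/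

section Average

variable {d k T : ℕ} {ν : Measure (Fin k → ℝ)}

theorem integral_dotProduct_sq_le (hν : ∀ j, MemLp (fun w : Fin k → ℝ => w j) 2 ν) {s : ℝ}
    (h : ‖Matrix.toEuclideanCLM (𝕜 := ℝ) (secondMoment ν)‖ ≤ s) (v : Fin k → ℝ) :
    ∫ w, (v ⬝ᵥ w) ^ 2 ∂ν ≤ s * ∑ j, v j ^ 2 := by
  rw [integral_dotProduct_sq hν]
  have h1 : v ⬝ᵥ (secondMoment ν *ᵥ v) = inner ℝ (WithLp.toLp 2 v)
      (Matrix.toEuclideanCLM (𝕜 := ℝ) (secondMoment ν) (WithLp.toLp 2 v)) := by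
    simp only [PiLp.inner_apply, RCLike.inner_apply, conj_trivial, dotProduct]
    exact Finset.sum_congr rfl fun i _ => mul_comm _ _
  have h2 : ∑ j, v j ^ 2 = ‖WithLp.toLp 2 v‖ ^ 2 := by
    rw [EuclideanSpace.real_norm_sq_eq]
  rw [h1, h2]
  refine (real_inner_le_norm _ _).trans ?_
  calc _ ≤ ‖WithLp.toLp 2 v‖ * (‖Matrix.toEuclideanCLM (𝕜 := ℝ) (secondMoment ν)‖ *
        ‖WithLp.toLp 2 v‖) := by
        gcongr
        exact ContinuousLinearMap.le_opNorm _ _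
    _ ≤ ‖WithLp.toLp 2 v‖ * (s * ‖WithLp.toLp 2 v‖) := by gcongr
    _ = _ := by ring

/-- Transfer from the source tasks to a random target task: the predictor `B̂ Ŵ P w` with a right
inverse `P` of `Ws` has average error controlled by the total error on the source tasks. -/
theorem integral_transfer_le (hν : ∀ j, MemLp (fun w : Fin k → ℝ => w j) 2 ν) {s q : ℝ}
    (hs : 0 ≤ s) (hq : 0 < q) (h : ‖Matrix.toEuclideanCLM (𝕜 := ℝ) (secondMoment ν)‖ ≤ s)
    {Bs B : Matrix (Fin d) (Fin k) ℝ} {Ws W : Matrix (Fin k) (Fin T) ℝ}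
    {P : Matrix (Fin T) (Fin k) ℝ} (hP : Ws * P = 1)
    (hPn : ∀ r : Fin T → ℝ, q * ∑ j, (r ᵥ* P) j ^ 2 ≤ ∑ t, r t ^ 2)
    {A S : Matrix (Fin d) (Fin d) ℝ}
    (hS : ∀ v : Fin d → ℝ, v ⬝ᵥ (A *ᵥ v) = ∑ i, (S *ᵥ v) i ^ 2) :
    Integrable (fun w => (Bs *ᵥ w - B *ᵥ ((W * P) *ᵥ w)) ⬝ᵥ
      (A *ᵥ (Bs *ᵥ w - B *ᵥ ((W * P) *ᵥ w)))) ν ∧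
    ∫ w, (Bs *ᵥ w - B *ᵥ ((W * P) *ᵥ w)) ⬝ᵥ (A *ᵥ (Bs *ᵥ w - B *ᵥ ((W * P) *ᵥ w))) ∂ν ≤
      s / q * ∑ t, (B * W - Bs * Ws)ᵀ t ⬝ᵥ (A *ᵥ (B * W - Bs * Ws)ᵀ t) := by
  let r : Fin d → Fin T → ℝ := fun i => (S * (Bs * Ws - B * W)) i
  have e : ∀ w, (Bs *ᵥ w - B *ᵥ ((W * P) *ᵥ w)) ⬝ᵥ (A *ᵥ (Bs *ᵥ w - B *ᵥ ((W * P) *ᵥ w))) =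
      ∑ i, ((r i ᵥ* P) ⬝ᵥ w) ^ 2 := by
    intro w
    rw [hS]
    refine Finset.sum_congr rfl fun i _ => ?_
    have h1 : Bs *ᵥ w - B *ᵥ ((W * P) *ᵥ w) = ((Bs * Ws - B * W) * P) *ᵥ w := by
      rw [Matrix.sub_mul, Matrix.mul_assoc, hP, Matrix.mul_one, sub_mulVec, Matrix.mul_assoc,
        mulVec_mulVec]
    rw [h1, mulVec_mulVec, ← Matrix.mul_assoc]
    rfl
  simp only [e]
  have hint : ∀ i, Integrable (fun w => ((r i ᵥ* P) ⬝ᵥ w) ^ 2) ν := fun i =>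
    integrable_mul_dotProduct_sq hν _
  refine ⟨integrable_finsetSum _ fun i _ => hint i, ?_⟩
  rw [integral_finsetSum _ fun i _ => hint i]
  have h2 : ∑ t, (B * W - Bs * Ws)ᵀ t ⬝ᵥ (A *ᵥ (B * W - Bs * Ws)ᵀ t) = ∑ i, ∑ t, r i t ^ 2 := by
    rw [Finset.sum_comm]
    refine Finset.sum_congr rfl fun t _ => ?_
    rw [hS]
    refine Finset.sum_congr rfl fun i _ => ?_
    have h3 : (S *ᵥ (B * W - Bs * Ws)ᵀ t) i = (S * (B * W - Bs * Ws)) i t := rfl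
    have h4 : r i t = -(S * (B * W - Bs * Ws)) i t := by
      simp only [r]
      rw [← neg_sub (B * W), Matrix.mul_neg]
      rfl
    rw [h3, h4, neg_sq]
  rw [h2, Finset.mul_sum]
  refine Finset.sum_le_sum fun i _ => (integral_dotProduct_sq_le hν h _).trans ?_
  rw [div_mul_eq_mul_div, le_div_iff₀ hq, mul_assoc]
  refine mul_le_mul_of_nonneg_left ?_ hs
  rw [mul_comm]
  exact hPn _

end Average

/-- The target stage on its favourable event: the average excess risk is controlled by the total
prediction error of `B W` on the source tasks. -/
theorem TargetGood.integrable_excessRisk_and_integral_le {d k T n : ℕ}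
    {p : Measure (Fin d → ℝ)} {ρ : ℝ≥0} (hp : IsSubgaussianInput ρ p) (σ : ℝ≥0)
    {ν : Measure (Fin k → ℝ)} [IsProbabilityMeasure ν]
    (hν : ∀ j, MemLp (fun w : Fin k → ℝ => w j) 2 ν) {s q τ : ℝ} (hs : 0 ≤ s) (hq : 0 < q)
    (h : ‖Matrix.toEuclideanCLM (𝕜 := ℝ) (secondMoment ν)‖ ≤ s)
    {Bs B : Matrix (Fin d) (Fin k) ℝ} {Ws W : Matrix (Fin k) (Fin T) ℝ}
    {P : Matrix (Fin T) (Fin k) ℝ} (hP : Ws * P = 1)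
    (hPn : ∀ r : Fin T → ℝ, q * ∑ j, (r ᵥ* P) j ^ 2 ≤ ∑ t, r t ^ 2)
    {ω : Fin n → (Fin d → ℝ) × ℝ} (hG : TargetGood p Bs τ B ω) (hn : 0 < n)
    {ŵ : (Fin k → ℝ) → Fin k → ℝ}
    (hmin : ∀ w, IsTargetMinimizer (targetSample Bs w ω) B (ŵ w)) :
    Integrable (fun w => excessRisk p σ Bs w B (ŵ w)) ν ∧
    ∫ w, excessRisk p σ Bs w B (ŵ w) ∂ν ≤
      6 * (s / q * ∑ t, (B * W - Bs * Ws)ᵀ t ⬝ᵥ (secondMoment p *ᵥ (B * W - Bs * Ws)ᵀ t)) +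
        8 * τ / n := by
  have hprob := hp.isProbabilityMeasure
  obtain ⟨S, hS⟩ := hp.exists_sqrt
  obtain ⟨L, hL⟩ := hG.exists_linear hn hS
  obtain ⟨hint, hle⟩ := integral_transfer_le (Bs := Bs) (B := B) (W := W) hν hs hq h hP hPn hS
  have hER : ∀ w, excessRisk p σ Bs w B (ŵ w) =
      1 / 2 * ((Bs *ᵥ w - B *ᵥ ŵ w) ⬝ᵥ (secondMoment p *ᵥ (Bs *ᵥ w - B *ᵥ ŵ w))) := fun w =>
    excessRisk_eq hp.memLp σ Bs B w (ŵ w)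
  have hbound : ∀ w, excessRisk p σ Bs w B (ŵ w) ≤
      6 * ((Bs *ᵥ w - B *ᵥ ((W * P) *ᵥ w)) ⬝ᵥ
        (secondMoment p *ᵥ (Bs *ᵥ w - B *ᵥ ((W * P) *ᵥ w)))) + 8 * τ / n := by
    intro w
    have := hG.error_le hn (hmin w) ((W * P) *ᵥ w)
    rw [hER]
    have e : 8 * τ / n = 1 / 2 * (16 * τ / n) := by ring
    rw [e]
    linarith
  have hnonneg : ∀ w, 0 ≤ excessRisk p σ Bs w B (ŵ w) := by
    intro w
    rw [hER, hS]
    positivity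
  have hmeas : Measurable fun w => excessRisk p σ Bs w B (ŵ w) := by
    have e : (fun w => excessRisk p σ Bs w B (ŵ w)) = fun w => 1 / 2 * ∑ i,
        (S *ᵥ (Bs *ᵥ w - B *ᵥ L fun i => (Bs *ᵥ w) ⬝ᵥ (ω i).1 + (ω i).2)) i ^ 2 := by
      ext w
      rw [hER, hS, hL w (ŵ w) (hmin w)]
    rw [e]
    have hLc : Continuous L := L.continuous_of_finiteDimensional
    have hy : Continuous fun (w : Fin k → ℝ) (i : Fin n) =>
        (Bs *ᵥ w) ⬝ᵥ (ω i).1 + (ω i).2 := by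
      simp only [dotProduct, mulVec]
      fun_prop
    have hLy := hLc.comp hy
    refine Continuous.measurable ?_
    refine continuous_const.mul (continuous_finsetSum _ fun i _ => Continuous.pow ?_ 2)
    have h1 : Continuous fun w : Fin k → ℝ =>
        S *ᵥ (Bs *ᵥ w - B *ᵥ L fun i => (Bs *ᵥ w) ⬝ᵥ (ω i).1 + (ω i).2) :=
      continuous_const.matrix_mulVec ((continuous_const.matrix_mulVec continuous_id).sub
        (continuous_const.matrix_mulVec hLy))
    exact (continuous_apply i).comp h1
  have hdomint := (hint.const_mul 6).add (integrable_const (8 * τ / n))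
  have hI : Integrable (fun w => excessRisk p σ Bs w B (ŵ w)) ν := by
    refine hdomint.mono' hmeas.aestronglyMeasurable (Filter.Eventually.of_forall fun w => ?_)
    rw [Real.norm_of_nonneg (hnonneg w)]
    exact hbound w
  refine ⟨hI, (integral_mono hI hdomint hbound).trans ?_⟩
  simp only [Pi.add_apply]
  rw [integral_add (hint.const_mul 6) (integrable_const _), integral_const_mul]
  simp only [integral_const, probReal_univ, smul_eq_mul, one_mul]
  linarith

/-! ### Combination of the two stages -/

theorem log_four_div {δ : ℝ} (hδ : 0 < δ) : Real.log (4 / δ) ≤ 1.4 + Real.log (1 / δ) := by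
  have h4 : Real.log 4 = 2 * Real.log 2 := by
    rw [show (4 : ℝ) = 2 ^ 2 by norm_num, Real.log_pow]
    norm_num
  rw [Real.log_div (by norm_num) hδ.ne', Real.log_div one_ne_zero hδ.ne', Real.log_one, h4]
  linarith [Real.log_two_lt_d9]

/-- Final arithmetic: the transferred source error and the target noise combine into the rate. The
source terms `k / m` and `l / (m T)`, `m = c n₁`, are absorbed into `(k + l) / n` as `n ≤ m`. -/
theorem transfer_add_noise_le {K E V k T n m G l τ : ℝ} (hK : 0 ≤ K) (hV : 0 ≤ V) (hk : 0 ≤ k)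
    (hT : 1 ≤ T) (hn : 0 < n) (hnm : n ≤ m) (hG : 0 ≤ G) (hl : 0 ≤ l)
    (hE : m * E ≤ 1024 * (V * (k * T + G + l))) (hτ : 8 * τ ≤ 80 * (V * (k + l))) :
    6 * (K * (E / T)) + 8 * τ / n ≤
      (6144 * K + 80) * (V * (G / (m * T) + (k + l) / n)) := by
  have hm : 0 < m := hn.trans_le hnm
  have hT0 : 0 < T := by linarith
  have h1 : k / m ≤ k / n := by gcongr
  have h2 : l / (m * T) ≤ l / n := by
    gcongr
    exact hnm.trans (le_mul_of_one_le_right hm.le hT)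
  have h3 : E / T ≤ 1024 * (V * (k / m + G / (m * T) + l / (m * T))) := by
    have e : 1024 * (V * (k / m + G / (m * T) + l / (m * T))) =
        1024 * (V * (k * T + G + l)) / m / T := by field_simp
    rw [e]
    gcongr
    rwa [le_div_iff₀' hm]
  have h4 : E / T ≤ 1024 * (V * (G / (m * T) + (k + l) / n)) := by
    refine h3.trans ?_
    gcongr 1024 * (V * ?_)
    rw [add_div]
    linarith
  have h5 : 8 * τ / n ≤ 80 * (V * (G / (m * T) + (k + l) / n)) := by
    calc 8 * τ / n ≤ 80 * (V * (k + l)) / n := by gcongr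
      _ = 80 * (V * ((k + l) / n)) := by ring
      _ ≤ _ := by
        gcongr
        exact le_add_of_nonneg_left (by positivity)
  calc 6 * (K * (E / T)) + 8 * τ / n
      ≤ 6 * (K * (1024 * (V * (G / (m * T) + (k + l) / n)))) +
        80 * (V * (G / (m * T) + (k + l) / n)) := by gcongr
    _ = _ := by ring

theorem theorem4p1 :
    -- `C₀` is the universal constant of the sample size conditions; `C` may depend only on the
    -- constants `c₁`, `C₂` of the two task diversity assumptions
    ∃ C₀ : ℝ, 0 < C₀ ∧ ∀ c₁ C₂ : ℝ, 0 < c₁ → 0 < C₂ → ∃ C : ℝ, 0 < C ∧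
      ∀ (d k T n₁ n₂ : ℕ) (δ c : ℝ) (ρ σ : ℝ≥0)
        -- input distributions of the source tasks and of the target task
        (p : Fin T → Measure (Fin d → ℝ)) (p₀ : Measure (Fin d → ℝ))
        -- ground truth
        (Bs : Matrix (Fin d) (Fin k) ℝ) (Ws : Matrix (Fin k) (Fin T) ℝ)
        (ν : Measure (Fin k → ℝ))
        -- the learning algorithm
        (Bhat : SourceData d T n₁ → Matrix (Fin d) (Fin k) ℝ)
        (What : SourceData d T n₁ → Matrix (Fin k) (Fin T) ℝ)
        (what : Matrix (Fin d) (Fin k) ℝ → TargetData d n₂ → Fin k → ℝ),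
        0 < δ → δ < 1 → 0 < c →
        1 ≤ k → 2 * k ≤ min d T →
        -- subgaussian inputs
        (∀ t, IsSubgaussianInput ρ (p t)) → IsSubgaussianInput ρ p₀ →
        -- the source covariances are nondegenerate, so that `κ` is finite
        (∀ t, (secondMoment (p t)).PosDef) →
        -- covariance dominance
        (∀ t, (secondMoment (p t) - c • secondMoment p₀).PosSemidef) →
        -- diverse source tasks: `σ_k(W*)² ≥ c₁ T / k` (singular values are indexed from `0`)
        c₁ * ((T : ℝ) / k) ≤ (Matrix.toEuclideanLin Ws).singularValues (k - 1) ^ 2 →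
        -- distribution of the target predictor: `‖E[w wᵀ]‖ ≤ C₂ / k` in operator norm
        IsProbabilityMeasure ν → (∀ j, MemLp (fun w : Fin k → ℝ => w j) 2 ν) →
        ‖Matrix.toEuclideanCLM (𝕜 := ℝ) (secondMoment ν)‖ ≤ C₂ / k →
        -- sample sizes
        C₀ * ((ρ : ℝ) ^ 4 * (d + Real.log (T / δ))) ≤ n₁ →
        C₀ * ((ρ : ℝ) ^ 4 * (k + Real.log (1 / δ))) ≤ n₂ →
        (n₂ : ℝ) ≤ c * n₁ →
        -- the representation is learned from the source data by least squares
        (∀ i j, Measurable fun D => Bhat D i j) →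
        (∀ D, (∃ B W, IsSourceMinimizer (k := k) D B W) →
          IsSourceMinimizer D (Bhat D) (What D)) →
        -- the target predictor is learned by least squares on top of the representation
        (∀ B D, IsTargetMinimizer D B (what B D)) →
        ((sourceLaw n₁ p Bs Ws σ).prod (targetNoiseLaw n₂ p₀ σ))
          {ω | ¬ (Integrable (fun w => excessRisk p₀ σ Bs w (Bhat ω.1)
                    (what (Bhat ω.1) (targetSample Bs w ω.2))) ν ∧
                  ∫ w, excessRisk p₀ σ Bs w (Bhat ω.1)
                    (what (Bhat ω.1) (targetSample Bs w ω.2)) ∂ν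
                  ≤ C * ((σ : ℝ) ^ 2 *
                      ((k : ℝ) * d * Real.log (kappa p * n₁) / (c * n₁ * T)
                        + (k + Real.log (1 / δ)) / n₂)))}
          ≤ ENNReal.ofReal δ := by
  refine ⟨4000000, by norm_num, fun c₁ C₂ hc₁ hC₂ => ⟨6144 * (C₂ / c₁) + 80, by positivity, ?_⟩⟩
  intro d k T n₁ n₂ δ c ρ σ p p₀ Bs Ws ν Bhat What what hδ hδ1 hc hk hkd hp hp₀ hpd hdom hsing
    hνp hν hνn hn₁ hn₂ hcn hBm hmin htmin
  have hkT : 2 * k ≤ T := hkd.trans (min_le_right _ _)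
  have hkd' : 2 * k ≤ d := hkd.trans (min_le_left _ _)
  have hT : 0 < T := by omega
  have hd : 0 < d := by omega
  have hTr : (1 : ℝ) ≤ T := by exact_mod_cast hT
  have hkr : (1 : ℝ) ≤ k := by exact_mod_cast hk
  have hprob : ∀ t, IsProbabilityMeasure (p t) := fun t => (hp t).isProbabilityMeasure
  have hprob₀ := hp₀.isProbabilityMeasure
  have hl : 0 ≤ Real.log (1 / δ) := Real.log_nonneg (by rw [le_div_iff₀ hδ]; linarith)
  have hρ4 : (1 / 4 : ℝ) ≤ (ρ : ℝ) ^ 4 := by nlinarith [hp₀.half_le hd]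
  have hn₂r : (0 : ℝ) < n₂ := by
    refine lt_of_lt_of_le ?_ hn₂
    positivity
  have hn₂0 : 0 < n₂ := by exact_mod_cast hn₂r
  have hcn0 : 0 < c * n₁ := hn₂r.trans_le hcn
  have hn₁r : (1 : ℝ) ≤ n₁ := by
    have : (0 : ℝ) < n₁ := by
      by_contra hcon
      push Not at hcon
      nlinarith
    exact_mod_cast this
  have hlogκ : 0 ≤ Real.log (kappa p * n₁) := by
    obtain ⟨a, b, hb, hba, hκ, -⟩ := exists_kappa_bounds hd hT p hpd
    have hκ1 : 1 ≤ kappa p := by rw [hκ, le_div_iff₀ hb]; linarith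
    exact Real.log_nonneg (one_le_mul_of_one_le_of_one_le hκ1 hn₁r)
  have hl4 := log_four_div hδ
  have h4 : 1 / (δ / 4) = 4 / δ := by field_simp
  obtain ⟨P, hP, hPn⟩ := exists_right_inverse_of_le_singularValues hk (by omega) Ws
    (by positivity) hsing
  -- the target stage is run at level `δ / 4` and fails with probability at most `2 (δ / 4)`
  set τ : ℝ := (σ : ℝ) ^ 2 * (4 * (k + Real.log (1 / (δ / 4)))) with hτ
  set A : Set (SourceData d T n₁) := {D | ¬ ((∃ (B : Matrix (Fin d) (Fin k) ℝ)
      (W : Matrix (Fin k) (Fin T) ℝ), IsSourceMinimizer D B W) ∧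
      ∀ (B : Matrix (Fin d) (Fin k) ℝ) (W : Matrix (Fin k) (Fin T) ℝ), IsSourceMinimizer D B W →
        c * n₁ * ∑ t, (B * W - Bs * Ws)ᵀ t ⬝ᵥ (secondMoment p₀ *ᵥ (B * W - Bs * Ws)ᵀ t) ≤
          1024 * ((σ : ℝ) ^ 2 *
            (k * T + k * d * Real.log (kappa p * n₁) + Real.log (1 / δ))))} with hA
  have hAle : sourceLaw n₁ p Bs Ws σ A ≤ ENNReal.ofReal (δ / 2) :=
    sourceLaw_prediction_error_le Bs Ws hδ hδ1 hk hkd hp hpd hdom hn₁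
  have hprobS : IsProbabilityMeasure (sourceLaw n₁ p Bs Ws σ) := by
    unfold sourceLaw; infer_instance
  have hprobT : IsProbabilityMeasure (targetNoiseLaw n₂ p₀ σ) := by
    unfold targetNoiseLaw; infer_instance
  -- `Bhat` is measurable in the source data, and independent of the target data
  have hGmeas : MeasurableSet {ω : SourceData d T n₁ × (Fin n₂ → (Fin d → ℝ) × ℝ) |
      TargetGood p₀ Bs τ (Bhat ω.1) ω.2} := by
    have hf : Measurable fun ω : SourceData d T n₁ × (Fin n₂ → (Fin d → ℝ) × ℝ) =>
        ((fun i j => Bhat ω.1 i j : Fin d → Fin k → ℝ), ω.2) :=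
      (measurable_pi_lambda _ fun i => measurable_pi_lambda _ fun j =>
        (hBm i j).comp measurable_fst).prodMk measurable_snd
    exact hf (isClosed_targetGood p₀ Bs τ).measurableSet
  have hG : ((sourceLaw n₁ p Bs Ws σ).prod (targetNoiseLaw n₂ p₀ σ))
      {ω | TargetGood p₀ Bs τ (Bhat ω.1) ω.2}ᶜ ≤ ENNReal.ofReal (δ / 2) := by
    refine prod_le_of_forall_preimage_le _ _ hGmeas.compl fun D => ?_
    have hn : 1000000 * ((ρ : ℝ) ^ 4 * ((2 * k : ℕ) + Real.log (1 / (δ / 4)))) ≤ n₂ := by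
      refine le_trans ?_ hn₂
      rw [h4]
      push_cast
      have : 2 * (k : ℝ) + Real.log (4 / δ) ≤ 4 * (k + Real.log (1 / δ)) := by linarith
      nlinarith [mul_le_mul_of_nonneg_left this (by positivity : 0 ≤ (ρ : ℝ) ^ 4)]
    have := targetNoiseLaw_targetGood_compl_le hp₀ hd (by omega) Bs (Bhat D) σ
      (by positivity : 0 < δ / 4) (by linarith) hn
    rwa [show 2 * (δ / 4) = δ / 2 by ring] at this
  refine (measure_mono (t := A ×ˢ Set.univ ∪
    {ω | TargetGood p₀ Bs τ (Bhat ω.1) ω.2}ᶜ) ?_).trans ((measure_union_le _ _).trans ?_)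
  swap
  · rw [Measure.prod_prod, measure_univ, mul_one]
    refine (add_le_add hAle hG).trans (le_of_eq ?_)
    rw [← ENNReal.ofReal_add (by positivity) (by positivity), add_halves]
  rintro ⟨D, ω⟩ hω
  by_contra hcon
  simp only [Set.mem_union, Set.mem_prod, Set.mem_univ, and_true, Set.mem_compl_iff, not_or,
    not_not, Set.mem_ofPred_eq, hA] at hcon
  obtain ⟨⟨hex, hsrc⟩, hgood⟩ := hcon
  refine hω ?_
  obtain ⟨hint, hle⟩ := hgood.integrable_excessRisk_and_integral_le (W := What D) hp₀ σ hν
    (s := C₂ / k) (q := c₁ * (T / k)) (by positivity) (by positivity) hνn hP hPn hn₂0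
    (ŵ := fun w => what (Bhat D) (targetSample Bs w ω)) (fun w => htmin _ _)
  refine ⟨hint, hle.trans ?_⟩
  have hE := hsrc _ _ (hmin D hex)
  have hratio : ∀ E : ℝ, C₂ / k / (c₁ * (T / k)) * E = C₂ / c₁ * (E / T) := fun E => by
    field_simp
  rw [hratio]
  refine transfer_add_noise_le (by positivity) (by positivity) (by positivity) hTr hn₂r hcn
    (by positivity) hl hE ?_
  have h32 : 32 * (k + Real.log (4 / δ)) ≤ 80 * (k + Real.log (1 / δ)) := by linarith
  rw [hτ, h4]
  linarith [mul_le_mul_of_nonneg_left h32 (by positivity : 0 ≤ (σ : ℝ) ^ 2)]
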